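/- A solid torus in $\mathbb S^3$ is *unknotted* if it is the image of the standard solid torus $\{x\in\mathbb S^3: x_0^2+x_1^2\le \frac12\}$ under a homeomorphism of $\mathbb S^3$. Let $P\subset\mathbb S^3$ be an unknotted solid torus and let $f:\mathbb S^3\to\mathbb S^3$ be an orientation-preserving homeomorphism with $f(P)\subset \operatorname{int}P$ (so $f(P)$ is again an unknotted solid torus). Put $X=P\setminus \operatorname{int} f(P)$. Let $\Gamma$ be a tame proper arc in $X$ with one end on $\partial P$ and the other on $\partial f(P)$, and let $N\cong D^2\times[0,1]$ be a regular neighbourhood of $\Gamma$ in $X$, meeting $\partial f(P)$ and $\partial P$ exactly in the end discs $D^2\times\{0\}$ and $D^2\times\{1\}$; assume that $f(\partial P\cap N)=\partial f(P)\cap N$. Let $X^*=X\setminus\operatorname{int}N$, the interior being taken relative to $X$, and let $M^*=X^*/f$ be the quotient space of $X^*$ obtained by identifying $x$ with $f(x)$ for every $x\in\partial P\cap X^*$. Let $S^*\subset M^*$ be the image of $\partial P\cap X^*$. Let $\widetilde M^*_{S^*}$ be the quotient of $\mathbb Z\times X^*$ by the identifications $(k,f(x))\sim(k+1,x)$ for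 $k\in\mathbb Z$ and $x\in\partial P\cap X^*$, with projection $(k,x)\mapsto [x]$ to $M^*$, and let $\tau(k,x)=(k+1,x)$. Then: 1. $M^*$ is a compact (orientable, topological) 3-manifold whose boundary is a torus. 2. $\widetilde M^*_{S^*}\to M^*$ is an infinite cyclic cover (a connected covering on whose fibres the infinite cyclic group generated by the deck transformation $\tau$ acts simply transitively), and $(\widetilde M^*_{S^*},\tau)\subset(\mathbb S^3,f)$, that is, there is a topological embedding $e:\widetilde M^*_{S^*}\to\mathbb S^3$ with $e\circ\tau=f\circ e$. 3. In particular, if $M^*$ is homeomorphic to the exterior $E(k)$ of a tame knot $k\subset\mathbb S^3$, then $k$ has Property DIE: there are a homeomorphism $g$ of $\mathbb S^3$ and a topological embedding $e'$ of the infinite cyclic cover $\widetilde E(k)$ in $\mathbb S^3$ with $e'\circ\tau_k=g\circ e'$, where $\tau_k$ is a generator of the deck transformation group of $\widetilde E(k)$. -/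

import Mathlib

open Set Metric Topology Manifold

/-- The plane. -/
abbrev E2 : Type := EuclideanSpace ℝ (Fin 2)

/-- Euclidean three-space. -/
abbrev E3 : Type := EuclideanSpace ℝ (Fin 3)

/-- The 3-sphere, as the unit sphere of Euclidean four-space. -/
abbrev S3 : Type := sphere (0 : EuclideanSpace ℝ (Fin 4)) 1

/-! ### Orientations of topological 3-manifolds -/

/-- The local homeomorphism `g` of three-space preserves the orientation at the point `y` of its
source: it has local degree one there, that is, on a small sphere around `y` the map
`u ↦ g (y + ε u) - g y` is homotopic, as a map into `E3 ∖ {0}`, to the inclusion of the unit sphere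
(by Hopf's theorem homotopy classes of such maps are classified by the degree). -/
def PreservesOrientationAt (g : OpenPartialHomeomorph E3 E3) (y : E3) : Prop :=
  ∃ ε : ℝ, 0 < ε ∧ closedBall y ε ⊆ g.source ∧
    ∃ H : C(unitInterval × sphere (0 : E3) 1, E3),
      (∀ z, H z ≠ 0) ∧
      (∀ u : sphere (0 : E3) 1, H (0, u) = (u : E3)) ∧
      (∀ u : sphere (0 : E3) 1, H (1, u) = g (y + ε • (u : E3)) - g y)

/-- `A` is an oriented atlas of the (boundaryless) 3-manifold `W`: its charts cover `W` and all
transition maps preserve the orientation. -/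
def IsOrientedAtlas {W : Type*} [TopologicalSpace W] (A : Set (OpenPartialHomeomorph W E3)) :
    Prop :=
  (∀ x : W, ∃ φ ∈ A, x ∈ φ.source) ∧
  ∀ φ ∈ A, ∀ ψ ∈ A, ∀ y ∈ (φ.symm.trans ψ).source,
    PreservesOrientationAt (φ.symm.trans ψ) y

/-- A homeomorphism of the 3-sphere is orientation preserving: with respect to an oriented atlas
of the 3-sphere (any two of which agree up to a global sign), it preserves the orientation in
all charts. -/
def OrientationPreserving (f : S3 ≃ₜ S3) : Prop :=
  ∃ A : Set (OpenPartialHomeomorph S3 E3), IsOrientedAtlas A ∧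
    ∀ φ ∈ A, ∀ ψ ∈ A, ∀ y ∈ ((φ.symm.trans f.toOpenPartialHomeomorph).trans ψ).source,
      PreservesOrientationAt ((φ.symm.trans f.toOpenPartialHomeomorph).trans ψ) y

/-- `W` is a compact orientable topological 3-manifold whose boundary is a torus. The interior and
the boundary are those of an atlas modelled on the closed half-space (by invariance of domain
they do not depend on it); a manifold with boundary is orientable if its interior is. -/
def IsCompactThreeManifoldWithTorusBoundary (W : Type) [TopologicalSpace W] : Prop :=
  CompactSpace W ∧ T2Space W ∧ SecondCountableTopology W ∧
  ∃ _ : ChartedSpace (EuclideanHalfSpace 3) W,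
    (∃ A : Set (OpenPartialHomeomorph ((𝓡∂ 3).interior W) E3), IsOrientedAtlas A) ∧
    Nonempty ((𝓡∂ 3).boundary W ≃ₜ Circle × Circle)

/-! ### Infinite cyclic covers and embeddings of dynamical systems -/

/-- `p : C → B` is an infinite cyclic cover with generating deck transformation `τ`: a connected
covering on whose fibres the infinite cyclic group generated by `τ` acts simply transitively. -/
def IsInfiniteCyclicCover {C B : Type} [TopologicalSpace C] [TopologicalSpace B]
    (p : C → B) (τ : C ≃ₜ C) : Prop :=
  ConnectedSpace C ∧ IsCoveringMap p ∧ Function.Surjective p ∧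
  (∀ x, p (τ x) = p x) ∧
  (∀ x y, p x = p y → ∃ n : ℤ, (τ ^ n) x = y) ∧
  (∀ (x : C) (n : ℤ), (τ ^ n) x = x → n = 0)

/-- The dynamical system `(C, g)` embeds into the dynamical system `(Y, f)`. -/
def DynEmbeds {C Y : Type} [TopologicalSpace C] [TopologicalSpace Y] (g : C → C) (f : Y → Y) :
    Prop :=
  ∃ e : C → Y, IsEmbedding e ∧ ∀ x, e (g x) = f (e x)

/-! ### Knots -/

/-- `K` is a (tame) knot in the 3-sphere and `E` is its exterior, the complement of the interior of
a tubular neighbourhood `S¹ × D²` of `K`; that `ν` is defined on a larger open solid torus says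
that the tubular neighbourhood is tame. -/
def IsKnotWithExterior (K E : Set S3) : Prop :=
  ∃ ν : Circle × ball (0 : E2) 2 → S3, IsOpenEmbedding ν ∧
    K = ν '' {z | (z.2 : E2) = 0} ∧ E = (ν '' {z | ‖(z.2 : E2)‖ < 1})ᶜ

/-- Property DIE of a knot `K`: the infinite cyclic cover of the exterior of `K`, with its deck
transformation, embeds into a dynamical system on the 3-sphere. (The exterior is unique up to
homeomorphism, its infinite cyclic cover is unique up to isomorphism, and the generating
deck transformation up to inversion.) -/
def HasPropertyDIE (K : Set S3) : Prop :=
  ∃ E : Set S3, IsKnotWithExterior K E ∧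
    ∃ (C : Type) (_ : TopologicalSpace C) (p : C → E) (τ : C ≃ₜ C),
      IsInfiniteCyclicCover p τ ∧ ∃ f : S3 ≃ₜ S3, DynEmbeds τ f

/-! ### The construction -/

/-- The standard unknotted solid torus in the 3-sphere, one half of the genus one splitting. -/
def standardSolidTorus : Set S3 :=
  {x | (x : EuclideanSpace ℝ (Fin 4)) 0 ^ 2 + (x : EuclideanSpace ℝ (Fin 4)) 1 ^ 2 ≤ 1 / 2}

/-- Unknotted solid tori: the images of the standard one under homeomorphisms of the 3-sphere. -/
def IsUnknottedSolidTorus (P : Set S3) : Prop :=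
  ∃ φ : S3 ≃ₜ S3, P = φ '' standardSolidTorus

/-- `X = P ∖ f(P)`, where the interior of `f(P)` is removed. -/
def cutRegion (P : Set S3) (f : S3 ≃ₜ S3) : Set S3 := P \ interior (f '' P)

/-- `Γ` is a (tame) proper arc in `X` from `A` to `B`, parts of the boundary of `X`, and `N` is a
regular neighbourhood of `Γ` in `X`: a copy of `D² × [0,1]` with core `Γ` that meets `A` and `B`
in the two end discs. That `h` is defined on a larger open disc times `[0,1]`, as an open
embedding into `X`, expresses tameness. -/
def IsArcWithRegularNeighborhood (X A B Γ N : Set S3) : Prop :=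
  ∃ h : ball (0 : E2) 2 × unitInterval → X, IsOpenEmbedding h ∧
    (∀ z, (h z : S3) ∈ A ↔ z.2 = 0) ∧ (∀ z, (h z : S3) ∈ B ↔ z.2 = 1) ∧
    Γ = (fun z => (h z : S3)) '' {z | (z.1 : E2) = 0} ∧
    N = (fun z => (h z : S3)) '' {z | ‖(z.1 : E2)‖ ≤ 1}

/-- `X* = X ∖ N`, where the interior of `N` relative to `X` is removed. -/
def drilledRegion (X N : Set S3) : Set S3 :=
  X \ ((↑) '' interior ((↑) ⁻¹' N : Set X))

/-- `Z / f`: the quotient space of `Z` in which every point `x` of `Z ∩ A` is identified with its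
image `f x` in `Z`. For `Z = X*` and `A = ∂P` this is `M*`. -/
def Glued (Z A : Set S3) (f : S3 ≃ₜ S3) : Type :=
  Quot fun x y : Z => (x : S3) ∈ A ∧ f x = y

instance (Z A : Set S3) (f : S3 ≃ₜ S3) : TopologicalSpace (Glued Z A f) :=
  inferInstanceAs (TopologicalSpace (Quot _))

/-- The infinite cyclic cover of `Z / f` defined by the surface that is the image of `Z ∩ A`: take
countably many copies `{k} × Z` of `Z` and identify, for every `k`, the copy of `f (Z ∩ A)` in
`{k} × Z` with the copy of `Z ∩ A` in `{k + 1} × Z` by means of `f`. -/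
def GluedCover (Z A : Set S3) (f : S3 ≃ₜ S3) : Type :=
  Quot fun a b : ℤ × Z => b.1 = a.1 + 1 ∧ (b.2 : S3) ∈ A ∧ f b.2 = a.2

instance (Z A : Set S3) (f : S3 ≃ₜ S3) : TopologicalSpace (GluedCover Z A f) :=
  inferInstanceAs (TopologicalSpace (Quot _))

/-- The covering projection, which sends every copy of `Z` to `Z / f`. -/
def GluedCover.proj (Z A : Set S3) (f : S3 ≃ₜ S3) : GluedCover Z A f → Glued Z A f :=
  Quot.lift (fun a => Quot.mk _ a.2) fun _ _ h => (Quot.sound ⟨h.2.1, h.2.2⟩).symm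

/-- The shift by `m` copies. -/
def GluedCover.shift (Z A : Set S3) (f : S3 ≃ₜ S3) (m : ℤ) :
    GluedCover Z A f → GluedCover Z A f :=
  Quot.map (fun a => (a.1 + m, a.2)) fun _ _ h => ⟨by dsimp only; omega, h.2⟩

theorem GluedCover.continuous_shift (Z A : Set S3) (f : S3 ≃ₜ S3) (m : ℤ) :
    Continuous (GluedCover.shift Z A f m) :=
  continuous_quot_lift _ (continuous_quot_mk.comp (by fun_prop))

/-- The deck transformation `τ`: the shift that sends the copy `{k} × Z` to `{k + 1} × Z`. -/
def GluedCover.deck (Z A : Set S3) (f : S3 ≃ₜ S3) : GluedCover Z A f ≃ₜ GluedCover Z A f where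
  toFun := GluedCover.shift Z A f 1
  invFun := GluedCover.shift Z A f (-1)
  left_inv := by rintro ⟨a⟩; simp [GluedCover.shift, Quot.map]; rfl
  right_inv := by rintro ⟨a⟩; simp [GluedCover.shift, Quot.map]; rfl
  continuous_toFun := GluedCover.continuous_shift Z A f 1
  continuous_invFun := GluedCover.continuous_shift Z A f (-1)

/-!
The cut region `X = P ∖ int f(P)` is a fundamental domain for `f` on the set of points whose orbit
meets it: since `f(P)` lies in the interior of `P`, two of its translates `f ^ m (X)` and
`f ^ n (X)` meet only for `|m - n| ≤ 1`, and successive ones meet only along a translate of `∂P`.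
So `(k, x) ↦ f ^ k x` defines a map from the cover to the 3-sphere, the developing map. It
conjugates the deck transformation to `f`, is injective (`GluedCover.dev_injective`) and, as the
translates form a locally finite family, an embedding (`GluedCover.isEmbedding_dev`). The points
of `X` wander (`IsTrapping.exists_wandering`), so the deck group acts freely and properly
discontinuously; this makes the projection to `M*` a covering and `M*` Hausdorff. The cover is
connected because `X*` is: if two closed sets have connected union and connected intersection, then each of
them is connected, and this applies to `X` and `f(P)` in `P`, and to `X*` and the tube `N`
in `X`. The third claim follows by transporting the second along the homeomorphism.

For the first claim let `Y` be the image of the developing map, so that `M*` is the orbit space of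
`f` on `Y` (`GluedCover.isOrbitMap`). Interior points of `Y` give interior charts, and as
`f` preserves an oriented atlas of the 3-sphere, transition maps between such charts, which are
iterates of `f`, preserve the orientation (`IsOrbitMap.exists_orientedAtlas`). The other points of
`Y` lie on the translates of the lateral boundary of the tube. There the tube can be prolonged
through its end disc by the preimage of its beginning (`IsMatchedTube.tubeHomeo`), and polar
coordinates around the prolonged tube give boundary charts (`IsMatchedTube.exists_chart_longTube`).

Hence the boundary is the lateral cylinder `S¹ × [0,1]` with its ends glued by the restriction to
the circle of the return map `γ` of the disc, which is induced by `f` on the end discs.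
It is a torus rather than a Klein bottle because `γ` preserves the orientation of the circle
(`IsMatchedTube.exists_angle`): otherwise `γ` would be complex conjugation on the circle, up to a
homotopy of the angle, and in the coordinates of the prolonged tube `f` would be `γ × id` up to a
translation, whose links are homotopic to a reflection of the 2-sphere
(`not_hasLinkClass_cylinderMap`). A reflection is not homotopic to the identity
(`not_homotopic_reflectS2`); without homology at hand this is proved by parallel transport of
lines in `ℂ²` along the homotopy. The mapping torus of the orientation preserving `γ` is
untwisted explicitly by the maps `z ↦ z exp (i t ψ(z))`, where `γ(z) = z exp (i ψ(z))`.
-/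

/-! ### A reflection of the 2-sphere is not homotopic to the identity -/

/-- The unit sphere of three-space. -/
abbrev S2 : Type := sphere (0 : E3) 1

/-- The radial retraction of the plane onto the closed unit disc. -/
noncomputable def clipDisc : C(ℂ, closedBall (0 : ℂ) 1) where
  toFun z := ⟨(((max 1 ‖z‖)⁻¹ : ℝ) : ℂ) * z, by
    have h1 : (0 : ℝ) < max 1 ‖z‖ := lt_of_lt_of_le one_pos (le_max_left _ _)
    rw [mem_closedBall_zero_iff, norm_mul, Complex.norm_real, Real.norm_of_nonneg (by positivity),
      inv_mul_le_iff₀ h1]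
    simp⟩
  continuous_toFun := by
    refine Continuous.subtype_mk (Continuous.mul (Complex.continuous_ofReal.comp
      (Continuous.inv₀ (by fun_prop) fun z => ?_)) continuous_id) _
    exact (lt_of_lt_of_le one_pos (le_max_left _ _)).ne'

theorem clipDisc_of_norm_eq_one {z : ℂ} (hz : ‖z‖ = 1) :
    clipDisc z = ⟨z, by simp [hz]⟩ := by
  apply Subtype.ext
  simp [clipDisc, hz]

/-- The squaring map of the unit circle does not extend to a nonvanishing function on the disc. -/
theorem false_of_nonvanishing_of_eq_sq (l : C(closedBall (0 : ℂ) 1, ℂ)) (h0 : ∀ z, l z ≠ 0) (c : ℂ)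
    (hc : ∀ z : closedBall (0 : ℂ) 1, ‖(z : ℂ)‖ = 1 → l z = (z : ℂ) ^ 2 * c) : False := by
  let L : C(ℂ, {z : ℂ // z ≠ 0}) := ⟨fun z => ⟨l (clipDisc z), h0 _⟩, by fun_prop⟩
  obtain ⟨F, ⟨-, hF⟩, -⟩ := Complex.isCoveringMap_exp.existsUnique_continuousMap_lifts L 0
    (Complex.log (L 0)) (Subtype.ext (Complex.exp_log (L 0).2))
  have hF' : ∀ z, Complex.exp (F z) = l (clipDisc z) := fun z =>
    congrArg Subtype.val (congrFun hF z)
  have hexp : ∀ θ : ℝ, ‖Complex.exp (θ * Complex.I)‖ = 1 := Complex.norm_exp_ofReal_mul_I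
  -- A logarithm `F` of the function would differ from `2 i θ` by a constant on the circle.
  have hD : ∀ θ : ℝ, Complex.exp (F (Complex.exp (θ * Complex.I)) - 2 * (θ * Complex.I)) = c := by
    intro θ
    rw [Complex.exp_sub, hF', clipDisc_of_norm_eq_one (hexp θ), hc _ (hexp θ), two_mul,
      Complex.exp_add, pow_two]
    field_simp
  have hconst := Complex.isCoveringMap_exp.const_of_comp
    (g := fun θ : ℝ => F (Complex.exp (θ * Complex.I)) - 2 * (θ * Complex.I)) (by fun_prop)
    (fun a b => Subtype.ext ((hD a).trans (hD b).symm)) 0 (2 * Real.pi)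
  simp only [Complex.ofReal_zero, zero_mul, Complex.exp_zero, mul_zero, sub_zero,
    Complex.ofReal_mul, Complex.ofReal_ofNat, Complex.exp_two_pi_mul_I] at hconst
  have h2 : (2 : ℂ) * (2 * Real.pi * Complex.I) = 0 := by linear_combination hconst
  simp [Real.pi_ne_zero] at h2

/-- For a unit vector `y` of three-space, the projection of `ℂ²` onto the complex line that
corresponds to `y` under the identification of the 2-sphere with the projective line. -/
noncomputable def lineProj (y : E3) (v : ℂ × ℂ) : ℂ × ℂ :=
  (((1 + y 2) * v.1 + (y 0 - y 1 * Complex.I) * v.2) / 2,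
    ((y 0 + y 1 * Complex.I) * v.1 + (1 - y 2) * v.2) / 2)

theorem continuous_lineProj : Continuous fun q : E3 × (ℂ × ℂ) => lineProj q.1 q.2 := by
  unfold lineProj
  fun_prop

theorem E3.sum_sq {y : E3} (hy : ‖y‖ = 1) : y 0 ^ 2 + y 1 ^ 2 + y 2 ^ 2 = 1 := by
  have := EuclideanSpace.real_norm_sq_eq y
  rw [hy, Fin.sum_univ_three] at this
  linarith

theorem lineProj_lineProj {y : E3} (hy : ‖y‖ = 1) (v : ℂ × ℂ) :
    lineProj y (lineProj y v) = lineProj y v := by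
  have h : ((y 0 : ℂ)) ^ 2 + (y 1 : ℂ) ^ 2 + (y 2 : ℂ) ^ 2 = 1 := by
    rw [← Complex.ofReal_one, ← E3.sum_sq hy]; push_cast; rfl
  have hI := Complex.I_sq
  ext
  · simp only [lineProj]
    linear_combination (v.1 / 4) * h - (v.1 / 4) * (y 1 : ℂ) ^ 2 * hI
  · simp only [lineProj]
    linear_combination (v.2 / 4) * h - (v.2 / 4) * (y 1 : ℂ) ^ 2 * hI

/-- The lines of two points of the sphere that are not antipodal are not orthogonal. -/
theorem lineProj_ne_zero {y y' : E3} (h : ‖y - y'‖ < 2) {v : ℂ × ℂ} (hv : lineProj y' v = v)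
    (hv0 : v ≠ 0) : lineProj y v ≠ 0 := by
  intro h0
  apply hv0
  set d := y' - y with hd
  have hn : ‖d‖ ^ 2 = d 0 ^ 2 + d 1 ^ 2 + d 2 ^ 2 := by
    rw [EuclideanSpace.real_norm_sq_eq d, Fin.sum_univ_three]
  have hlt : d 0 ^ 2 + d 1 ^ 2 + d 2 ^ 2 < 4 := by
    rw [← hn, hd, norm_sub_rev]
    nlinarith [norm_nonneg (y - y')]
  have hne : (d 0 : ℂ) ^ 2 + (d 1 : ℂ) ^ 2 + (d 2 : ℂ) ^ 2 - 4 ≠ 0 := by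
    intro h4
    have : d 0 ^ 2 + d 1 ^ 2 + d 2 ^ 2 - 4 = 0 := by
      rw [← Complex.ofReal_eq_zero]; push_cast; exact h4
    linarith
  have e1 : 2 * v.1 = d 2 * v.1 + (d 0 - d 1 * Complex.I) * v.2 := by
    have a := congrArg Prod.fst hv
    have b := congrArg Prod.fst h0
    simp only [lineProj, Prod.fst_zero] at a b
    simp only [hd, PiLp.sub_apply, Complex.ofReal_sub]
    linear_combination -2 * a + 2 * b
  have e2 : 2 * v.2 = (d 0 + d 1 * Complex.I) * v.1 - d 2 * v.2 := by
    have a := congrArg Prod.snd hv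
    have b := congrArg Prod.snd h0
    simp only [lineProj, Prod.snd_zero] at a b
    simp only [hd, PiLp.sub_apply, Complex.ofReal_sub]
    linear_combination -2 * a + 2 * b
  have hI := Complex.I_sq
  ext
  · refine (mul_eq_zero.1 (?_ : _ * v.1 = 0)).resolve_left hne
    linear_combination (-2 - d 2) * e1 - (d 0 - d 1 * Complex.I) * e2 + (d 1 : ℂ) ^ 2 * v.1 * hI
  · refine (mul_eq_zero.1 (?_ : _ * v.2 = 0)).resolve_left hne
    linear_combination (-2 + d 2) * e2 - (d 0 + d 1 * Complex.I) * e1 + (d 1 : ℂ) ^ 2 * v.2 * hI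

/-- Parallel transport of a vector of `ℂ²` along a sequence of lines. -/
noncomputable def lineTransport (y : ℕ → E3) : ℕ → ℂ × ℂ → ℂ × ℂ
  | 0, w => w
  | k + 1, w => lineProj (y (k + 1)) (lineTransport y k w)

theorem lineTransport_smul (y : ℕ → E3) (k : ℕ) (c : ℂ) (w : ℂ × ℂ) :
    lineTransport y k (c • w) = c • lineTransport y k w := by
  induction k with
  | zero => rfl
  | succ k ih =>
    simp only [lineTransport, ih]
    ext <;> simp only [lineProj, Prod.smul_fst, Prod.smul_snd, smul_eq_mul] <;> ring

theorem continuous_lineTransport {T : Type*} [TopologicalSpace T] {y : T → ℕ → E3}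
    (hy : ∀ k, Continuous fun t => y t k) {w : T → ℂ × ℂ} (hw : Continuous w) (k : ℕ) :
    Continuous fun t => lineTransport (y t) k (w t) := by
  induction k with
  | zero => exact hw
  | succ k ih => exact continuous_lineProj.comp ((hy (k + 1)).prodMk ih)

theorem lineTransport_spec {y : ℕ → E3} (h1 : ∀ k, ‖y k‖ = 1) (h2 : ∀ k, ‖y (k + 1) - y k‖ < 2)
    {w : ℂ × ℂ} (hw : lineProj (y 0) w = w) (hw0 : w ≠ 0) (k : ℕ) :
    lineProj (y k) (lineTransport y k w) = lineTransport y k w ∧ lineTransport y k w ≠ 0 := by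
  induction k with
  | zero => exact ⟨hw, hw0⟩
  | succ k ih => exact ⟨lineProj_lineProj (h1 _) _, lineProj_ne_zero (h2 k) ih.1 ih.2⟩

/-- The reflection of the 2-sphere in the plane `x₁ = 0`. -/
noncomputable def reflectS2 : C(S2, S2) where
  toFun x := ⟨!₂[(x : E3) 0, -(x : E3) 1, (x : E3) 2], by
    have := E3.sum_sq (mem_sphere_zero_iff_norm.1 x.2)
    rw [mem_sphere_zero_iff_norm, EuclideanSpace.norm_eq, Fin.sum_univ_three]
    simpa using this⟩
  continuous_toFun := by
    refine Continuous.subtype_mk ?_ _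
    refine (PiLp.continuous_toLp 2 _).comp (continuous_pi fun i => ?_)
    fin_cases i <;> simp <;> fun_prop

/-- The height over the disc of a point of the 3-sphere in `ℂ × ℝ`. -/
noncomputable def discHeight (z : closedBall (0 : ℂ) 1) : ℝ := √(1 - ‖(z : ℂ)‖ ^ 2)

theorem discHeight_sq (z : closedBall (0 : ℂ) 1) : discHeight z ^ 2 = 1 - ‖(z : ℂ)‖ ^ 2 := by
  have h : ‖(z : ℂ)‖ ≤ 1 := mem_closedBall_zero_iff.1 z.2
  exact Real.sq_sqrt (by nlinarith [norm_nonneg (z : ℂ)])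

/-- The Hopf map on the disc of all `(z, s) ∈ ℂ²` of norm one with `s` real and nonnegative. -/
noncomputable def hopfDisc : C(closedBall (0 : ℂ) 1, S2) where
  toFun z := ⟨!₂[2 * discHeight z * (z : ℂ).re, -2 * discHeight z * (z : ℂ).im,
      2 * ‖(z : ℂ)‖ ^ 2 - 1], by
    have h1 := discHeight_sq z
    have h2 : ‖(z : ℂ)‖ ^ 2 = (z : ℂ).re ^ 2 + (z : ℂ).im ^ 2 := by
      rw [← Complex.normSq_eq_norm_sq, Complex.normSq_apply]; ring
    rw [mem_sphere_zero_iff_norm, EuclideanSpace.norm_eq, Fin.sum_univ_three, Real.sqrt_eq_one]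
    simp only [Real.norm_eq_abs, sq_abs]
    simp
    rw [h2] at h1 ⊢
    linear_combination (4 * ((z : ℂ).re ^ 2 + (z : ℂ).im ^ 2)) * h1⟩
  continuous_toFun := by
    refine Continuous.subtype_mk ?_ _
    refine (PiLp.continuous_toLp 2 _).comp (continuous_pi fun i => ?_)
    unfold discHeight
    fin_cases i <;> simp <;> fun_prop

theorem ofReal_norm_sq_eq (z : ℂ) : ((‖z‖ ^ 2 : ℝ) : ℂ) = z * (starRingEnd ℂ) z := by
  rw [Complex.mul_conj, Complex.normSq_eq_norm_sq]

theorem hopfDisc_line (z : closedBall (0 : ℂ) 1) :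
    lineProj (hopfDisc z) ((z : ℂ), (discHeight z : ℂ)) = ((z : ℂ), (discHeight z : ℂ)) := by
  have h1 : ((discHeight z : ℂ)) ^ 2 = 1 - ((‖(z : ℂ)‖ ^ 2 : ℝ) : ℂ) := by
    exact_mod_cast discHeight_sq z
  have h2 := ofReal_norm_sq_eq (z : ℂ)
  have h3 := Complex.re_add_im (z : ℂ)
  have h4 : (starRingEnd ℂ) (z : ℂ) = (z : ℂ).re - (z : ℂ).im * Complex.I := by
    apply Complex.ext <;> simp
  have hI := Complex.I_sq
  set s : ℂ := (discHeight z : ℂ)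
  rw [h4] at h2
  ext
  · simp only [lineProj, hopfDisc, ContinuousMap.coe_mk]
    simp
    push_cast at h1 h2
    linear_combination (z : ℂ) * h1 + s ^ 2 * h3
  · simp only [lineProj, hopfDisc, ContinuousMap.coe_mk]
    simp
    push_cast at h1 h2
    linear_combination (-s) * h2

/-- The line of the reflected point is the conjugate of the line of the point, so the bilinear
pairing of `ℂ²` between these two lines is nondegenerate. -/
theorem pairing_ne_zero (z : closedBall (0 : ℂ) 1) {u : ℂ × ℂ} (hu0 : u ≠ 0)
    (hu : lineProj (reflectS2 (hopfDisc z)) u = u) :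
    (z : ℂ) * u.1 + (discHeight z : ℂ) * u.2 ≠ 0 := by
  intro h0
  have h1 : ((discHeight z : ℂ)) ^ 2 = 1 - ((‖(z : ℂ)‖ ^ 2 : ℝ) : ℂ) := by
    exact_mod_cast discHeight_sq z
  have h2 := ofReal_norm_sq_eq (z : ℂ)
  have h3 := Complex.re_add_im (z : ℂ)
  have h4 : (starRingEnd ℂ) (z : ℂ) = (z : ℂ).re - (z : ℂ).im * Complex.I := by
    apply Complex.ext <;> simp
  set s : ℂ := (discHeight z : ℂ) with hs
  have a := congrArg Prod.fst hu
  have b := congrArg Prod.snd hu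
  simp only [lineProj, reflectS2, hopfDisc, ContinuousMap.coe_mk] at a b
  simp at a b
  rw [← hs] at a b
  push_cast at h1 h2
  apply hu0
  ext
  · change u.1 = 0
    linear_combination -a + (starRingEnd ℂ) (z : ℂ) * h0 + u.1 * h2 - s * u.2 * h4
  · change u.2 = 0
    linear_combination -b + s * h0 + s * u.1 * h3 - u.2 * h1

/-- The reflection has degree `-1`. A homotopy from the identity would, by parallel transport in the
tautological line bundle over the projective line, identify that bundle with its conjugate;
on a disc in the 3-sphere that is bounded by a fibre of the Hopf map this yields a nonvanishing
function which is a multiple of `z ↦ z ^ 2` on the boundary. -/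
theorem not_homotopic_reflectS2 : ¬ (ContinuousMap.id S2).Homotopic reflectS2 := by
  rintro ⟨H⟩
  have huc := CompactSpace.uniformContinuous_of_continuous H.continuous
  obtain ⟨δ, hδ, hH⟩ := Metric.uniformContinuous_iff.1 huc 2 two_pos
  obtain ⟨n, hn⟩ := exists_nat_one_div_lt hδ
  -- Subdivide the homotopy so finely that successive points are never antipodal.
  let t : ℕ → unitInterval := fun k =>
    Set.projIcc (0 : ℝ) 1 zero_le_one ((k : ℝ) * (1 / ((n : ℝ) + 1)))
  have t0 : t 0 = 0 := by simp [t, Set.projIcc_left]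
  have t1 : t (n + 1) = 1 := by
    have : ((n + 1 : ℕ) : ℝ) * (1 / ((n : ℝ) + 1)) = 1 := by push_cast; field_simp
    simp only [t, this, Set.projIcc_right]
    rfl
  have ht : ∀ k, dist (t (k + 1)) (t k) < δ := by
    intro k
    refine lt_of_le_of_lt ?_ hn
    have := (LipschitzWith.projIcc (zero_le_one' ℝ)).dist_le_mul
      (((k + 1 : ℕ) : ℝ) * (1 / ((n : ℝ) + 1))) ((k : ℝ) * (1 / ((n : ℝ) + 1)))
    refine this.trans_eq ?_
    rw [Real.dist_eq, ← sub_mul]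
    push_cast
    rw [add_sub_cancel_left, abs_of_nonneg (by positivity)]
    simp
  let y : S2 → ℕ → E3 := fun x k => (H (t k, x) : E3)
  have hy1 : ∀ x k, ‖y x k‖ = 1 := fun x k => mem_sphere_zero_iff_norm.1 (H (t k, x)).2
  have hy2 : ∀ x k, ‖y x (k + 1) - y x k‖ < 2 := fun x k => by
    rw [← dist_eq_norm]
    refine hH (a := (t (k + 1), x)) (b := (t k, x)) ?_
    rw [Prod.dist_eq, dist_self]
    exact max_lt (ht k) hδ
  -- `w` trivializes the tautological bundle over the disc, and `u` transports it to the conjugate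
  -- bundle; `w` rotates once along the boundary, whose points all lie over the same line.
  let w : closedBall (0 : ℂ) 1 → ℂ × ℂ := fun z => ((z : ℂ), (discHeight z : ℂ))
  let u : closedBall (0 : ℂ) 1 → ℂ × ℂ := fun z => lineTransport (y (hopfDisc z)) (n + 1) (w z)
  have hw : Continuous w := by unfold w discHeight; fun_prop
  have hu : Continuous u := continuous_lineTransport (fun k => by fun_prop) hw (n + 1)
  have hw0 : ∀ z, w z ≠ 0 := by
    intro z hz
    have a : (z : ℂ) = 0 := congrArg Prod.fst hz
    have b : discHeight z = 0 := by
      have := congrArg Prod.snd hz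
      simpa [w] using this
    have := discHeight_sq z
    rw [a, b] at this
    norm_num at this
  let l : C(closedBall (0 : ℂ) 1, ℂ) :=
    ⟨fun z => (z : ℂ) * (u z).1 + (discHeight z : ℂ) * (u z).2, by
      unfold discHeight; fun_prop⟩
  let e : closedBall (0 : ℂ) 1 := ⟨1, by simp⟩
  refine false_of_nonvanishing_of_eq_sq l (fun z => ?_) (l e) fun z hz => ?_
  · have hs := lineTransport_spec (hy1 (hopfDisc z)) (hy2 (hopfDisc z)) (w := w z) (by
      simp only [y, t0, H.apply_zero]
      exact hopfDisc_line z) (hw0 z) (n + 1)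
    refine pairing_ne_zero z hs.2 ?_
    have := hs.1
    simp only [y, t1, H.apply_one] at this
    exact this
  · have key : ∀ z : closedBall (0 : ℂ) 1, ‖(z : ℂ)‖ = 1 → discHeight z = 0 := by
      intro z hz
      simp [discHeight, hz]
    have he : ‖(e : ℂ)‖ = 1 := by simp [e]
    have hh : hopfDisc z = hopfDisc e := by
      apply Subtype.ext
      simp only [hopfDisc, ContinuousMap.coe_mk]
      rw [key z hz, key e he, hz, he]
      simp
    have hwz : w z = (z : ℂ) • w e := by
      simp only [w]
      rw [key z hz, key e he]
      simp [e]
    have huz : u z = (z : ℂ) • u e := by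
      simp only [u]
      rw [hh, hwz, lineTransport_smul]
    change (z : ℂ) * (u z).1 + (discHeight z : ℂ) * (u z).2 =
      (z : ℂ) ^ 2 * ((e : ℂ) * (u e).1 + (discHeight e : ℂ) * (u e).2)
    rw [huz, key z hz, key e he]
    simp [e]
    ring

/-! ### The local homotopy class of a map of three-space -/

/-- The unit vector in the direction of `v`. -/
noncomputable def unitVec (v : E3) : E3 := ‖v‖⁻¹ • v

theorem norm_unitVec {v : E3} (hv : v ≠ 0) : ‖unitVec v‖ = 1 := by
  simpa [unitVec] using norm_smul_inv_norm (𝕜 := ℝ) hv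

theorem unitVec_coe (u : S2) : unitVec (u : E3) = u := by
  simp [unitVec, mem_sphere_zero_iff_norm.1 u.2]

theorem S2.coe_ne_zero (u : S2) : (u : E3) ≠ 0 := by
  intro h
  have := mem_sphere_zero_iff_norm.1 u.2
  simp [h] at this

/-- A continuous family of nonvanishing vector fields along the sphere, normalized, is a
homotopy. -/
theorem homotopic_of_nonvanishing {m₀ m₁ : C(S2, S2)} (F : unitInterval × S2 → E3)
    (hF : Continuous F) (h0 : ∀ q, F q ≠ 0) (hm₀ : ∀ u, (m₀ u : E3) = unitVec (F (0, u)))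
    (hm₁ : ∀ u, (m₁ u : E3) = unitVec (F (1, u))) : m₀.Homotopic m₁ :=
  ⟨{ toFun := fun q => ⟨unitVec (F q), mem_sphere_zero_iff_norm.2 (norm_unitVec (h0 q))⟩
     continuous_toFun := by
       refine Continuous.subtype_mk ?_ _
       exact (hF.norm.inv₀ fun q => norm_ne_zero_iff.2 (h0 q)).smul hF
     map_zero_left := fun u => Subtype.ext (hm₀ u).symm
     map_one_left := fun u => Subtype.ext (hm₁ u).symm }⟩

/-- `m` is the map of the sphere that `g` induces on the sphere of radius `ε` about `y`. -/
def IsLink (g : E3 → E3) (y : E3) (ε : ℝ) (m : C(S2, S2)) : Prop :=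
  ∀ u : S2, (m u : E3) = unitVec (g (y + ε • (u : E3)) - g y)

theorem add_smul_mem_closedBall (y : E3) {r ε : ℝ} (hr : 0 ≤ r) (h : r ≤ ε) (u : S2) :
    y + r • (u : E3) ∈ closedBall y ε := by
  rw [mem_closedBall, dist_eq_norm, add_sub_cancel_left, norm_smul,
    mem_sphere_zero_iff_norm.1 u.2, Real.norm_of_nonneg hr, mul_one]
  exact h

theorem link_ne_zero {g : E3 → E3} {y : E3} {ε r : ℝ} (hi : InjOn g (closedBall y ε)) (hr : 0 < r)
    (h : r ≤ ε) (u : S2) : g (y + r • (u : E3)) - g y ≠ 0 := by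
  rw [sub_ne_zero]
  intro he
  have := hi (add_smul_mem_closedBall y hr.le h u) (mem_closedBall_self (hr.le.trans h)) he
  rw [add_eq_left, smul_eq_zero] at this
  exact this.elim hr.ne' (S2.coe_ne_zero u)

theorem exists_isLink {g : E3 → E3} {y : E3} {ε : ℝ} (hε : 0 < ε)
    (hc : ContinuousOn g (closedBall y ε)) (hi : InjOn g (closedBall y ε)) :
    ∃ m, IsLink g y ε m := by
  have hF : Continuous fun u : S2 => g (y + ε • (u : E3)) - g y :=
    (hc.comp_continuous (by fun_prop)
      fun u => add_smul_mem_closedBall y hε.le le_rfl u).sub continuous_const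
  have h0 := fun u : S2 => link_ne_zero hi hε le_rfl u
  exact ⟨⟨fun u => ⟨_, mem_sphere_zero_iff_norm.2 (norm_unitVec (h0 u))⟩,
    Continuous.subtype_mk ((hF.norm.inv₀ fun q => norm_ne_zero_iff.2 (h0 q)).smul hF) _⟩,
    fun u => rfl⟩

/-- The link maps of `g` about nearby points and of various radii are homotopic. -/
theorem IsLink.homotopic {g : E3 → E3} {y y₀ y₁ : E3} {ε r₀ r₁ : ℝ}
    (hc : ContinuousOn g (closedBall y ε)) (hi : InjOn g (closedBall y ε))
    (hr₀ : 0 < r₀) (hr₁ : 0 < r₁) (h₀ : dist y₀ y + r₀ ≤ ε) (h₁ : dist y₁ y + r₁ ≤ ε)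
    {m₀ m₁ : C(S2, S2)} (hm₀ : IsLink g y₀ r₀ m₀) (hm₁ : IsLink g y₁ r₁ m₁) :
    m₀.Homotopic m₁ := by
  let r : unitInterval → ℝ := fun s => (1 - s) * r₀ + s * r₁
  let z : unitInterval → E3 := fun s => (1 - s : ℝ) • y₀ + (s : ℝ) • y₁
  have hr : ∀ s, 0 < r s := fun s => by
    rcases eq_or_lt_of_le s.2.1 with h | h
    · simp [r, ← h, hr₀]
    · have := s.2.2
      have : 0 ≤ (1 - (s : ℝ)) * r₀ := mul_nonneg (by linarith) hr₀.le
      have := mul_pos h hr₁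
      simp only [r]; linarith
  have hz : ∀ s, dist (z s) y + r s ≤ ε := fun s => by
    have hs := s.2.1
    have hs' : 0 ≤ 1 - (s : ℝ) := by linarith [s.2.2]
    have e : z s - y = (1 - s : ℝ) • (y₀ - y) + (s : ℝ) • (y₁ - y) := by
      simp only [z]; module
    have : dist (z s) y ≤ (1 - s) * dist y₀ y + s * dist y₁ y := by
      rw [dist_eq_norm, e, dist_eq_norm, dist_eq_norm]
      refine (norm_add_le _ _).trans_eq ?_
      rw [norm_smul, norm_smul, Real.norm_of_nonneg hs, Real.norm_of_nonneg hs']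
    have h3 := mul_le_mul_of_nonneg_left h₀ hs'
    have h4 := mul_le_mul_of_nonneg_left h₁ hs
    simp only [r]
    nlinarith
  have hsub : ∀ s, closedBall (z s) (r s) ⊆ closedBall y ε := fun s =>
    closedBall_subset_closedBall' (by linarith [hz s])
  have hzc : Continuous z := by fun_prop
  have hrc : Continuous r := by fun_prop
  refine homotopic_of_nonvanishing
    (fun q => g (z q.1 + r q.1 • (q.2 : E3)) - g (z q.1)) ?_ ?_ ?_ ?_
  · refine (hc.comp_continuous (by fun_prop) fun q => hsub q.1 ?_).sub
      (hc.comp_continuous (by fun_prop) fun q => hsub q.1 ?_)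
    · exact add_smul_mem_closedBall _ (hr _).le le_rfl _
    · exact mem_closedBall_self (hr _).le
  · exact fun q => link_ne_zero (hi.mono (hsub q.1)) (hr _) le_rfl _
  · intro u; rw [hm₀ u]; simp [z, r]
  · intro u; rw [hm₁ u]; simp [z, r]

/-- Near `y` the map `g` is continuous and injective, and on small spheres about `y` it induces maps
of the 2-sphere in the homotopy class of `c`. For a local homeomorphism this class stands for its
local degree. -/
def HasLinkClass (g : E3 → E3) (y : E3) (c : C(S2, S2)) : Prop :=
  ∃ ε : ℝ, 0 < ε ∧ ContinuousOn g (closedBall y ε) ∧ InjOn g (closedBall y ε) ∧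
    ∃ m, IsLink g y ε m ∧ m.Homotopic c

theorem exists_hasLinkClass {g : E3 → E3} {y : E3} {s : Set E3} (hs : s ∈ 𝓝 y)
    (hc : ContinuousOn g s) (hi : InjOn g s) : ∃ c, HasLinkClass g y c := by
  obtain ⟨ε, hε, h⟩ := Metric.nhds_basis_closedBall.mem_iff.1 hs
  obtain ⟨m, hm⟩ := exists_isLink hε (hc.mono h) (hi.mono h)
  exact ⟨m, ε, hε, hc.mono h, hi.mono h, m, hm, .refl m⟩

theorem OpenPartialHomeomorph.exists_hasLinkClass (g : OpenPartialHomeomorph E3 E3) {y : E3}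
    (hy : y ∈ g.source) : ∃ c, HasLinkClass g y c :=
  _root_.exists_hasLinkClass (g.open_source.mem_nhds hy) g.continuousOn g.injOn

namespace HasLinkClass

variable {g g₁ g₂ : E3 → E3} {y : E3} {c c' c₁ c₂ : C(S2, S2)}

theorem congr_class (h : HasLinkClass g y c) (hc : c.Homotopic c') : HasLinkClass g y c' := by
  obtain ⟨ε, hε, h1, h2, m, hm, hmc⟩ := h
  exact ⟨ε, hε, h1, h2, m, hm, hmc.trans hc⟩

theorem mono {s : Set E3} (h : HasLinkClass g y c) (hs : s ∈ 𝓝 y) :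
    ∃ ε : ℝ, 0 < ε ∧ closedBall y ε ⊆ s ∧ ContinuousOn g (closedBall y ε) ∧
      InjOn g (closedBall y ε) ∧ ∃ m, IsLink g y ε m ∧ m.Homotopic c := by
  obtain ⟨ε, hε, h1, h2, m, hm, hmc⟩ := h
  obtain ⟨δ, hδ, h⟩ := Metric.nhds_basis_closedBall.mem_iff.1 hs
  have hpos : 0 < min ε δ := lt_min hε hδ
  have hsub : closedBall y (min ε δ) ⊆ closedBall y ε :=
    closedBall_subset_closedBall (min_le_left _ _)
  obtain ⟨m', hm'⟩ := exists_isLink hpos (h1.mono hsub) (h2.mono hsub)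
  refine ⟨min ε δ, hpos, (closedBall_subset_closedBall (min_le_right _ _)).trans h,
    h1.mono hsub, h2.mono hsub, m', hm', ?_⟩
  refine ContinuousMap.Homotopic.trans (hm'.homotopic h1 h2 hpos hε ?_ ?_ hm) hmc <;> simp

theorem homotopic (h : HasLinkClass g y c) (h' : HasLinkClass g y c') : c.Homotopic c' := by
  obtain ⟨ε, hε, h1, h2, m, hm, hmc⟩ := h
  obtain ⟨δ, hδ, h3, -, -, m', hm', hmc'⟩ := h'.mono (closedBall_mem_nhds y hε)
  have hle : δ ≤ ε := by
    have := h3 (add_smul_mem_closedBall y hδ.le le_rfl ⟨EuclideanSpace.single 0 1, by simp⟩)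
    rw [mem_closedBall, dist_eq_norm, add_sub_cancel_left, norm_smul] at this
    simpa [abs_of_pos hδ] using this
  refine hmc.symm.trans (.trans ?_ hmc')
  refine hm.homotopic h1 h2 hε hδ ?_ ?_ hm' <;> simp [hle]

theorem congr_germ (h : HasLinkClass g₁ y c) (hg : g₁ =ᶠ[𝓝 y] g₂) : HasLinkClass g₂ y c := by
  obtain ⟨ε, hε, h0, h1, h2, m, hm, hmc⟩ := h.mono hg
  have heq : EqOn g₁ g₂ (closedBall y ε) := h0
  refine ⟨ε, hε, h1.congr heq.symm, heq.injOn_iff.1 h2, m, fun u => ?_, hmc⟩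
  rw [hm u, heq (add_smul_mem_closedBall y hε.le le_rfl u), heq (mem_closedBall_self hε.le)]

/-- The link class is locally constant. -/
theorem eventually (h : HasLinkClass g y c) : ∀ᶠ z in 𝓝 y, HasLinkClass g z c := by
  obtain ⟨ε, hε, h1, h2, m, hm, hmc⟩ := h
  filter_upwards [ball_mem_nhds y (half_pos hε)] with z hz
  rw [mem_ball] at hz
  have hsub : closedBall z (ε / 2) ⊆ closedBall y ε :=
    closedBall_subset_closedBall' (by linarith)
  obtain ⟨m', hm'⟩ := exists_isLink (half_pos hε) (h1.mono hsub) (h2.mono hsub)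
  refine ⟨ε / 2, half_pos hε, h1.mono hsub, h2.mono hsub, m', hm', .trans ?_ hmc⟩
  refine hm'.homotopic h1 h2 (half_pos hε) hε ?_ ?_ hm
  · linarith
  · simp

theorem comp (h₁ : HasLinkClass g₁ y c₁) (h₂ : HasLinkClass g₂ (g₁ y) c₂) :
    HasLinkClass (g₂ ∘ g₁) y (c₂.comp c₁) := by
  obtain ⟨δ, hδ, hc2, hi2, m₂, hm₂, hmc₂⟩ := h₂
  have hg₁ : ContinuousAt g₁ y := by
    obtain ⟨ε, hε, h1, -⟩ := h₁
    exact h1.continuousAt (closedBall_mem_nhds y hε)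
  obtain ⟨ε, hε, h0, hc1, hi1, m₁, hm₁, hmc₁⟩ :=
    h₁.mono (hg₁.preimage_mem_nhds (closedBall_mem_nhds (g₁ y) hδ))
  have hmaps : MapsTo g₁ (closedBall y ε) (closedBall (g₁ y) δ) := h0
  have hc := hc2.comp hc1 hmaps
  have hi := hi2.comp hi1 hmaps
  obtain ⟨m, hm⟩ := exists_isLink hε hc hi
  refine ⟨ε, hε, hc, hi, m, hm, .trans ?_ (hmc₂.comp hmc₁)⟩
  let w : S2 → E3 := fun u => g₁ (y + ε • (u : E3)) - g₁ y
  have hw0 : ∀ u, w u ≠ 0 := fun u => link_ne_zero hi1 hε le_rfl u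
  have hwc : Continuous w := (hc1.comp_continuous (by fun_prop)
      fun u => add_smul_mem_closedBall y hε.le le_rfl u).sub continuous_const
  have hwn : ∀ u, ‖w u‖ ≤ δ := fun u => by
    rw [← dist_eq_norm]
    exact hmaps (add_smul_mem_closedBall y hε.le le_rfl u)
  -- The image of the small sphere is pushed radially to the sphere of radius `δ`.
  let r : unitInterval × S2 → ℝ := fun q => (1 - q.1) * ‖w q.2‖ + q.1 * δ
  have hrc : Continuous r := by fun_prop
  have hr : ∀ q, 0 < r q ∧ r q ≤ δ := fun q => by
    have h1 := q.1.2.1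
    have h2 := q.1.2.2
    have h3 := norm_pos_iff.2 (hw0 q.2)
    have h4 := hwn q.2
    constructor
    · simp only [r]
      rcases eq_or_lt_of_le h1 with h | h
      · simpa [← h] using hw0 q.2
      · have := mul_nonneg (sub_nonneg.2 h2) h3.le
        have := mul_pos h hδ
        linarith
    · simp only [r]
      nlinarith [mul_le_mul_of_nonneg_left h4 (sub_nonneg.2 h2)]
  have huc : Continuous fun q : unitInterval × S2 => (m₁ q.2 : E3) := by fun_prop
  refine homotopic_of_nonvanishing
    (fun q => g₂ (g₁ y + r q • (m₁ q.2 : E3)) - g₂ (g₁ y)) ?_ ?_ ?_ ?_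
  · exact (hc2.comp_continuous (by fun_prop)
      fun q => add_smul_mem_closedBall _ (hr q).1.le (hr q).2 _).sub continuous_const
  · exact fun q => link_ne_zero hi2 (hr q).1 (hr q).2 _
  · intro u
    rw [hm u]
    have e : r (0, u) • (m₁ u : E3) = w u := by
      rw [hm₁ u]
      simp [r, unitVec, w, smul_smul, mul_inv_cancel₀ (norm_ne_zero_iff.2 (hw0 u))]
    simp only [e]
    simp [w]
  · intro u
    rw [ContinuousMap.comp_apply, hm₂ (m₁ u)]
    simp [r]

theorem id (y : E3) : HasLinkClass _root_.id y (ContinuousMap.id S2) :=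
  ⟨1, one_pos, continuousOn_id, injOn_id _, ContinuousMap.id S2, fun u => by
    simp [unitVec_coe], .refl _⟩

theorem add_const (a y : E3) : HasLinkClass (fun v => v + a) y (ContinuousMap.id S2) :=
  ⟨1, one_pos, by fun_prop, fun _ _ _ _ h => add_right_cancel h, ContinuousMap.id S2, fun u => by
    simp [unitVec_coe], .refl _⟩

/-- Composing on the left with a map of trivial link class does not change the link class. -/
theorem id_comp (h₁ : HasLinkClass g₁ y c₁)
    (h₂ : HasLinkClass g₂ (g₁ y) (ContinuousMap.id S2)) : HasLinkClass (g₂ ∘ g₁) y c₁ := by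
  simpa using h₁.comp h₂

theorem comp_id (h₁ : HasLinkClass g₁ y (ContinuousMap.id S2))
    (h₂ : HasLinkClass g₂ (g₁ y) c₂) : HasLinkClass (g₂ ∘ g₁) y c₂ := by
  simpa using h₁.comp h₂

/-- A local inverse has the inverse link class. -/
theorem comp_homotopic_id (h₁ : HasLinkClass g₁ y c₁) (h₂ : HasLinkClass g₂ (g₁ y) c₂)
    (h : g₂ ∘ g₁ =ᶠ[𝓝 y] _root_.id) : (c₂.comp c₁).Homotopic (ContinuousMap.id S2) :=
  ((h₁.comp h₂).congr_germ h).homotopic (.id y)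

end HasLinkClass

/-- The definition of orientation preservation uses maps into `E3 ∖ {0}`; radial rescaling
translates between these and the normalized maps. -/
theorem preservesOrientationAt_iff {g : OpenPartialHomeomorph E3 E3} {y : E3}
    (hy : y ∈ g.source) :
    PreservesOrientationAt g y ↔ HasLinkClass g y (ContinuousMap.id S2) := by
  constructor
  · rintro ⟨ε, hε, hs, H, hH, hH0, hH1⟩
    obtain ⟨m, hm⟩ := exists_isLink hε (g.continuousOn.mono hs) (g.injOn.mono hs)
    refine ⟨ε, hε, g.continuousOn.mono hs, g.injOn.mono hs, m, hm, .symm ?_⟩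
    refine homotopic_of_nonvanishing H H.continuous hH (fun u => ?_) fun u => ?_
    · rw [hH0, unitVec_coe]; rfl
    · rw [hm u, hH1]
  · intro h
    obtain ⟨ε, hε, hs, hc, hi, m, hm, ⟨H⟩⟩ := h.mono (g.open_source.mem_nhds hy)
    refine ⟨ε, hε, hs, ?_⟩
    let F : S2 → E3 := fun u => g (y + ε • (u : E3)) - g y
    have hF : Continuous F := (hc.comp_continuous (by fun_prop)
      fun u => add_smul_mem_closedBall y hε.le le_rfl u).sub continuous_const
    have hF0 : ∀ u, F u ≠ 0 := fun u => link_ne_zero hi hε le_rfl u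
    -- The length grows from `1` to that of the difference along the homotopy.
    let r : unitInterval × S2 → ℝ := fun q => (1 - q.1) + q.1 * ‖F q.2‖
    have hr : ∀ q, r q ≠ 0 := fun q => by
      have h1 := q.1.2.1
      have h2 := q.1.2.2
      have h3 := norm_pos_iff.2 (hF0 q.2)
      rcases eq_or_lt_of_le h1 with h | h
      · simp [r, ← h]
      · have := mul_pos h h3
        simp only [r]; linarith
    let H' : C(unitInterval × S2, E3) :=
      ⟨fun q => r q • (H.symm q : E3), by
        have : Continuous r := by fun_prop
        fun_prop⟩
    refine ⟨H', fun q => smul_ne_zero (hr q) (S2.coe_ne_zero _), fun u => ?_, fun u => ?_⟩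
    · simp [H', r]
    · change r (1, u) • (H.symm (1, u) : E3) = F u
      rw [H.symm.apply_one, hm u]
      simp [r, unitVec, F, smul_smul, mul_inv_cancel₀ (norm_ne_zero_iff.2 (hF0 u))]

theorem hasLinkClass_symm {g : OpenPartialHomeomorph E3 E3} {y : E3} (hy : y ∈ g.source)
    (h : HasLinkClass g y (ContinuousMap.id S2)) :
    HasLinkClass g.symm (g y) (ContinuousMap.id S2) := by
  obtain ⟨c, hc⟩ := g.symm.exists_hasLinkClass (g.map_source hy)
  have := h.comp_homotopic_id hc ((g.eventually_left_inverse hy).mono fun _ h => h)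
  exact hc.congr_class this

/-! ### Injective maps of the circle -/

theorem circleExp_add_two_pi_int (θ : ℝ) (n : ℤ) :
    Circle.exp (θ + n * (2 * Real.pi)) = Circle.exp θ := by
  rw [Circle.exp_eq_exp]
  exact ⟨n, rfl⟩

theorem exists_circleExp_eq (z : Circle) : ∃ θ : ℝ, Circle.exp θ = z :=
  Circle.isAddQuotientCoveringMap_exp.surjective z

/-- A continuous function of the angle that is `2π`-periodic is a function on the circle. -/
theorem exists_circle_descent {G : ℝ → ℝ} (hG : Continuous G)
    (hp : ∀ θ, G (θ + 2 * Real.pi) = G θ) : ∃ ψ : C(Circle, ℝ), ∀ θ, ψ (Circle.exp θ) = G θ := by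
  have hper : ∀ (n : ℤ) θ, G (θ + n * (2 * Real.pi)) = G θ := fun n θ =>
    (show Function.Periodic G (2 * Real.pi) from hp).int_mul n θ
  have hq : IsQuotientMap Circle.exp := Circle.isAddQuotientCoveringMap_exp.toIsQuotientMap
  have hf : Function.FactorsThrough G Circle.exp := fun a b hab => by
    obtain ⟨n, hn⟩ := Circle.exp_eq_exp.1 hab
    rw [hn, hper]
  let e : C(ℝ, Circle) := ⟨Circle.exp, hq.continuous⟩
  let G' : C(ℝ, ℝ) := ⟨G, hG⟩
  exact ⟨IsQuotientMap.lift (f := e) hq G' hf, fun θ =>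
    congrArg (fun F : C(ℝ, ℝ) => F θ) (IsQuotientMap.lift_comp (f := e) hq G' hf)⟩

/-- An injective continuous map of the circle is, up to a homotopy of the angle, the identity or
complex conjugation; in the first case the angle of the image is an increasing function of
the angle. -/
theorem exists_angle_of_injective {g : Circle → Circle} (hg : Continuous g)
    (hi : Function.Injective g) :
    ∃ ψ : C(Circle, ℝ), ((∀ z, g z = z * Circle.exp (ψ z)) ∧
      StrictMono fun θ : ℝ => θ + ψ (Circle.exp θ)) ∨ ∀ z, g z = z⁻¹ * Circle.exp (ψ z) := by
  have hpi := Real.two_pi_pos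
  obtain ⟨θ₀, hθ₀⟩ := exists_circleExp_eq (g (Circle.exp 0))
  obtain ⟨G, ⟨-, hG⟩, -⟩ := Circle.isCoveringMap_exp.existsUnique_continuousMap_lifts
    (⟨fun θ => g (Circle.exp θ), by fun_prop⟩ : C(ℝ, Circle)) 0 θ₀ hθ₀
  have hG : ∀ θ, Circle.exp (G θ) = g (Circle.exp θ) := fun θ => congrFun hG θ
  have hcomp : ∀ θ, Circle.exp (G (θ + 2 * Real.pi) - G θ) = 1 := fun θ => by
    rw [Circle.exp_sub, hG, hG, Circle.periodic_exp, div_self']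
  have hconst := Circle.isCoveringMap_exp.const_of_comp
    (g := fun θ : ℝ => G (θ + 2 * Real.pi) - G θ) (by fun_prop)
    (fun a b => (hcomp a).trans (hcomp b).symm)
  -- `G` is a lift to the angles, and `d` is the degree.
  obtain ⟨d, hd⟩ := Circle.exp_eq_exp.1 ((hcomp 0).trans Circle.exp_zero.symm)
  rw [zero_add] at hd
  have hG1 : ∀ θ, G (θ + 2 * Real.pi) = G θ + d * (2 * Real.pi) := fun θ => by
    have := (hconst θ 0).trans (by simpa using hd)
    linarith
  have hGinj : ∀ a b, Circle.exp (G a) = Circle.exp (G b) → Circle.exp a = Circle.exp b :=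
    fun a b h => hi (by rw [← hG, ← hG, h])
  -- The degree is not zero, by the intermediate value theorem for antipodal points.
  have hd0 : d ≠ 0 := by
    rintro rfl
    let D : ℝ → ℝ := fun θ => G (θ + Real.pi) - G θ
    have hD : Continuous D := by fun_prop
    have hanti : D Real.pi = - D 0 := by
      have := hG1 0
      simp only [D]
      rw [show Real.pi + Real.pi = 0 + 2 * Real.pi by ring, this]
      simp
    have hmem : (0 : ℝ) ∈ uIcc (D 0) (D Real.pi) := by
      rw [hanti, mem_uIcc]
      rcases le_total 0 (D 0) with h | h
      · exact .inr ⟨by linarith, h⟩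
      · exact .inl ⟨h, by linarith⟩
    obtain ⟨θ, -, hθ⟩ := intermediate_value_uIcc hD.continuousOn hmem
    obtain ⟨n, hn⟩ := Circle.exp_eq_exp.1 (hGinj (θ + Real.pi) θ (by
      rw [sub_eq_zero.1 hθ]))
    have h1 : Real.pi * (1 - 2 * n) = 0 := by linarith
    rcases mul_eq_zero.1 h1 with h | h
    · exact Real.pi_ne_zero h
    · have : (1 : ℤ) - 2 * n = 0 := by exact_mod_cast h
      omega
  have hGn : ∀ (n : ℤ) θ, G (θ + n * (2 * Real.pi)) = G θ + n * (d * (2 * Real.pi)) := by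
    intro n θ
    have hper : Function.Periodic (fun θ => G θ - d * θ) (2 * Real.pi) := fun θ => by
      simp only [hG1]; ring
    have := hper.int_mul n θ
    linarith
  have hGi : Function.Injective G := by
    intro a b hab
    obtain ⟨n, hn⟩ := Circle.exp_eq_exp.1 (hGinj a b (by rw [hab]))
    have h1 := hGn n b
    rw [← hn, hab] at h1
    have h2 : (n : ℝ) * (d * (2 * Real.pi)) = 0 := by linarith
    rcases mul_eq_zero.1 h2 with h | h
    · rw [hn, h]; ring
    · rcases mul_eq_zero.1 h with h | h
      · exact absurd (by exact_mod_cast h) hd0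
      · linarith
  -- The degree is at most one in absolute value, by the intermediate value theorem.
  have hone : ∀ m : ℤ, ∀ θ ∈ Ioo 0 (2 * Real.pi),
      G θ ≠ G 0 + m * (2 * Real.pi) := by
    intro m θ hθ he
    obtain ⟨n, hn⟩ := Circle.exp_eq_exp.1 (hGinj θ 0 (by
      rw [he, circleExp_add_two_pi_int]))
    rw [zero_add] at hn
    rw [hn] at hθ
    have h1 : (0 : ℝ) < n := pos_of_mul_pos_left hθ.1 hpi.le
    have h2 : (n : ℝ) < 1 := by nlinarith [hθ.2]
    have h3 : 0 < n := by exact_mod_cast h1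
    have h4 : n < 1 := by exact_mod_cast h2
    omega
  have hivt : Ioo (G 0) (G (2 * Real.pi)) ⊆ G '' Ioo 0 (2 * Real.pi) :=
    intermediate_value_Ioo hpi.le G.continuous.continuousOn
  have hivt' : Ioo (G (2 * Real.pi)) (G 0) ⊆ G '' Ioo 0 (2 * Real.pi) :=
    intermediate_value_Ioo' hpi.le G.continuous.continuousOn
  have hend := hG1 0
  rw [zero_add] at hend
  rcases G.continuous.strictMono_of_inj hGi with hm | hm
  · have hlt := hm hpi
    have hdpos : 0 < d := by
      have : (0 : ℝ) < d * (2 * Real.pi) := by linarith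
      exact_mod_cast pos_of_mul_pos_left this hpi.le
    have hd1 : d = 1 := by
      by_contra hne
      have h2 : (2 : ℝ) ≤ d := by
        have : 2 ≤ d := by omega
        exact_mod_cast this
      obtain ⟨θ, hθ, he⟩ := hivt (show G 0 + (1 : ℤ) * (2 * Real.pi) ∈ _ by
        constructor
        · push_cast; linarith
        · rw [hend]; push_cast; nlinarith)
      exact hone 1 θ hθ he
    obtain ⟨ψ, hψ⟩ := exists_circle_descent (G := fun θ => G θ - θ) (by fun_prop) fun θ => by
      simp only [hG1, hd1]; push_cast; ring
    refine ⟨ψ, .inl ⟨fun z => ?_, ?_⟩⟩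
    · obtain ⟨θ, rfl⟩ := exists_circleExp_eq z
      rw [hψ, ← Circle.exp_add, ← hG]
      congr 1; ring
    · have : (fun θ : ℝ => θ + ψ (Circle.exp θ)) = G := funext fun θ => by rw [hψ]; ring
      rw [this]
      exact hm
  · have hlt := hm hpi
    have hdneg : d < 0 := by
      have : (d : ℝ) * (2 * Real.pi) < 0 := by linarith
      by_contra hcon
      have : (0 : ℝ) ≤ d := by exact_mod_cast not_lt.1 hcon
      nlinarith
    have hd1 : d = -1 := by
      by_contra hne
      have h2 : (d : ℝ) ≤ -2 := by
        have : d ≤ -2 := by omega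
        exact_mod_cast this
      obtain ⟨θ, hθ, he⟩ := hivt' (show G 0 + (-1 : ℤ) * (2 * Real.pi) ∈ _ by
        constructor
        · rw [hend]; push_cast; nlinarith
        · push_cast; linarith)
      exact hone (-1) θ hθ he
    obtain ⟨ψ, hψ⟩ := exists_circle_descent (G := fun θ => G θ + θ) (by fun_prop) fun θ => by
      simp only [hG1, hd1]; push_cast; ring
    refine ⟨ψ, .inr fun z => ?_⟩
    obtain ⟨θ, rfl⟩ := exists_circleExp_eq z
    rw [hψ, ← Circle.exp_neg, ← Circle.exp_add, ← hG]
    congr 1; ring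

/-! ### Orientation of homeomorphisms of the disc -/

/-- Three-space as the product of the complex plane and the real line. -/
noncomputable def coordsE3 : E3 ≃L[ℝ] ℂ × ℝ :=
  LinearEquiv.toContinuousLinearEquiv
    { toFun := fun x => (⟨x 0, x 1⟩, x 2)
      invFun := fun q => !₂[q.1.re, q.1.im, q.2]
      map_add' := fun x y => Prod.ext (Complex.ext (by simp) (by simp)) (by simp)
      map_smul' := fun r x => Prod.ext (Complex.ext (by simp) (by simp)) (by simp)
      left_inv := fun x => by
        ext i
        fin_cases i <;> rfl
      right_inv := fun q => by ext <;> simp }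

theorem coordsE3_apply (x : E3) : coordsE3 x = (⟨x 0, x 1⟩, x 2) := rfl

theorem coordsE3_symm_apply (q : ℂ × ℝ) : coordsE3.symm q = !₂[q.1.re, q.1.im, q.2] := rfl

attribute [irreducible] coordsE3

theorem S2.coords_norm (u : S2) : ‖(coordsE3 u).1‖ ^ 2 + (coordsE3 u).2 ^ 2 = 1 := by
  have := E3.sum_sq (mem_sphere_zero_iff_norm.1 u.2)
  rw [← Complex.normSq_eq_norm_sq, Complex.normSq_apply, coordsE3_apply]
  simp only
  linarith

theorem S2.coords_norm_le (u : S2) : ‖(coordsE3 u).1‖ ≤ 1 := by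
  have := S2.coords_norm u
  nlinarith [norm_nonneg (coordsE3 (u : E3)).1, sq_nonneg (coordsE3 (u : E3)).2]

theorem coordsE3_symm_disc_ne_zero {a : ℂ → ℂ} (ha : ∀ ζ, ‖ζ‖ = 1 → a ζ ≠ 0) {b : ℝ} (hb : b ≠ 0)
    (u : S2) : coordsE3.symm (a (coordsE3 u).1, b * (coordsE3 u).2) ≠ 0 := by
  rw [Ne, EmbeddingLike.map_eq_zero_iff, Prod.mk_eq_zero]
  rintro ⟨h1, h2⟩
  have h3 := (mul_eq_zero.1 h2).resolve_left hb
  refine ha _ ?_ h1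
  have := S2.coords_norm u
  rw [h3] at this
  have h4 : ‖(coordsE3 (u : E3)).1‖ ^ 2 = 1 := by linarith
  exact (pow_eq_one_iff_of_nonneg (norm_nonneg _) two_ne_zero).1 h4

/-- `m` is the normalized suspension of the map `a` of the disc into the plane. -/
def IsSuspension (a : ℂ → ℂ) (b : ℝ) (m : C(S2, S2)) : Prop :=
  ∀ u : S2, (m u : E3) = unitVec (coordsE3.symm (a (coordsE3 u).1, b * (coordsE3 u).2))

theorem exists_isSuspension {a : ℂ → ℂ} (hc : ContinuousOn a (closedBall 0 1))
    (ha : ∀ ζ, ‖ζ‖ = 1 → a ζ ≠ 0) : ∃ m, IsSuspension a 1 m := by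
  have hF : Continuous fun u : S2 =>
      coordsE3.symm (a (coordsE3 u).1, 1 * (coordsE3 (u : E3)).2) := by
    refine coordsE3.symm.continuous.comp (Continuous.prodMk ?_ (by fun_prop))
    exact hc.comp_continuous (by fun_prop) fun u => mem_closedBall_zero_iff.2 (S2.coords_norm_le u)
  have h0 := fun u : S2 => coordsE3_symm_disc_ne_zero ha one_ne_zero u
  exact ⟨⟨fun u => ⟨_, mem_sphere_zero_iff_norm.2 (norm_unitVec (h0 u))⟩,
    Continuous.subtype_mk ((hF.norm.inv₀ fun q => norm_ne_zero_iff.2 (h0 q)).smul hF) _⟩,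
    fun u => rfl⟩

/-- Only the values on the boundary circle matter for suspensions of maps of the disc. -/
theorem IsSuspension.homotopic {m₀ m₁ : C(S2, S2)} (a : unitInterval → ℂ → ℂ)
    (hc : ContinuousOn (fun q : unitInterval × ℂ => a q.1 q.2) (univ ×ˢ closedBall 0 1))
    (ha : ∀ s ζ, ‖ζ‖ = 1 → a s ζ ≠ 0) (b : unitInterval → ℝ) (hb : Continuous b)
    (hb0 : ∀ s, b s ≠ 0) (h₀ : IsSuspension (a 0) (b 0) m₀) (h₁ : IsSuspension (a 1) (b 1) m₁) :
    m₀.Homotopic m₁ := by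
  refine homotopic_of_nonvanishing
    (fun q => coordsE3.symm (a q.1 (coordsE3 q.2).1, b q.1 * (coordsE3 q.2).2)) ?_
    (fun q => coordsE3_symm_disc_ne_zero (ha q.1) (hb0 q.1) q.2) h₀ h₁
  refine coordsE3.symm.continuous.comp (Continuous.prodMk ?_ (by fun_prop))
  exact hc.comp_continuous (f := fun q : unitInterval × S2 => (q.1, (coordsE3 (q.2 : E3)).1))
    (by fun_prop) fun q => ⟨mem_univ _, mem_closedBall_zero_iff.2 (S2.coords_norm_le q.2)⟩

/-- The product of a map of the plane and the identity of the line. -/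
noncomputable def cylinderMap (γ : ℂ → ℂ) (x : E3) : E3 :=
  coordsE3.symm (γ (coordsE3 x).1, (coordsE3 x).2)

/-- If an embedding of the disc that preserves the unit circle is complex conjugation there, up to a
homotopy of the angle, then its product with the line reverses the orientation. -/
theorem not_hasLinkClass_cylinderMap {γ : ℂ → ℂ} (hc : ContinuousOn γ (closedBall 0 1))
    (hi : InjOn γ (closedBall 0 1)) (h0 : ‖γ 0‖ < 1) (ψ : C(Circle, ℝ))
    (hψ : ∀ z : Circle, γ z = ((z⁻¹ * Circle.exp (ψ z) : Circle) : ℂ)) (t : ℝ) :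
    ¬ HasLinkClass (cylinderMap γ) (coordsE3.symm (0, t)) (ContinuousMap.id S2) := by
  intro h
  have hball : coordsE3 ⁻¹' (ball 0 1 ×ˢ univ) ∈ 𝓝 (coordsE3.symm ((0 : ℂ), t)) := by
    refine (isOpen_ball.prod isOpen_univ).preimage coordsE3.continuous |>.mem_nhds ?_
    simp
  obtain ⟨ε, hε, hsub, -, -, m, hm, hmid⟩ := h.mono hball
  have hε1 : ε ≤ 1 := by
    have := hsub (add_smul_mem_closedBall (coordsE3.symm ((0 : ℂ), t)) hε.le le_rfl
      ⟨EuclideanSpace.single 0 1, by simp⟩)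
    simp [coordsE3_apply] at this
    rw [coordsE3_symm_apply, Complex.norm_def, Complex.normSq_apply] at this
    simp at this
    rw [Real.sqrt_mul_self hε.le] at this
    exact this.le
  have hm1 : IsSuspension (fun ζ => γ (ε * ζ) - γ 0) ε m := fun u => by
    rw [hm u, cylinderMap, cylinderMap, ← map_sub]
    simp
  have hcirc : ∀ ζ : ℂ, ‖ζ‖ = 1 → ∃ z : Circle, (z : ℂ) = ζ := fun ζ h =>
    ⟨⟨ζ, mem_sphere_zero_iff_norm.2 h⟩, rfl⟩
  have hγ1 : ∀ ζ, ‖ζ‖ = 1 → ‖γ ζ‖ = 1 := fun ζ h => by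
    obtain ⟨z, rfl⟩ := hcirc ζ h
    rw [hψ, Circle.norm_coe]
  have hscale : ∀ (r : ℝ) (ζ : ℂ), 0 ≤ r → r ≤ 1 → ‖ζ‖ ≤ 1 →
      (r * ζ : ℂ) ∈ closedBall (0 : ℂ) 1 := by
    intro r ζ h1 h2 h3
    rw [mem_closedBall_zero_iff, norm_mul, Complex.norm_real, Real.norm_of_nonneg h1]
    exact mul_le_one₀ h2 (norm_nonneg _) h3
  -- Enlarge the small circle to the unit circle.
  let r : unitInterval → ℝ := fun s => (1 - s) * ε + s
  have hr : ∀ s, 0 < r s ∧ r s ≤ 1 := fun s => by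
    have h1 := s.2.1
    have h2 := s.2.2
    constructor
    · simp only [r]
      rcases eq_or_lt_of_le h1 with h | h
      · simpa [← h] using hε
      · nlinarith
    · simp only [r]
      nlinarith
  have hrc : Continuous r := by fun_prop
  obtain ⟨m₁, hm₁⟩ := exists_isSuspension (a := fun ζ => γ ζ - γ 0) (by fun_prop) fun ζ h => by
    intro he
    have := hγ1 ζ h
    rw [sub_eq_zero.1 he] at this
    linarith
  have H1 : m.Homotopic m₁ := by
    refine IsSuspension.homotopic (fun s ζ => γ (r s * ζ) - γ 0) ?_ ?_ r hrc
      (fun s => (hr s).1.ne') (by simpa [r] using hm1) (by simpa [r] using hm₁)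
    · refine ContinuousOn.sub (hc.comp (Continuous.continuousOn (by fun_prop)) ?_)
        continuousOn_const
      rintro ⟨s, ζ⟩ ⟨-, h⟩
      exact hscale _ _ (hr s).1.le (hr s).2 (mem_closedBall_zero_iff.1 h)
    · intro s ζ h he
      have := hi (hscale _ _ (hr s).1.le (hr s).2 h.le) (mem_closedBall_self zero_le_one)
        (sub_eq_zero.1 he)
      rcases mul_eq_zero.1 this with h' | h'
      · exact (hr s).1.ne' (by exact_mod_cast h')
      · rw [h', norm_zero] at h
        exact zero_ne_one h
  -- Move the image of the centre to the centre.
  obtain ⟨m₂, hm₂⟩ := exists_isSuspension (a := γ) hc fun ζ h he => by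
    have := hγ1 ζ h
    rw [he, norm_zero] at this
    exact zero_ne_one this
  have H2 : m₂.Homotopic m₁ := by
    refine IsSuspension.homotopic (fun s ζ => γ ζ - (s : ℝ) * γ 0) ?_ ?_ (fun _ => 1)
      continuous_const (fun _ => one_ne_zero) (by simpa using hm₂) (by simpa using hm₁)
    · exact (hc.comp continuousOn_snd fun q hq => hq.2).sub
        (Continuous.continuousOn (by fun_prop))
    · intro s ζ h he
      have h1 := hγ1 ζ h
      rw [sub_eq_zero.1 he, norm_mul, Complex.norm_real, Real.norm_of_nonneg s.2.1] at h1
      nlinarith [s.2.2, s.2.1, norm_nonneg (γ 0)]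
  -- Replace the map in the interior of the disc and untwist the angle.
  have hemb : IsClosedEmbedding ((↑) : Circle → ℂ) :=
    Continuous.isClosedEmbedding (X := Circle) continuous_subtype_val Subtype.val_injective
  obtain ⟨Ψ, hΨ⟩ := ContinuousMap.exists_extension hemb ψ
  have hΨ : ∀ z : Circle, Ψ z = ψ z := fun z => congrArg (fun F : C(Circle, ℝ) => F z) hΨ
  have hexp : ∀ z : Circle, γ z = (starRingEnd ℂ) z * Complex.exp (Ψ z * Complex.I) := fun z => by
    rw [hψ, hΨ, Circle.coe_mul, Circle.coe_inv_eq_conj, Circle.coe_exp]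
  have hconj : ∀ ζ : ℂ, ‖ζ‖ = 1 → (starRingEnd ℂ) ζ ≠ 0 := fun ζ h he => by
    rw [(map_eq_zero _).1 he, norm_zero] at h
    exact zero_ne_one h
  obtain ⟨m₃, hm₃⟩ := exists_isSuspension
    (a := fun ζ => (starRingEnd ℂ) ζ * Complex.exp (Ψ ζ * Complex.I))
    (Continuous.continuousOn (by fun_prop)) fun ζ h =>
      mul_ne_zero (hconj ζ h) (Complex.exp_ne_zero _)
  have H3 : m₂.Homotopic m₃ := by
    refine IsSuspension.homotopic (fun s ζ => (1 - s : ℝ) * γ ζ +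
        (s : ℝ) * ((starRingEnd ℂ) ζ * Complex.exp (Ψ ζ * Complex.I))) ?_ ?_ (fun _ => 1)
      continuous_const (fun _ => one_ne_zero) (by simpa using hm₂) (by simpa using hm₃)
    · have h1 : ContinuousOn (fun q : unitInterval × ℂ => γ q.2) (univ ×ˢ closedBall 0 1) :=
        hc.comp continuousOn_snd fun q hq => hq.2
      exact (ContinuousOn.mul (Continuous.continuousOn (by fun_prop)) h1).add
        (Continuous.continuousOn (by fun_prop))
    · intro s ζ h
      obtain ⟨z, rfl⟩ := hcirc ζ h
      rw [← hexp]
      have h1 := hγ1 z h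
      rw [← add_mul]
      intro he
      simp only [Complex.ofReal_sub, Complex.ofReal_one, sub_add_cancel, one_mul] at he
      rw [he, norm_zero] at h1
      exact zero_ne_one h1
  have H4 : reflectS2.Homotopic m₃ := by
    refine IsSuspension.homotopic
      (fun s ζ => (starRingEnd ℂ) ζ * Complex.exp ((s : ℝ) * Ψ ζ * Complex.I))
      (Continuous.continuousOn (by fun_prop)) (fun s ζ h =>
        mul_ne_zero (hconj ζ h) (Complex.exp_ne_zero _)) (fun _ => 1)
      continuous_const (fun _ => one_ne_zero) (fun u => ?_) (by simpa using hm₃)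
    rw [← unitVec_coe]
    congr 1
    ext i
    fin_cases i <;> simp [reflectS2, coordsE3_apply, coordsE3_symm_apply]
  exact not_homotopic_reflectS2 ((hmid.symm.trans H1).trans (H2.symm.trans (H3.trans H4.symm)))

/-! ### The dynamics of a homeomorphism on an attracting region -/

theorem Homeomorph.zpow_add_apply {T : Type*} [TopologicalSpace T] (f : T ≃ₜ T) (m n : ℤ) (x : T) :
    (f ^ (m + n)) x = (f ^ m) ((f ^ n) x) := by
  rw [zpow_add]; rfl

theorem Homeomorph.zpow_one_add_apply {T : Type*} [TopologicalSpace T] (f : T ≃ₜ T) (n : ℤ)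
    (x : T) : (f ^ (1 + n)) x = f ((f ^ n) x) := by
  rw [f.zpow_add_apply, zpow_one]

theorem Homeomorph.zpow_add_one_apply {T : Type*} [TopologicalSpace T] (f : T ≃ₜ T) (n : ℤ)
    (x : T) : (f ^ (n + 1)) x = (f ^ n) (f x) := by
  rw [f.zpow_add_apply, zpow_one]

theorem Homeomorph.zpow_neg_apply_zpow_apply {T : Type*} [TopologicalSpace T] (f : T ≃ₜ T) (n : ℤ)
    (x : T) : (f ^ (-n)) ((f ^ n) x) = x := by
  rw [← f.zpow_add_apply, neg_add_cancel, zpow_zero]; rfl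

theorem Homeomorph.zpow_apply_zpow_neg_apply {T : Type*} [TopologicalSpace T] (f : T ≃ₜ T) (n : ℤ)
    (x : T) : (f ^ n) ((f ^ (-n)) x) = x := by
  rw [← f.zpow_add_apply, add_neg_cancel, zpow_zero]; rfl

/-- `P` is a closed trapping region of `f`. -/
structure IsTrapping (P : Set S3) (f : S3 ≃ₜ S3) : Prop where
  isClosed : IsClosed P
  image_subset : f '' P ⊆ interior P

namespace IsTrapping

variable {P : Set S3} {f : S3 ≃ₜ S3} (h : IsTrapping P f)
include h

theorem apply_mem {x : S3} (hx : x ∈ P) : f x ∈ interior P := h.image_subset ⟨x, hx, rfl⟩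

theorem zpow_mem {x : S3} (hx : x ∈ P) {n : ℤ} (hn : 0 < n) : (f ^ n) x ∈ interior P := by
  obtain ⟨k, rfl⟩ : ∃ k : ℕ, n = 1 + k := ⟨(n - 1).toNat, by omega⟩
  clear hn
  induction k with
  | zero => simpa using h.apply_mem hx
  | succ k ih =>
    push_cast
    rw [← add_assoc, add_comm, f.zpow_one_add_apply]
    exact h.apply_mem (interior_subset ih)

theorem zpow_mem_of_nonneg {x : S3} (hx : x ∈ P) {n : ℤ} (hn : 0 ≤ n) : (f ^ n) x ∈ P := by
  rcases hn.eq_or_lt with rfl | hn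
  · simpa using hx
  · exact interior_subset (h.zpow_mem hx hn)

omit h in
theorem mem_cutRegion {x : S3} : x ∈ cutRegion P f ↔ x ∈ P ∧ f.symm x ∉ interior P := by
  have e : interior (f '' P) = f '' interior P := (f.image_interior P).symm
  rw [cutRegion, mem_sdiff, e, ← f.preimage_symm]
  rfl

omit h in
theorem apply_mem_cutRegion {x : S3} : f x ∈ cutRegion P f ↔ f x ∈ P ∧ x ∉ interior P := by
  rw [mem_cutRegion, f.symm_apply_apply]

theorem isClosed_cutRegion : IsClosed (cutRegion P f) := h.isClosed.sdiff isOpen_interior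

theorem frontier_subset : frontier P ⊆ P := h.isClosed.frontier_subset

theorem mem_frontier {x : S3} : x ∈ frontier P ↔ x ∈ P ∧ x ∉ interior P := by
  rw [h.isClosed.frontier_eq]; rfl

theorem frontier_subset_cutRegion : frontier P ⊆ cutRegion P f := fun x hx => by
  rw [h.mem_frontier] at hx
  refine mem_cutRegion.2 ⟨hx.1, fun h' => hx.2 ?_⟩
  have := h.apply_mem (interior_subset h')
  rwa [f.apply_symm_apply] at this

theorem apply_mem_cutRegion_of_mem_frontier {x : S3} (hx : x ∈ frontier P) :
    f x ∈ cutRegion P f :=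
  apply_mem_cutRegion.2 ⟨interior_subset (h.apply_mem (h.frontier_subset hx)),
    (h.mem_frontier.1 hx).2⟩

omit h in
theorem apply_mem_frontier_image {x : S3} : f x ∈ frontier (f '' P) ↔ x ∈ frontier P := by
  rw [← f.image_frontier, f.injective.mem_set_image]

theorem mem_frontier_of_apply_mem {x : S3} (hx : x ∈ cutRegion P f) (hx' : f x ∈ cutRegion P f) :
    x ∈ frontier P :=
  h.mem_frontier.2 ⟨(mem_cutRegion.1 hx).1, (apply_mem_cutRegion.1 hx').2⟩

/-- Only successive translates of the cut region meet. -/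
theorem le_one_of_zpow_mem {x : S3} {n : ℤ} (hx : x ∈ cutRegion P f)
    (hn : (f ^ n) x ∈ cutRegion P f) : n ≤ 1 := by
  by_contra! hlt
  obtain ⟨k, rfl⟩ : ∃ k, n = 1 + k := ⟨n - 1, by ring⟩
  rw [f.zpow_one_add_apply, apply_mem_cutRegion] at hn
  exact hn.2 (h.zpow_mem (mem_cutRegion.1 hx).1 (by omega))

theorem eq_of_zpow_eq {x y : S3} {n : ℤ} (hx : x ∈ cutRegion P f) (hy : y ∈ cutRegion P f)
    (hxy : (f ^ n) x = y) : (n = 0 ∧ x = y) ∨ (n = 1 ∧ x ∈ frontier P ∧ f x = y) ∨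
      (n = -1 ∧ y ∈ frontier P ∧ f y = x) := by
  have h1 := h.le_one_of_zpow_mem hx (hxy ▸ hy)
  have hyx : (f ^ (-n)) y = x := by rw [← hxy, f.zpow_neg_apply_zpow_apply]
  have h2 := h.le_one_of_zpow_mem hy (hyx ▸ hx)
  obtain rfl | rfl | rfl : n = 0 ∨ n = 1 ∨ n = -1 := by omega
  · exact .inl ⟨rfl, by simpa using hxy⟩
  · rw [zpow_one] at hxy
    exact .inr (.inl ⟨rfl, h.mem_frontier_of_apply_mem hx (hxy ▸ hy), hxy⟩)
  · rw [neg_neg, zpow_one] at hyx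
    exact .inr (.inr ⟨rfl, h.mem_frontier_of_apply_mem hy (hyx ▸ hx), hyx⟩)

theorem zpow_apply_ne {x : S3} {n : ℤ} (hx : x ∈ cutRegion P f) (hn : n ≠ 0) : (f ^ n) x ≠ x := by
  intro he
  rcases h.eq_of_zpow_eq hx hx he with ⟨h0, -⟩ | ⟨-, h1, h2⟩ | ⟨-, h1, h2⟩
  · exact hn h0
  all_goals
    have := h.apply_mem (h.frontier_subset h1)
    rw [h2] at this
    exact (h.mem_frontier.1 h1).2 this

end IsTrapping

/-- An open neighbourhood of the cut region that meets only few of its translates. -/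
def cutNhd (P : Set S3) (f : S3 ≃ₜ S3) : Set S3 := f ⁻¹' interior P \ f '' (f '' P)

/-- The translates of the cut region of a trapping region are disjoint from it for shifts `n` with
`3 ≤ |n|`, even after a slight enlargement. -/
theorem IsTrapping.abs_le_two {P : Set S3} {f : S3 ≃ₜ S3} (h : IsTrapping P f) {x : S3} {n : ℤ}
    (hx : x ∈ cutNhd P f) (hn : (f ^ n) x ∈ cutNhd P f) : -2 ≤ n ∧ n ≤ 2 := by
  have key : ∀ {x : S3} {n : ℤ}, x ∈ cutNhd P f → (f ^ n) x ∈ cutNhd P f → n ≤ 2 := by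
    intro x n hx hn
    by_contra! hlt
    refine hn.2 ⟨(f ^ (n - 1)) x, ⟨(f ^ (n - 2)) x, ?_, ?_⟩, ?_⟩
    · have := h.zpow_mem_of_nonneg (interior_subset hx.1) (n := n - 3) (by omega)
      rw [← f.zpow_add_one_apply] at this
      rwa [show n - 3 + 1 = n - 2 by ring] at this
    · rw [← f.zpow_one_add_apply, show 1 + (n - 2) = n - 1 by ring]
    · rw [← f.zpow_one_add_apply, show 1 + (n - 1) = n by ring]
  refine ⟨?_, key hx hn⟩
  have := key (x := (f ^ n) x) (n := -n) hn (by rwa [f.zpow_neg_apply_zpow_apply])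
  omega

theorem IsTrapping.isOpen_cutNhd {P : Set S3} {f : S3 ≃ₜ S3} (h : IsTrapping P f) :
    IsOpen (cutNhd P f) :=
  (isOpen_interior.preimage f.continuous).sdiff
    (f.isClosedMap _ (f.isClosedMap _ h.isClosed))

theorem IsTrapping.cutRegion_subset_cutNhd {P : Set S3} {f : S3 ≃ₜ S3} (h : IsTrapping P f) :
    cutRegion P f ⊆ cutNhd P f := by
  intro x hx
  rw [mem_cutRegion] at hx
  refine ⟨h.apply_mem hx.1, ?_⟩
  rintro ⟨_, ⟨y, hy, rfl⟩, rfl⟩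
  exact hx.2 (by rw [f.symm_apply_apply]; exact h.apply_mem hy)

/-- The translate by `f ^ k` of the neighbourhood of the cut region. -/
def cutNhdTranslate (P : Set S3) (f : S3 ≃ₜ S3) (k : ℤ) : Set S3 :=
  (f ^ (-k)) ⁻¹' cutNhd P f

theorem IsTrapping.isOpen_cutNhdTranslate {P : Set S3} {f : S3 ≃ₜ S3} (h : IsTrapping P f) (k : ℤ) :
    IsOpen (cutNhdTranslate P f k) :=
  h.isOpen_cutNhd.preimage (f ^ (-k)).continuous

theorem IsTrapping.zpow_mem_cutNhdTranslate {P : Set S3} {f : S3 ≃ₜ S3} (h : IsTrapping P f)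
    (k : ℤ) {x : S3} (hx : x ∈ cutRegion P f) : (f ^ k) x ∈ cutNhdTranslate P f k := by
  rw [cutNhdTranslate, mem_preimage, f.zpow_neg_apply_zpow_apply]
  exact h.cutRegion_subset_cutNhd hx

theorem IsTrapping.finite_translates {P : Set S3} {f : S3 ≃ₜ S3} (h : IsTrapping P f) {k l n : ℤ}
    {y : S3} (hk : y ∈ cutNhdTranslate P f k) (hl : (f ^ n) y ∈ cutNhdTranslate P f l) :
    n ∈ Icc (l - k - 2) (l - k + 2) := by
  have := h.abs_le_two (n := -l + n + k) hk (by
    rw [f.zpow_add_apply, f.zpow_apply_zpow_neg_apply, f.zpow_add_apply]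
    exact hl)
  rw [mem_Icc]; omega

/-- Every point of a translate of the cut region is a wandering point. -/
theorem IsTrapping.exists_wandering {P : Set S3} {f : S3 ≃ₜ S3} (h : IsTrapping P f) (k : ℤ)
    {x : S3} (hx : x ∈ cutRegion P f) :
    ∃ U : Set S3, IsOpen U ∧ (f ^ k) x ∈ U ∧ ∀ n : ℤ, ∀ y ∈ U, (f ^ n) y ∈ U → n = 0 := by
  have hsep : ∀ n : ℤ, ∃ V : Set S3, IsOpen V ∧ (f ^ k) x ∈ V ∧
      (n ≠ 0 → ∀ y ∈ V, (f ^ n) y ∉ V) := by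
    intro n
    by_cases hn : n = 0
    · exact ⟨univ, isOpen_univ, mem_univ _, fun h => absurd hn h⟩
    · have hne : (f ^ n) ((f ^ k) x) ≠ (f ^ k) x := by
        rw [← f.zpow_add_apply, add_comm, f.zpow_add_apply]
        exact fun he => h.zpow_apply_ne hx hn ((f ^ k).injective he)
      obtain ⟨V, W, hV, hW, hxV, hxW, hVW⟩ := t2_separation hne
      refine ⟨W ∩ (f ^ n) ⁻¹' V, hW.inter (hV.preimage (f ^ n).continuous), ⟨hxW, hxV⟩,
        fun _ y hy hy' => ?_⟩
      exact disjoint_left.1 hVW hy.2 hy'.1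
  choose V hVo hxV hV using hsep
  refine ⟨cutNhdTranslate P f k ∩ ⋂ n ∈ Icc (-2 : ℤ) 2, V n,
    (h.isOpen_cutNhdTranslate k).inter ((finite_Icc _ _).isOpen_biInter fun n _ => hVo n),
    ⟨h.zpow_mem_cutNhdTranslate k hx, mem_iInter₂.2 fun n _ => hxV n⟩, fun n y hy hy' => ?_⟩
  by_contra hn
  have := h.finite_translates hy.1 hy'.1
  rw [sub_self, zero_sub, zero_add] at this
  exact hV n hn y (mem_iInter₂.1 hy.2 n this) (mem_iInter₂.1 hy'.2 n this)

/-! ### The infinite cyclic cover -/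

namespace GluedCover

variable {Z A : Set S3} {f : S3 ≃ₜ S3}

/-- The point `x` of the `k`-th copy of `Z`. -/
def mk (A : Set S3) (f : S3 ≃ₜ S3) (k : ℤ) (x : Z) : GluedCover Z A f := Quot.mk _ (k, x)

theorem continuous_mk (k : ℤ) : Continuous (mk A f k : Z → GluedCover Z A f) :=
  continuous_quot_mk.comp (Continuous.prodMk_right k)

theorem exists_mk (c : GluedCover Z A f) : ∃ k x, c = mk A f k x := by
  obtain ⟨k, x⟩ := c
  exact ⟨k, x, rfl⟩

theorem shift_mk (k m : ℤ) (x : Z) : shift Z A f m (mk A f k x) = mk A f (k + m) x := rfl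

theorem sound {k : ℤ} {x y : Z} (hx : (x : S3) ∈ A) (hy : f x = y) :
    mk A f k y = mk A f (k + 1) x :=
  Quot.sound ⟨rfl, hx, hy⟩

instance : AddAction ℤ (GluedCover Z A f) where
  vadd := shift Z A f
  zero_vadd := by
    intro c
    obtain ⟨k, x, rfl⟩ := exists_mk c
    change shift Z A f 0 _ = _
    rw [shift_mk, add_zero]
  add_vadd := by
    intro m n c
    obtain ⟨k, x, rfl⟩ := exists_mk c
    change shift Z A f (m + n) _ = shift Z A f m (shift Z A f n _)
    rw [shift_mk, shift_mk, shift_mk, add_assoc, add_comm m]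

instance : ContinuousConstVAdd ℤ (GluedCover Z A f) := ⟨continuous_shift Z A f⟩

theorem vadd_mk (n k : ℤ) (x : Z) : n +ᵥ mk A f k x = mk A f (k + n) x := rfl

theorem deck_zpow_apply (n : ℤ) (c : GluedCover Z A f) : (deck Z A f ^ n) c = n +ᵥ c := by
  induction n using Int.induction_on generalizing c with
  | zero => rw [zero_vadd, zpow_zero]; rfl
  | succ n ih => rw [Homeomorph.zpow_add_one_apply, ih, add_vadd]; rfl
  | pred n ih =>
    rw [sub_eq_add_neg, Homeomorph.zpow_add_apply, ih, add_vadd, zpow_neg_one]; rfl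

/-- The developing map of the cover, which sends the `k`-th copy of `Z` to `f ^ k (Z)`. -/
def dev (Z A : Set S3) (f : S3 ≃ₜ S3) : GluedCover Z A f → S3 :=
  Quot.lift (fun a => (f ^ a.1) a.2) fun a b h => by
    rw [h.1, f.zpow_add_one_apply, h.2.2]

theorem dev_mk (k : ℤ) (x : Z) : dev Z A f (mk A f k x) = (f ^ k) x := rfl

theorem dev_vadd (n : ℤ) (c : GluedCover Z A f) : dev Z A f (n +ᵥ c) = (f ^ n) (dev Z A f c) := by
  obtain ⟨k, x⟩ := c
  change (f ^ (k + n)) (x : S3) = (f ^ n) ((f ^ k) x)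
  rw [add_comm, f.zpow_add_apply]

theorem continuous_dev : Continuous (dev Z A f) := by
  refine continuous_quot_lift _ ?_
  rw [continuous_prod_of_discrete_left]
  exact fun k => (f ^ k).continuous.comp continuous_subtype_val

theorem proj_vadd (n : ℤ) (c : GluedCover Z A f) : proj Z A f (n +ᵥ c) = proj Z A f c := by
  obtain ⟨k, x⟩ := c
  rfl

theorem exists_of_mk_eq {x y : Z} (h : (Quot.mk _ x : Glued Z A f) = Quot.mk _ y) :
    ∃ n : ℤ, mk A f 0 x = n +ᵥ mk A f 0 y := by
  have := Quot.eqvGen_exact h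
  clear h
  induction this with
  | rel x y hxy =>
    refine ⟨-1, ?_⟩
    rw [sound hxy.1 hxy.2, vadd_mk]
    simp
  | refl x => exact ⟨0, (zero_vadd ℤ _).symm⟩
  | symm x y _ ih =>
    obtain ⟨n, hn⟩ := ih
    exact ⟨-n, by rw [hn, neg_vadd_vadd]⟩
  | trans x y z _ _ ih1 ih2 =>
    obtain ⟨n, hn⟩ := ih1
    obtain ⟨m, hm⟩ := ih2
    exact ⟨n + m, by rw [hn, hm, add_vadd]⟩

theorem proj_eq_iff {c c' : GluedCover Z A f} :
    proj Z A f c = proj Z A f c' ↔ c ∈ AddAction.orbit ℤ c' := by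
  constructor
  · obtain ⟨k, x, rfl⟩ := exists_mk c
    obtain ⟨l, y, rfl⟩ := exists_mk c'
    intro h
    obtain ⟨n, hn⟩ := exists_of_mk_eq (f := f) (A := A) (x := x) (y := y) h
    refine ⟨k + n - l, ?_⟩
    have h1 : mk A f k x = k +ᵥ mk A f 0 x := by rw [vadd_mk, zero_add]
    have h2 : mk A f l y = l +ᵥ mk A f 0 y := by rw [vadd_mk, zero_add]
    change (k + n - l) +ᵥ _ = _
    rw [h1, h2, hn, ← add_vadd, ← add_vadd]
    congr 1; ring
  · rintro ⟨n, rfl⟩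
    exact proj_vadd n c'

theorem continuous_proj : Continuous (proj Z A f) :=
  continuous_quot_lift _ (continuous_quot_mk.comp continuous_snd)

theorem isQuotientMap_proj : IsQuotientMap (proj Z A f) := by
  refine IsQuotientMap.of_comp (f := mk A f 0) ?_
    continuous_proj ?_
  · exact continuous_mk 0
  · exact isQuotientMap_quot_mk

variable {P : Set S3} (h : IsTrapping P f) (hZ : Z ⊆ cutRegion P f)
include h hZ

theorem dev_injective : Function.Injective (dev Z (frontier P) f) := by
  intro c c' hcc
  obtain ⟨k, x, rfl⟩ := exists_mk c
  obtain ⟨l, y, rfl⟩ := exists_mk c'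
  rw [dev_mk, dev_mk] at hcc
  have hxy : (f ^ (-l + k)) (x : S3) = y := by
    rw [f.zpow_add_apply, hcc, f.zpow_neg_apply_zpow_apply]
  rcases h.eq_of_zpow_eq (hZ x.2) (hZ y.2) hxy with ⟨h1, h2⟩ | ⟨h1, h2, h3⟩ | ⟨h1, h2, h3⟩
  · obtain rfl : k = l := by omega
    rw [Subtype.ext h2]
  · obtain rfl : k = l + 1 := by omega
    exact (sound h2 h3).symm
  · obtain rfl : l = k + 1 := by omega
    exact sound h2 h3

theorem isEmbedding_dev (hc : IsClosed Z) : IsEmbedding (dev Z (frontier P) f) := by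
  let F := rangeFactorization (dev Z (frontier P) f)
  have hF : IsClosedEmbedding F := by
    refine .of_continuous_injective_isClosedMap continuous_dev.rangeFactorization
      (fun a b hab => dev_injective h hZ (congrArg Subtype.val hab)) fun K hK => ?_
    let T : ℤ → Set (range (dev Z (frontier P) f)) := fun k =>
      {y | ∃ x : Z, mk (frontier P) f k x ∈ K ∧ (f ^ k) (x : S3) = y}
    have hT : F '' K = ⋃ k, T k := by
      ext y
      rw [mem_iUnion]
      constructor
      · rintro ⟨c, hcK, rfl⟩
        obtain ⟨k, x, rfl⟩ := exists_mk c
        exact ⟨k, x, hcK, rfl⟩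
      · rintro ⟨k, x, hcK, hy⟩
        exact ⟨_, hcK, Subtype.ext hy⟩
    rw [hT]
    refine LocallyFinite.isClosed_iUnion (fun y => ?_) fun k => ?_
    · obtain ⟨_, c, rfl⟩ := y
      obtain ⟨l, x, rfl⟩ := exists_mk c
      refine ⟨Subtype.val ⁻¹' cutNhdTranslate P f l,
        ((h.isOpen_cutNhdTranslate l).preimage continuous_subtype_val).mem_nhds
          (h.zpow_mem_cutNhdTranslate l (hZ x.2)), (finite_Icc (l - 2) (l + 2)).subset ?_⟩
      rintro k ⟨y, ⟨x', -, hy⟩, hy'⟩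
      have h1 := h.zpow_mem_cutNhdTranslate k (hZ x'.2)
      have := h.finite_translates (n := 0) h1 (by
        rw [hy]; simpa using hy')
      rw [mem_Icc] at this ⊢
      omega
    · have hcl : IsClosed {x : Z | mk (frontier P) f k x ∈ K} :=
        hK.preimage (continuous_mk k)
      have h1 := (f ^ k).isClosedMap _ (hc.isClosedEmbedding_subtypeVal.isClosedMap _ hcl)
      convert h1.preimage continuous_subtype_val using 1
      ext y
      simp only [T, mem_ofPred_eq, mem_preimage, mem_image]
      constructor
      · rintro ⟨x, hx, hy⟩
        exact ⟨x, ⟨x, hx, rfl⟩, hy⟩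
      · rintro ⟨_, ⟨x, hx, rfl⟩, hy⟩
        exact ⟨x, hx, hy⟩
  exact IsEmbedding.subtypeVal.comp hF.isEmbedding

theorem isAddQuotientCoveringMap_proj :
    IsAddQuotientCoveringMap (proj Z (frontier P) f) ℤ where
  toIsQuotientMap := isQuotientMap_proj
  toContinuousConstVAdd := inferInstance
  apply_eq_iff_mem_orbit := proj_eq_iff
  disjoint c := by
    obtain ⟨k, x, rfl⟩ := exists_mk c
    obtain ⟨U, hU, hxU, hn⟩ := h.exists_wandering k (hZ x.2)
    refine ⟨dev Z (frontier P) f ⁻¹' U, (hU.preimage continuous_dev).mem_nhds hxU, fun n => ?_⟩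
    rintro ⟨_, ⟨c, hc, rfl⟩, hc'⟩
    refine hn n _ hc ?_
    rw [← dev_vadd]
    exact hc'

theorem isInfiniteCyclicCover [ConnectedSpace (GluedCover Z (frontier P) f)] :
    IsInfiniteCyclicCover (proj Z (frontier P) f) (deck Z (frontier P) f) := by
  have hp := isAddQuotientCoveringMap_proj h hZ
  refine ⟨inferInstance, hp.isCoveringMap, hp.surjective, fun c => ?_, fun c c' hcc => ?_,
    fun c n hn => ?_⟩
  · exact proj_vadd 1 c
  · obtain ⟨n, hn⟩ := proj_eq_iff.1 hcc.symm
    exact ⟨n, by rw [deck_zpow_apply]; exact hn⟩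
  · rw [deck_zpow_apply] at hn
    obtain ⟨U, hU, hn'⟩ := hp.disjoint c
    exact hn' n ⟨c, ⟨c, mem_of_mem_nhds hU, hn⟩, mem_of_mem_nhds hU⟩

theorem t2Space_glued : T2Space (Glued Z (frontier P) f) := by
  have hp := isAddQuotientCoveringMap_proj h hZ
  have : T2Space (GluedCover Z (frontier P) f) :=
    .of_injective_continuous (dev_injective h hZ) continuous_dev
  refine (t2Space_iff_of_isOpenQuotientMap
    ⟨hp.surjective, hp.continuous, hp.isCoveringMap.isOpenMap⟩).2 ?_
  let T : ℤ → Set (GluedCover Z (frontier P) f × GluedCover Z (frontier P) f) := fun n =>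
    {q | n +ᵥ q.2 = q.1}
  have hT : {q : GluedCover Z (frontier P) f × GluedCover Z (frontier P) f |
      proj Z (frontier P) f q.1 = proj Z (frontier P) f q.2} = ⋃ n, T n := by
    ext q
    simp only [mem_ofPred_eq, proj_eq_iff, mem_iUnion, T]
    rfl
  rw [hT]
  -- The equivalence relation is the union of the graphs of the deck transformations, which form a
  -- locally finite family of closed sets.
  refine LocallyFinite.isClosed_iUnion (fun q => ?_) fun n =>
    isClosed_eq ((continuous_const_vadd n).comp continuous_snd) continuous_fst
  obtain ⟨c, c'⟩ := q
  obtain ⟨k, x, rfl⟩ := exists_mk c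
  obtain ⟨l, y, rfl⟩ := exists_mk c'
  refine ⟨(dev Z (frontier P) f ⁻¹' cutNhdTranslate P f k) ×ˢ
    (dev Z (frontier P) f ⁻¹' cutNhdTranslate P f l), prod_mem_nhds ?_ ?_,
    (finite_Icc (k - l - 2) (k - l + 2)).subset ?_⟩
  · exact ((h.isOpen_cutNhdTranslate k).preimage continuous_dev).mem_nhds
      (h.zpow_mem_cutNhdTranslate k (hZ x.2))
  · exact ((h.isOpen_cutNhdTranslate l).preimage continuous_dev).mem_nhds
      (h.zpow_mem_cutNhdTranslate l (hZ y.2))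
  · rintro n ⟨⟨b, b'⟩, hb, hb1, hb2⟩
    have hb : n +ᵥ b' = b := hb
    refine h.finite_translates (n := n) hb2 ?_
    rw [← dev_vadd, hb]
    exact hb1

theorem secondCountableTopology_glued (hc : IsClosed Z) :
    SecondCountableTopology (Glued Z (frontier P) f) := by
  have hp := isAddQuotientCoveringMap_proj h hZ
  have := (isEmbedding_dev h hZ hc).secondCountableTopology
  exact hp.toIsQuotientMap.secondCountableTopology hp.isCoveringMap.isOpenMap

omit h hZ in
theorem compactSpace_glued (hc : IsClosed Z) : CompactSpace (Glued Z A f) := by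
  have : CompactSpace Z := isCompact_iff_compactSpace.1 hc.isCompact
  exact Quot.compactSpace

omit h hZ in
theorem connectedSpace (hconn : IsConnected Z) {x : S3} (hx : x ∈ Z) (hxA : x ∈ A)
    (hfx : f x ∈ Z) : ConnectedSpace (GluedCover Z A f) := by
  have : ConnectedSpace Z := isConnected_iff_connectedSpace.1 hconn
  let s : ℤ → Set (GluedCover Z A f) := fun k => range (mk A f k)
  have hs : ∀ k, IsConnected (s k) := fun k =>
    isConnected_range (continuous_mk k)
  have hU := IsConnected.iUnion_of_chain hs fun k => by
    refine ⟨mk A f k ⟨f x, hfx⟩, ⟨_, rfl⟩, ⟨⟨x, hx⟩, ?_⟩⟩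
    exact (sound hxA rfl).symm
  have huniv : ⋃ k, s k = univ := eq_univ_of_forall fun c => by
    obtain ⟨k, x, rfl⟩ := exists_mk c
    exact mem_iUnion.2 ⟨k, x, rfl⟩
  rw [huniv] at hU
  exact connectedSpace_iff_univ.2 hU

end GluedCover

/-! ### Connectedness of the pieces -/

/-- Coordinates on the 3-sphere adapted to its genus one splitting. -/
noncomputable def torusParam (q : ℝ × ℝ × ℝ) : S3 :=
  ⟨!₂[Real.sin q.1 * Real.cos q.2.1, Real.sin q.1 * Real.sin q.2.1,
    Real.cos q.1 * Real.cos q.2.2, Real.cos q.1 * Real.sin q.2.2], by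
    rw [mem_sphere_zero_iff_norm, EuclideanSpace.norm_eq, Fin.sum_univ_four, Real.sqrt_eq_one]
    simp only [Real.norm_eq_abs, sq_abs]
    simp
    linear_combination Real.sin q.1 ^ 2 * Real.sin_sq_add_cos_sq q.2.1 +
      Real.cos q.1 ^ 2 * Real.sin_sq_add_cos_sq q.2.2 + Real.sin_sq_add_cos_sq q.1⟩

theorem continuous_torusParam : Continuous torusParam := by
  refine Continuous.subtype_mk ?_ _
  refine (PiLp.continuous_toLp 2 _).comp (continuous_pi fun i => ?_)
  fin_cases i <;> simp <;> fun_prop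

/-- The height function whose sublevel set is the standard solid torus. -/
def torusHeight (x : S3) : ℝ :=
  (x : EuclideanSpace ℝ (Fin 4)) 0 ^ 2 + (x : EuclideanSpace ℝ (Fin 4)) 1 ^ 2

theorem continuous_torusHeight : Continuous torusHeight := by
  unfold torusHeight
  fun_prop

theorem torusHeight_torusParam (q : ℝ × ℝ × ℝ) : torusHeight (torusParam q) = Real.sin q.1 ^ 2 := by
  simp only [torusHeight, torusParam]
  simp
  linear_combination Real.sin q.1 ^ 2 * Real.sin_sq_add_cos_sq q.2.1

theorem exists_polar (a b : ℝ) : ∃ α, a = √(a ^ 2 + b ^ 2) * Real.cos α ∧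
    b = √(a ^ 2 + b ^ 2) * Real.sin α := by
  have h : ‖(⟨a, b⟩ : ℂ)‖ = √(a ^ 2 + b ^ 2) := by
    rw [Complex.norm_def, Complex.normSq_apply]
    congr 1
    ring
  refine ⟨Complex.arg ⟨a, b⟩, ?_, ?_⟩
  · rw [← h, Complex.norm_mul_cos_arg]
  · rw [← h, Complex.norm_mul_sin_arg]

theorem exists_torusParam_eq (x : S3) :
    ∃ q : ℝ × ℝ × ℝ, q.1 = Real.arcsin √(torusHeight x) ∧ torusParam q = x := by
  have hx : (x : EuclideanSpace ℝ (Fin 4)) 0 ^ 2 + (x : EuclideanSpace ℝ (Fin 4)) 1 ^ 2 +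
      (x : EuclideanSpace ℝ (Fin 4)) 2 ^ 2 + (x : EuclideanSpace ℝ (Fin 4)) 3 ^ 2 = 1 := by
    have := EuclideanSpace.real_norm_sq_eq (x : EuclideanSpace ℝ (Fin 4))
    rw [mem_sphere_zero_iff_norm.1 x.2, Fin.sum_univ_four] at this
    linarith
  obtain ⟨α, h0, h1⟩ := exists_polar ((x : EuclideanSpace ℝ (Fin 4)) 0)
    ((x : EuclideanSpace ℝ (Fin 4)) 1)
  obtain ⟨β, h2, h3⟩ := exists_polar ((x : EuclideanSpace ℝ (Fin 4)) 2)
    ((x : EuclideanSpace ℝ (Fin 4)) 3)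
  have hle : torusHeight x ≤ 1 := by
    simp only [torusHeight]
    nlinarith [sq_nonneg ((x : EuclideanSpace ℝ (Fin 4)) 2),
      sq_nonneg ((x : EuclideanSpace ℝ (Fin 4)) 3)]
  have hnn : 0 ≤ torusHeight x := by unfold torusHeight; positivity
  have hsin : Real.sin (Real.arcsin √(torusHeight x)) = √(torusHeight x) :=
    Real.sin_arcsin (by linarith [Real.sqrt_nonneg (torusHeight x)]) (Real.sqrt_le_one.2 hle)
  have hcos : Real.cos (Real.arcsin √(torusHeight x)) =
      √((x : EuclideanSpace ℝ (Fin 4)) 2 ^ 2 + (x : EuclideanSpace ℝ (Fin 4)) 3 ^ 2) := by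
    rw [Real.cos_arcsin, Real.sq_sqrt hnn]
    congr 1
    simp only [torusHeight]
    linarith
  refine ⟨(Real.arcsin √(torusHeight x), α, β), rfl, Subtype.ext ?_⟩
  ext i
  fin_cases i
  · simpa [torusParam, hsin] using (show √(torusHeight x) * Real.cos α = _ from h0.symm)
  · simpa [torusParam, hsin] using (show √(torusHeight x) * Real.sin α = _ from h1.symm)
  · simpa [torusParam, hcos] using h2.symm
  · simpa [torusParam, hcos] using h3.symm

theorem standardSolidTorus_eq : standardSolidTorus = {x | torusHeight x ≤ 1 / 2} := rfl

theorem isClosed_standardSolidTorus : IsClosed standardSolidTorus :=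
  isClosed_le continuous_torusHeight continuous_const

theorem arcsin_sqrt_half : Real.arcsin √(1 / 2) = Real.pi / 4 := by
  refine Real.arcsin_eq_of_sin_eq ?_ ⟨by linarith [Real.pi_pos], by linarith [Real.pi_pos]⟩
  rw [Real.sin_pi_div_four, eq_comm, Real.sqrt_eq_iff_mul_self_eq (by norm_num) (by positivity)]
  have := Real.mul_self_sqrt (show (0 : ℝ) ≤ 2 by norm_num)
  linarith

theorem isConnected_standardSolidTorus : IsConnected standardSolidTorus := by
  have h : standardSolidTorus = torusParam '' (Icc 0 (Real.pi / 4) ×ˢ univ) := by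
    ext x
    constructor
    · intro hx
      obtain ⟨q, hq, rfl⟩ := exists_torusParam_eq x
      refine ⟨q, ⟨?_, mem_univ _⟩, rfl⟩
      rw [hq, ← arcsin_sqrt_half]
      exact ⟨Real.arcsin_nonneg.2 (Real.sqrt_nonneg _),
        Real.monotone_arcsin (Real.sqrt_le_sqrt hx)⟩
    · rintro ⟨q, ⟨hq, -⟩, rfl⟩
      rw [standardSolidTorus_eq, mem_ofPred_eq, torusHeight_torusParam]
      have h1 : Real.sin q.1 ≤ Real.sin (Real.pi / 4) :=
        Real.sin_le_sin_of_le_of_le_pi_div_two (by linarith [hq.1, Real.pi_pos])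
          (by linarith [Real.pi_pos]) hq.2
      have h0 : 0 ≤ Real.sin q.1 :=
        Real.sin_nonneg_of_nonneg_of_le_pi hq.1 (by linarith [hq.2, Real.pi_pos])
      rw [Real.sin_pi_div_four] at h1
      have := Real.mul_self_sqrt (show (0 : ℝ) ≤ 2 by norm_num)
      nlinarith
  rw [h]
  exact ((isConnected_Icc (by positivity)).prod isConnected_univ).image _
    continuous_torusParam.continuousOn

theorem frontier_standardSolidTorus :
    frontier standardSolidTorus = torusParam '' ({Real.pi / 4} ×ˢ univ) := by
  ext x
  constructor
  · intro hx
    have hx : torusHeight x = 1 / 2 :=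
      frontier_le_subset_eq continuous_torusHeight continuous_const hx
    obtain ⟨q, hq, rfl⟩ := exists_torusParam_eq x
    rw [hx, arcsin_sqrt_half] at hq
    exact ⟨q, ⟨hq, mem_univ _⟩, rfl⟩
  · rintro ⟨⟨θ, q⟩, ⟨hq, -⟩, rfl⟩
    obtain rfl : θ = Real.pi / 4 := hq
    have hs := Real.sin_pi_div_four
    have hsq := Real.mul_self_sqrt (show (0 : ℝ) ≤ 2 by norm_num)
    rw [frontier_eq_closure_inter_closure]
    refine ⟨subset_closure ?_, ?_⟩
    · rw [standardSolidTorus_eq, mem_ofPred_eq, torusHeight_torusParam, hs]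
      nlinarith
    · have hc : Filter.Tendsto (fun θ : ℝ => torusParam (θ, q)) (𝓝[>] (Real.pi / 4))
          (𝓝 (torusParam (Real.pi / 4, q))) :=
        ((continuous_torusParam.comp (by fun_prop : Continuous fun θ : ℝ => (θ, q))).tendsto
          _).mono_left nhdsWithin_le_nhds
      refine mem_closure_of_tendsto hc ?_
      filter_upwards [Ioo_mem_nhdsGT (show Real.pi / 4 < Real.pi / 2 by linarith [Real.pi_pos])]
        with θ hθ
      rw [mem_compl_iff, standardSolidTorus_eq, mem_ofPred_eq, torusHeight_torusParam, not_le]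
      have h1 : Real.sin (Real.pi / 4) < Real.sin θ :=
        Real.sin_lt_sin_of_lt_of_le_pi_div_two (by linarith [Real.pi_pos]) hθ.2.le hθ.1
      rw [hs] at h1
      nlinarith [Real.sqrt_nonneg 2]

theorem isConnected_frontier_standardSolidTorus : IsConnected (frontier standardSolidTorus) := by
  rw [frontier_standardSolidTorus]
  exact (isConnected_singleton.prod isConnected_univ).image _ continuous_torusParam.continuousOn

theorem IsUnknottedSolidTorus.isClosed {P : Set S3} (hP : IsUnknottedSolidTorus P) :
    IsClosed P := by
  obtain ⟨φ, rfl⟩ := hP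
  exact φ.isClosedMap _ isClosed_standardSolidTorus

theorem IsUnknottedSolidTorus.isConnected {P : Set S3} (hP : IsUnknottedSolidTorus P) :
    IsConnected P := by
  obtain ⟨φ, rfl⟩ := hP
  exact isConnected_standardSolidTorus.image _ φ.continuous.continuousOn

theorem IsUnknottedSolidTorus.isConnected_frontier {P : Set S3} (hP : IsUnknottedSolidTorus P) :
    IsConnected (frontier P) := by
  obtain ⟨φ, rfl⟩ := hP
  rw [← φ.image_frontier]
  exact isConnected_frontier_standardSolidTorus.image _ φ.continuous.continuousOn

/-- If a connected set is the union of two closed sets with connected intersection, then these sets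
are connected. -/
theorem isConnected_of_union_of_inter {T : Type*} [TopologicalSpace T] {A B : Set T}
    (hA : IsClosed A) (hB : IsClosed B) (hU : IsConnected (A ∪ B)) (hI : IsConnected (A ∩ B)) :
    IsConnected A := by
  refine ⟨hI.nonempty.mono inter_subset_left, ?_⟩
  have key : ∀ u v : Set T, IsClosed u → IsClosed v → A ⊆ u ∪ v → Disjoint u v → A ∩ B ⊆ u →
      A ⊆ u := by
    intro u v hu hv hAuv huv hABu
    -- `B` meets `A` inside `u`, so it can be added to that side of the separation.
    have hd : Disjoint ((A ∩ u) ∪ B) (A ∩ v) := by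
      rw [disjoint_left]
      rintro x (⟨-, hx⟩ | hx) ⟨hxA, hxv⟩
      · exact disjoint_left.1 huv hx hxv
      · exact disjoint_left.1 huv (hABu ⟨hxA, hx⟩) hxv
    have hcov : A ∪ B ⊆ ((A ∩ u) ∪ B) ∪ (A ∩ v) := by
      rintro x (hx | hx)
      · rcases hAuv hx with h | h
        · exact .inl (.inl ⟨hx, h⟩)
        · exact .inr ⟨hx, h⟩
      · exact .inl (.inr hx)
    rcases (isPreconnected_iff_subset_of_fully_disjoint_closed (hA.union hB)).1 hU.isPreconnected
      _ _ ((hA.inter hu).union hB) (hA.inter hv) hcov hd with h | h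
    · intro x hx
      rcases h (.inl hx) with h' | h'
      · exact h'.2
      · exact hABu ⟨hx, h'⟩
    · obtain ⟨x, hx⟩ := hI.nonempty
      exact absurd (h (.inr hx.2)).2 (disjoint_left.1 huv (hABu hx))
  refine (isPreconnected_iff_subset_of_fully_disjoint_closed hA).2 fun u v hu hv hAuv huv => ?_
  rcases (isPreconnected_iff_subset_of_fully_disjoint_closed (hA.inter hB)).1 hI.isPreconnected
    u v hu hv (inter_subset_left.trans hAuv) huv with h | h
  · exact .inl (key u v hu hv hAuv huv h)
  · exact .inr (key v u hv hu (by rwa [union_comm]) huv.symm h)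

theorem IsTrapping.isConnected_cutRegion {P : Set S3} {f : S3 ≃ₜ S3} (h : IsTrapping P f)
    (hP : IsConnected P) (hfr : IsConnected (frontier P)) : IsConnected (cutRegion P f) := by
  have hcl : IsClosed (f '' P) := f.isClosedMap _ h.isClosed
  refine isConnected_of_union_of_inter h.isClosed_cutRegion hcl ?_ ?_
  · convert hP
    rw [cutRegion]
    ext x
    constructor
    · rintro (hx | hx)
      · exact hx.1
      · exact interior_subset (h.image_subset hx)
    · intro hx
      by_cases hx' : x ∈ f '' P
      · exact .inr hx'
      · exact .inl ⟨hx, fun h' => hx' (interior_subset h')⟩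
  · have : cutRegion P f ∩ f '' P = f '' frontier P := by
      rw [f.image_frontier, hcl.frontier_eq, cutRegion]
      ext x
      constructor
      · rintro ⟨h1, h2⟩
        exact ⟨h2, h1.2⟩
      · rintro ⟨h1, h2⟩
        exact ⟨⟨interior_subset (h.image_subset h1), h2⟩, h1⟩
    rw [this]
    exact hfr.image _ f.continuous.continuousOn

/-! ### The drilled tube -/

/-- An embedding of a subset and its inverse, extended to total functions. -/
theorem exists_total_of_isEmbedding {T Y : Type*} [TopologicalSpace T] [TopologicalSpace Y]
    [Nonempty T] [Nonempty Y] {S : Set T} {Φ : S → Y} (hΦ : IsEmbedding Φ) :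
    ∃ (F : T → Y) (G : Y → T), (∀ s : S, F s = Φ s) ∧ ContinuousOn F S ∧ (∀ s ∈ S, G (F s) = s) ∧
      ContinuousOn G (F '' S) := by
  let F : T → Y := Function.extend Subtype.val Φ fun _ => Classical.arbitrary Y
  let G : Y → T := Function.extend Φ Subtype.val fun _ => Classical.arbitrary T
  have hF : ∀ s : S, F s = Φ s := fun s => Subtype.val_injective.extend_apply _ _ s
  have hG : ∀ s : S, G (Φ s) = s := fun s => hΦ.injective.extend_apply _ _ s
  have himg : F '' S = range Φ := by
    ext y
    constructor
    · rintro ⟨s, hs, rfl⟩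
      exact ⟨⟨s, hs⟩, (hF ⟨s, hs⟩).symm⟩
    · rintro ⟨s, rfl⟩
      exact ⟨s, s.2, hF s⟩
  refine ⟨F, G, hF, ?_, fun s hs => ?_, ?_⟩
  · rw [continuousOn_iff_continuous_domRestrict]
    exact hΦ.continuous.congr fun s => (hF s).symm
  · rw [hF ⟨s, hs⟩, hG]
  · rw [himg]
    rintro _ ⟨s, rfl⟩
    rw [ContinuousWithinAt, ← hΦ.map_nhds_eq, Filter.tendsto_map'_iff, hG]
    exact (continuous_subtype_val.tendsto s).congr fun x => (hG x).symm

/-- The domain of the parametrization of a neighbourhood of the arc: a disc of radius two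
times the unit interval. -/
def tubeDomain : Set (ℂ × ℝ) := ball 0 2 ×ˢ Icc 0 1

/-- A parametrization `F` of an open neighbourhood of a proper arc in `X` from `A` to `B`, with its
inverse `G`, both extended to total functions. -/
structure IsTube (X A B : Set S3) (F : ℂ × ℝ → S3) (G : S3 → ℂ × ℝ) : Prop where
  continuousOn : ContinuousOn F tubeDomain
  mapsTo : MapsTo F tubeDomain X
  left_inv : ∀ q ∈ tubeDomain, G (F q) = q
  continuousOn_inv : ContinuousOn G (F '' tubeDomain)
  image_mem_nhdsWithin : ∀ q ∈ tubeDomain, F '' tubeDomain ∈ 𝓝[X] (F q)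
  mem_left : ∀ q ∈ tubeDomain, F q ∈ A ↔ q.2 = 0
  mem_right : ∀ q ∈ tubeDomain, F q ∈ B ↔ q.2 = 1

/-- The closed solid cylinder in the domain of a tube. -/
def solidCylinder : Set (ℂ × ℝ) := closedBall 0 1 ×ˢ Icc 0 1

/-- The part of the solid cylinder with open discs. -/
def openCylinder : Set (ℂ × ℝ) := ball 0 1 ×ˢ Icc 0 1

theorem openCylinder_subset : openCylinder ⊆ solidCylinder :=
  prod_mono ball_subset_closedBall le_rfl

theorem solidCylinder_subset : solidCylinder ⊆ tubeDomain :=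
  prod_mono (closedBall_subset_ball (by norm_num)) le_rfl

theorem IsArcWithRegularNeighborhood.exists_isTube {X A B Γ N : Set S3}
    (h : IsArcWithRegularNeighborhood X A B Γ N) :
    ∃ F G, IsTube X A B F G ∧ N = F '' solidCylinder := by
  obtain ⟨g, hg, hA, hB, -, hN⟩ := h
  let i : E2 ≃ₗᵢ[ℝ] ℂ := Complex.orthonormalBasisOneI.repr.symm
  have hdom : ∀ q : tubeDomain, i.symm (q : ℂ × ℝ).1 ∈ ball (0 : E2) 2 := fun q => by
    rw [mem_ball_zero_iff, i.symm.norm_map]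
    exact mem_ball_zero_iff.1 q.2.1
  let k : tubeDomain ≃ₜ ball (0 : E2) 2 × unitInterval :=
    { toFun := fun q => (⟨i.symm (q : ℂ × ℝ).1, hdom q⟩, ⟨(q : ℂ × ℝ).2, q.2.2⟩)
      invFun := fun z => ⟨(i z.1, z.2), by
        refine ⟨?_, z.2.2⟩
        rw [mem_ball_zero_iff, i.norm_map]
        exact mem_ball_zero_iff.1 z.1.2⟩
      left_inv := fun q => by simp
      right_inv := fun z => by simp
      continuous_toFun := by fun_prop
      continuous_invFun := by fun_prop }
  have hk : ∀ q : tubeDomain, ((k q).2 : ℝ) = (q : ℂ × ℝ).2 := fun q => rfl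
  have hkn : ∀ q : tubeDomain, ‖((k q).1 : E2)‖ = ‖(q : ℂ × ℝ).1‖ := fun q =>
    i.symm.norm_map _
  have hemb : IsEmbedding fun q : tubeDomain => (g (k q) : S3) :=
    IsEmbedding.subtypeVal.comp (hg.isEmbedding.comp k.isEmbedding)
  have : Nonempty S3 := ⟨⟨EuclideanSpace.single 0 1, by simp⟩⟩
  obtain ⟨F, G, hF, hFc, hGF, hGc⟩ := exists_total_of_isEmbedding hemb
  have himg : F '' tubeDomain = Subtype.val '' range g := by
    ext y
    constructor
    · rintro ⟨q, hq, rfl⟩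
      exact ⟨_, ⟨k ⟨q, hq⟩, rfl⟩, (hF ⟨q, hq⟩).symm⟩
    · rintro ⟨_, ⟨z, rfl⟩, rfl⟩
      refine ⟨k.symm z, (k.symm z).2, ?_⟩
      rw [hF, k.apply_symm_apply]
  refine ⟨F, G, ⟨hFc, fun q hq => ?_, hGF, hGc, fun q hq => ?_, fun q hq => ?_, fun q hq => ?_⟩, ?_⟩
  · rw [hF ⟨q, hq⟩]
    exact (g _).2
  · rw [himg, hF ⟨q, hq⟩, ← map_nhds_subtype_val]
    exact Filter.image_mem_map (hg.isOpen_range.mem_nhds ⟨_, rfl⟩)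
  · rw [hF ⟨q, hq⟩, hA, ← Subtype.coe_inj, hk]
    rfl
  · rw [hF ⟨q, hq⟩, hB, ← Subtype.coe_inj, hk]
    rfl
  · rw [hN]
    ext y
    constructor
    · rintro ⟨z, hz, rfl⟩
      refine ⟨k.symm z, ⟨?_, (k.symm z).2.2⟩, ?_⟩
      · rw [mem_closedBall_zero_iff, ← hkn, k.apply_symm_apply]
        exact hz
      · rw [hF, k.apply_symm_apply]
    · rintro ⟨q, hq, rfl⟩
      have hq' := solidCylinder_subset hq
      refine ⟨k ⟨q, hq'⟩, ?_, (hF ⟨q, hq'⟩).symm⟩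
      change ‖((k ⟨q, hq'⟩).1 : E2)‖ ≤ 1
      rw [hkn]
      exact mem_closedBall_zero_iff.1 hq.1

namespace IsTube

variable {X A B : Set S3} {F : ℂ × ℝ → S3} {G : S3 → ℂ × ℝ} (t : IsTube X A B F G)
include t

theorem injOn : InjOn F tubeDomain := fun q hq q' hq' h => by
  rw [← t.left_inv q hq, h, t.left_inv q' hq']

theorem mem_image_iff {S : Set (ℂ × ℝ)} (hS : S ⊆ tubeDomain) {q : ℂ × ℝ} (hq : q ∈ tubeDomain) :
    F q ∈ F '' S ↔ q ∈ S :=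
  ⟨fun ⟨_, hq', h⟩ => t.injOn (hS hq') hq h ▸ hq', fun h => ⟨q, h, rfl⟩⟩

theorem tendsto_inv {q : ℂ × ℝ} (hq : q ∈ tubeDomain) :
    Filter.Tendsto G (𝓝[X] (F q)) (𝓝 q) := by
  have h1 := t.continuousOn_inv (F q) ⟨q, hq, rfl⟩
  rw [ContinuousWithinAt, t.left_inv q hq] at h1
  exact h1.mono_left (nhdsWithin_le_iff.2 (t.image_mem_nhdsWithin q hq))

theorem eventually_right_inv {q : ℂ × ℝ} (hq : q ∈ tubeDomain) :
    ∀ᶠ y in 𝓝[X] (F q), G y ∈ tubeDomain ∧ F (G y) = y := by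
  filter_upwards [t.image_mem_nhdsWithin q hq]
  rintro _ ⟨q', hq', rfl⟩
  rw [t.left_inv q' hq']
  exact ⟨hq', rfl⟩

/-- The relative interior of the solid cylinder consists of its open discs. -/
theorem solidCylinder_mem_nhdsWithin {q : ℂ × ℝ} (hq : q ∈ tubeDomain) :
    F '' solidCylinder ∈ 𝓝[X] (F q) ↔ q ∈ openCylinder := by
  constructor
  · intro h
    have hmem := mem_of_mem_nhdsWithin (t.mapsTo hq) h
    rw [t.mem_image_iff solidCylinder_subset hq] at hmem
    refine ⟨?_, hmem.2⟩
    by_contra hnot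
    have h1 : ‖q.1‖ = 1 := le_antisymm (mem_closedBall_zero_iff.1 hmem.1)
      (not_lt.1 fun h => hnot (mem_ball_zero_iff.2 h))
    -- On the unit circle the ray through `q` leaves the solid cylinder.
    let p : ℝ → ℂ × ℝ := fun s => (s * q.1, q.2)
    have hp1 : p 1 = q := by simp [p]
    have hpD : ∀ s ∈ Ioo (1 : ℝ) 2, p s ∈ tubeDomain := fun s hs => by
      refine ⟨?_, hmem.2⟩
      rw [mem_ball_zero_iff, norm_mul, h1, mul_one, Complex.norm_real,
        Real.norm_of_nonneg (by linarith [hs.1])]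
      exact hs.2
    have hpc : Filter.Tendsto p (𝓝[>] 1) (𝓝[tubeDomain] q) := by
      refine tendsto_nhdsWithin_iff.2 ⟨?_, ?_⟩
      · have : Continuous p := by fun_prop
        exact hp1 ▸ (this.tendsto 1).mono_left nhdsWithin_le_nhds
      · filter_upwards [Ioo_mem_nhdsGT (one_lt_two (α := ℝ))] with s hs using hpD s hs
    have hF : Filter.Tendsto F (𝓝[tubeDomain] q) (𝓝[X] (F q)) :=
      (t.continuousOn q hq).tendsto_nhdsWithin t.mapsTo
    obtain ⟨s, hs, hsmem⟩ := ((Filter.Eventually.and (Ioo_mem_nhdsGT (one_lt_two (α := ℝ)))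
      ((hF.comp hpc).eventually h))).exists
    rw [Function.comp_apply] at hsmem
    have := mem_closedBall_zero_iff.1
      ((t.mem_image_iff solidCylinder_subset (hpD s hs)).1 hsmem).1
    rw [norm_mul, h1, mul_one, Complex.norm_real, Real.norm_of_nonneg (by linarith [hs.1])] at this
    linarith [hs.1]
  · intro h
    have h1 : ∀ᶠ y in 𝓝[X] (F q), (G y).1 ∈ ball (0 : ℂ) 1 :=
      (t.tendsto_inv hq).eventually
        ((isOpen_ball.preimage continuous_fst).mem_nhds h.1)
    filter_upwards [h1, t.eventually_right_inv hq] with y hy1 hy2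
    exact ⟨G y, ⟨ball_subset_closedBall hy1, hy2.1.2⟩, hy2.2⟩

theorem drilledRegion_eq : drilledRegion X (F '' solidCylinder) = X \ F '' openCylinder := by
  have hsub : F '' openCylinder ⊆ F '' solidCylinder := image_mono openCylinder_subset
  ext y
  simp only [drilledRegion, mem_sdiff]
  refine and_congr_right fun hy => not_congr ?_
  have key : y ∈ Subtype.val '' interior ((↑) ⁻¹' (F '' solidCylinder) : Set X) ↔
      F '' solidCylinder ∈ 𝓝[X] y := by
    rw [← preimage_coe_mem_nhds_subtype (a := (⟨y, hy⟩ : X)), ← mem_interior_iff_mem_nhds]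
    exact ⟨fun ⟨y', h1, h2⟩ => by subst h2; exact h1, fun h => ⟨_, h, rfl⟩⟩
  rw [key]
  constructor
  · intro h
    obtain ⟨q, hq, rfl⟩ := mem_of_mem_nhdsWithin hy h
    exact ⟨q, (t.solidCylinder_mem_nhdsWithin (solidCylinder_subset hq)).1 h, rfl⟩
  · rintro ⟨q, hq, rfl⟩
    exact (t.solidCylinder_mem_nhdsWithin
      (solidCylinder_subset (openCylinder_subset hq))).2 hq

theorem isClosed_image {S : Set (ℂ × ℝ)} (hS : S ⊆ tubeDomain) (hc : IsCompact S) :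
    IsClosed (F '' S) :=
  (hc.image_of_continuousOn (t.continuousOn.mono hS)).isClosed

end IsTube

theorem isCompact_solidCylinder : IsCompact solidCylinder :=
  (isCompact_closedBall _ _).prod isCompact_Icc

/-- The lateral boundary of the solid cylinder. -/
def lateralCylinder : Set (ℂ × ℝ) := sphere 0 1 ×ˢ Icc 0 1

theorem lateralCylinder_subset : lateralCylinder ⊆ tubeDomain :=
  prod_mono (sphere_subset_closedBall.trans (closedBall_subset_ball (by norm_num))) le_rfl

theorem isCompact_lateralCylinder : IsCompact lateralCylinder :=
  (isCompact_sphere _ _).prod isCompact_Icc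

theorem isConnected_lateralCylinder : IsConnected lateralCylinder := by
  have : IsConnected (sphere (0 : ℂ) 1) :=
    isConnected_sphere (by rw [Complex.rank_real_complex]; norm_num) 0 zero_le_one
  exact this.prod (isConnected_Icc zero_le_one)

namespace IsTube

variable {X A B : Set S3} {F : ℂ × ℝ → S3} {G : S3 → ℂ × ℝ} (t : IsTube X A B F G)
include t

theorem isClosed_drilled (hX : IsClosed X) : IsClosed (X \ F '' openCylinder) := by
  refine isClosed_iff_frequently.2 fun y hy => ?_
  have hyX : y ∈ X := hX.mem_of_frequently_of_tendsto (hy.mono fun _ h => h.1) Filter.tendsto_id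
  refine ⟨hyX, ?_⟩
  rintro ⟨q, hq, rfl⟩
  have hqD := solidCylinder_subset (openCylinder_subset hq)
  have h1 : ∀ᶠ y in 𝓝[X] (F q), y ∈ F '' openCylinder := by
    filter_upwards [(t.tendsto_inv hqD).eventually
      ((isOpen_ball.preimage continuous_fst).mem_nhds hq.1), t.eventually_right_inv hqD]
      with y h1 h2
    exact ⟨G y, ⟨h1, h2.1.2⟩, h2.2⟩
  rw [eventually_nhdsWithin_iff] at h1
  obtain ⟨y, hy1, hy2⟩ := (hy.and_eventually h1).exists
  exact hy1.2 (hy2 hy1.1)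

theorem isConnected_drilled (hX : IsClosed X) (hconn : IsConnected X) :
    IsConnected (X \ F '' openCylinder) := by
  refine isConnected_of_union_of_inter (t.isClosed_drilled hX)
    (t.isClosed_image solidCylinder_subset isCompact_solidCylinder) ?_ ?_
  · convert hconn
    ext y
    constructor
    · rintro (h | ⟨q, hq, rfl⟩)
      · exact h.1
      · exact t.mapsTo (solidCylinder_subset hq)
    · intro h
      by_cases hy : y ∈ F '' openCylinder
      · exact .inr (image_mono openCylinder_subset hy)
      · exact .inl ⟨h, hy⟩
  · have : (X \ F '' openCylinder) ∩ F '' solidCylinder = F '' lateralCylinder := by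
      ext y
      constructor
      · rintro ⟨⟨-, hy⟩, q, hq, rfl⟩
        refine ⟨q, ⟨?_, hq.2⟩, rfl⟩
        have h1 := mem_closedBall_zero_iff.1 hq.1
        refine mem_sphere_zero_iff_norm.2 (le_antisymm h1 (not_lt.1 fun h => hy ?_))
        exact ⟨q, ⟨mem_ball_zero_iff.2 h, hq.2⟩, rfl⟩
      · rintro ⟨q, hq, rfl⟩
        have hqD := lateralCylinder_subset hq
        refine ⟨⟨t.mapsTo hqD, fun h => ?_⟩, q, ⟨sphere_subset_closedBall hq.1, hq.2⟩, rfl⟩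
        rw [t.mem_image_iff (openCylinder_subset.trans solidCylinder_subset) hqD] at h
        have h1 := mem_ball_zero_iff.1 h.1
        rw [mem_sphere_zero_iff_norm.1 hq.1] at h1
        exact lt_irrefl _ h1
    rw [this]
    exact isConnected_lateralCylinder.image _ (t.continuousOn.mono lateralCylinder_subset)

end IsTube

/-! ### The tube near the glued discs -/

/-- A tube in the cut region of a trapping region `P` whose end discs match under `f`. -/
structure IsMatchedTube (P : Set S3) (f : S3 ≃ₜ S3) (F : ℂ × ℝ → S3) (G : S3 → ℂ × ℝ) : Prop where
  trapping : IsTrapping P f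
  tube : IsTube (cutRegion P f) (frontier (f '' P)) (frontier P) F G
  image_disc : f '' (frontier P ∩ F '' solidCylinder) = frontier (f '' P) ∩ F '' solidCylinder

/-- The map from the disc at the end of the tube to the disc at its start that is induced by `f`. -/
def returnMap (f : S3 ≃ₜ S3) (F : ℂ × ℝ → S3) (G : S3 → ℂ × ℝ) (z : ℂ) : ℂ := (G (f (F (z, 1)))).1

/-- The inverse of the return map. -/
def returnInv (f : S3 ≃ₜ S3) (F : ℂ × ℝ → S3) (G : S3 → ℂ × ℝ) (w : ℂ) : ℂ :=
  (G (f.symm (F (w, 0)))).1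

/-- The domain of the return map. -/
def returnDomain (f : S3 ≃ₜ S3) (F : ℂ × ℝ → S3) : Set ℂ :=
  {z | z ∈ ball 0 2 ∧ f (F (z, 1)) ∈ F '' tubeDomain}

/-- The domain of the inverse of the return map. -/
def returnRange (f : S3 ≃ₜ S3) (F : ℂ × ℝ → S3) : Set ℂ :=
  {w | w ∈ ball 0 2 ∧ f.symm (F (w, 0)) ∈ F '' tubeDomain}

/-- The tube, prolonged beyond its end through the preimage of the tube under `f`. -/
noncomputable def longTube (f : S3 ≃ₜ S3) (F : ℂ × ℝ → S3) (G : S3 → ℂ × ℝ) (q : ℂ × ℝ) : S3 :=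
  if q.2 ≤ 1 then F q else f.symm (F (returnMap f F G q.1, q.2 - 1))

open Classical in
/-- The inverse of the prolonged tube. -/
noncomputable def longTubeInv (P : Set S3) (f : S3 ≃ₜ S3) (F : ℂ × ℝ → S3) (G : S3 → ℂ × ℝ)
    (y : S3) : ℂ × ℝ :=
  if y ∈ cutRegion P f then G y else (returnInv f F G (G (f y)).1, (G (f y)).2 + 1)

theorem mk_one_mem_tubeDomain {z : ℂ} (hz : z ∈ ball (0 : ℂ) 2) : (z, (1 : ℝ)) ∈ tubeDomain :=
  ⟨hz, zero_le_one, le_rfl⟩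

theorem mk_zero_mem_tubeDomain {z : ℂ} (hz : z ∈ ball (0 : ℂ) 2) : (z, (0 : ℝ)) ∈ tubeDomain :=
  ⟨hz, le_rfl, zero_le_one⟩

/-- A continuous family of points of the region, parametrized by a planar disc, that meets the tube
at `z` has continuous tube coordinates near `z`. -/
theorem IsTube.eventually_of_family {X A B : Set S3} {F : ℂ × ℝ → S3} {G : S3 → ℂ × ℝ}
    (t : IsTube X A B F G) {u : ℂ → S3} (hu : ContinuousOn u (ball 0 2))
    (hX : ∀ z ∈ ball 0 2, u z ∈ X) {z : ℂ} (hz : z ∈ ball 0 2) (hz' : u z ∈ F '' tubeDomain) :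
    (∀ᶠ z' in 𝓝 z, z' ∈ ball 0 2 ∧ u z' ∈ F '' tubeDomain) ∧ ContinuousAt (fun z => G (u z)) z := by
  obtain ⟨q, hq, hqz⟩ := hz'
  have hb := isOpen_ball.mem_nhds hz
  have hcont : Filter.Tendsto u (𝓝 z) (𝓝[X] (F q)) := by
    refine tendsto_nhdsWithin_iff.2 ⟨?_, ?_⟩
    · rw [hqz]
      exact hu.continuousAt hb
    · filter_upwards [hb] with z' hz' using hX z' hz'
  refine ⟨?_, ?_⟩
  · filter_upwards [hb, hcont (t.image_mem_nhdsWithin q hq)] with z' h1 h2 using ⟨h1, h2⟩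
  · have := (t.tendsto_inv hq).comp hcont
    rwa [ContinuousAt, ← hqz, t.left_inv q hq]

namespace IsMatchedTube

variable {P : Set S3} {f : S3 ≃ₜ S3} {F : ℂ × ℝ → S3} {G : S3 → ℂ × ℝ}
  (T : IsMatchedTube P f F G)
include T

theorem end_mem {z : ℂ} (hz : z ∈ ball (0 : ℂ) 2) : F (z, 1) ∈ frontier P :=
  (T.tube.mem_right _ (mk_one_mem_tubeDomain hz)).2 rfl

theorem start_mem {z : ℂ} (hz : z ∈ ball (0 : ℂ) 2) : f.symm (F (z, 0)) ∈ frontier P := by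
  have := (T.tube.mem_left _ (mk_zero_mem_tubeDomain hz)).2 rfl
  rw [← f.image_frontier] at this
  obtain ⟨x, hx, he⟩ := this
  rwa [← he, f.symm_apply_apply]

theorem returnMap_spec {z : ℂ} (hz : z ∈ returnDomain f F) :
    returnMap f F G z ∈ ball 0 2 ∧ F (returnMap f F G z, 0) = f (F (z, 1)) := by
  obtain ⟨hz, q, hq, he⟩ := hz
  have h0 : q.2 = 0 := by
    rw [← T.tube.mem_left q hq, he, IsTrapping.apply_mem_frontier_image]
    exact T.end_mem hz
  have h1 : (returnMap f F G z, (0 : ℝ)) = q := by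
    rw [returnMap, ← he, T.tube.left_inv q hq, ← h0]
  have h2 : returnMap f F G z = q.1 := by rw [← h1]
  exact ⟨h2 ▸ hq.1, by rw [h1, ← he]⟩

theorem returnInv_spec {w : ℂ} (hw : w ∈ returnRange f F) :
    returnInv f F G w ∈ ball 0 2 ∧ F (returnInv f F G w, 1) = f.symm (F (w, 0)) := by
  obtain ⟨hw, q, hq, he⟩ := hw
  have h0 : q.2 = 1 := by
    rw [← T.tube.mem_right q hq, he]
    exact T.start_mem hw
  have h1 : (returnInv f F G w, (1 : ℝ)) = q := by
    rw [returnInv, ← he, T.tube.left_inv q hq, ← h0]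
  have h2 : returnInv f F G w = q.1 := by rw [← h1]
  exact ⟨h2 ▸ hq.1, by rw [h1, ← he]⟩

theorem returnMap_mem {z : ℂ} (hz : z ∈ returnDomain f F) :
    returnMap f F G z ∈ returnRange f F ∧ returnInv f F G (returnMap f F G z) = z := by
  obtain ⟨h1, h2⟩ := T.returnMap_spec hz
  have h3 : f.symm (F (returnMap f F G z, 0)) = F (z, 1) := by rw [h2, f.symm_apply_apply]
  refine ⟨⟨h1, ?_⟩, ?_⟩
  · rw [h3]
    exact ⟨_, mk_one_mem_tubeDomain hz.1, rfl⟩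
  · rw [returnInv, h3, T.tube.left_inv _ (mk_one_mem_tubeDomain hz.1)]

theorem returnInv_mem {w : ℂ} (hw : w ∈ returnRange f F) :
    returnInv f F G w ∈ returnDomain f F ∧ returnMap f F G (returnInv f F G w) = w := by
  obtain ⟨h1, h2⟩ := T.returnInv_spec hw
  have h3 : f (F (returnInv f F G w, 1)) = F (w, 0) := by rw [h2, f.apply_symm_apply]
  refine ⟨⟨h1, ?_⟩, ?_⟩
  · rw [h3]
    exact ⟨_, mk_zero_mem_tubeDomain hw.1, rfl⟩
  · rw [returnMap, h3, T.tube.left_inv _ (mk_zero_mem_tubeDomain hw.1)]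

theorem continuousOn_slice {s : ℝ} (hs : s ∈ Icc (0 : ℝ) 1) :
    ContinuousOn (fun z : ℂ => F (z, s)) (ball 0 2) :=
  T.tube.continuousOn.comp (Continuous.continuousOn (by fun_prop)) fun _ hz => ⟨hz, hs⟩

theorem eventually_returnDomain {z : ℂ} (hz : z ∈ returnDomain f F) :
    (∀ᶠ z' in 𝓝 z, z' ∈ returnDomain f F) ∧ ContinuousAt (returnMap f F G) z := by
  have := T.tube.eventually_of_family (u := fun z => f (F (z, 1)))
    (f.continuous.comp_continuousOn (T.continuousOn_slice ⟨zero_le_one, le_rfl⟩))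
    (fun z hz => T.trapping.apply_mem_cutRegion_of_mem_frontier (T.end_mem hz)) hz.1 hz.2
  exact ⟨this.1, continuous_fst.continuousAt.comp this.2⟩

theorem eventually_returnRange {w : ℂ} (hw : w ∈ returnRange f F) :
    (∀ᶠ w' in 𝓝 w, w' ∈ returnRange f F) ∧ ContinuousAt (returnInv f F G) w := by
  have := T.tube.eventually_of_family (u := fun w => f.symm (F (w, 0)))
    (f.symm.continuous.comp_continuousOn (T.continuousOn_slice ⟨le_rfl, zero_le_one⟩))
    (fun z hz => T.trapping.frontier_subset_cutRegion (T.start_mem hz)) hw.1 hw.2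
  exact ⟨this.1, continuous_fst.continuousAt.comp this.2⟩

theorem isOpen_returnDomain : IsOpen (returnDomain f F) :=
  isOpen_iff_mem_nhds.2 fun _ hz => (T.eventually_returnDomain hz).1

theorem continuousOn_returnMap : ContinuousOn (returnMap f F G) (returnDomain f F) :=
  fun _ hz => (T.eventually_returnDomain hz).2.continuousWithinAt

theorem injOn_returnMap : InjOn (returnMap f F G) (returnDomain f F) := fun z hz z' hz' h => by
  rw [← (T.returnMap_mem hz).2, h, (T.returnMap_mem hz').2]

theorem closedBall_returnMap {z : ℂ} (hz : z ∈ closedBall (0 : ℂ) 1) :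
    z ∈ returnDomain f F ∧ returnMap f F G z ∈ closedBall 0 1 := by
  have hz2 : z ∈ ball (0 : ℂ) 2 := closedBall_subset_ball (by norm_num) hz
  have h1 : f (F (z, 1)) ∈ f '' (frontier P ∩ F '' solidCylinder) :=
    ⟨_, ⟨T.end_mem hz2, _, ⟨hz, zero_le_one, le_rfl⟩, rfl⟩, rfl⟩
  rw [T.image_disc] at h1
  obtain ⟨-, q, hq, he⟩ := h1
  have hqD := solidCylinder_subset hq
  refine ⟨⟨hz2, q, hqD, he⟩, ?_⟩
  rw [returnMap, ← he, T.tube.left_inv q hqD]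
  exact hq.1

theorem closedBall_returnInv {w : ℂ} (hw : w ∈ closedBall (0 : ℂ) 1) :
    w ∈ returnRange f F ∧ returnInv f F G w ∈ closedBall 0 1 := by
  have hw2 : w ∈ ball (0 : ℂ) 2 := closedBall_subset_ball (by norm_num) hw
  have h1 : F (w, 0) ∈ frontier (f '' P) ∩ F '' solidCylinder :=
    ⟨(T.tube.mem_left _ (mk_zero_mem_tubeDomain hw2)).2 rfl, _, ⟨hw, le_rfl, zero_le_one⟩, rfl⟩
  rw [← T.image_disc] at h1
  obtain ⟨_, ⟨-, q, hq, rfl⟩, he⟩ := h1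
  have hqD := solidCylinder_subset hq
  have he' : f.symm (F (w, 0)) = F q := by rw [← he, f.symm_apply_apply]
  refine ⟨⟨hw2, q, hqD, he'.symm⟩, ?_⟩
  rw [returnInv, he', T.tube.left_inv q hqD]
  exact hq.1

theorem ball_returnMap {z : ℂ} (hz : z ∈ ball (0 : ℂ) 1) : returnMap f F G z ∈ ball 0 1 := by
  have hzV := (T.closedBall_returnMap (ball_subset_closedBall hz)).1
  obtain ⟨h1, h2⟩ := T.returnMap_mem hzV
  have h3 := T.eventually_returnRange h1
  have h4 := h3.2.eventually (isOpen_ball.mem_nhds (h2.symm ▸ hz))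
  rw [← interior_closedBall (0 : ℂ) one_ne_zero, mem_interior_iff_mem_nhds]
  filter_upwards [h3.1, h4] with w hw1 hw2
  rw [← (T.returnInv_mem hw1).2]
  exact (T.closedBall_returnMap (ball_subset_closedBall hw2)).2

theorem ball_returnInv {w : ℂ} (hw : w ∈ ball (0 : ℂ) 1) : returnInv f F G w ∈ ball 0 1 := by
  have hwV := (T.closedBall_returnInv (ball_subset_closedBall hw)).1
  obtain ⟨h1, h2⟩ := T.returnInv_mem hwV
  have h3 := T.eventually_returnDomain h1
  have h4 := h3.2.eventually (isOpen_ball.mem_nhds (h2.symm ▸ hw))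
  rw [← interior_closedBall (0 : ℂ) one_ne_zero, mem_interior_iff_mem_nhds]
  filter_upwards [h3.1, h4] with z hz1 hz2
  rw [← (T.returnMap_mem hz1).2]
  exact (T.closedBall_returnInv (ball_subset_closedBall hz2)).2

theorem returnMap_mem_ball_iff {z : ℂ} (hz : z ∈ returnDomain f F) :
    returnMap f F G z ∈ ball 0 1 ↔ z ∈ ball 0 1 := by
  refine ⟨fun h => ?_, T.ball_returnMap⟩
  rw [← (T.returnMap_mem hz).2]
  exact T.ball_returnInv h

theorem norm_returnMap {z : ℂ} (hz : ‖z‖ = 1) :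
    z ∈ returnDomain f F ∧ ‖returnMap f F G z‖ = 1 := by
  have h := T.closedBall_returnMap (mem_closedBall_zero_iff.2 hz.le)
  refine ⟨h.1, le_antisymm (mem_closedBall_zero_iff.1 h.2) (not_lt.1 fun hlt => ?_)⟩
  have := (T.returnMap_mem_ball_iff h.1).1 (mem_ball_zero_iff.2 hlt)
  rw [mem_ball_zero_iff, hz] at this
  exact lt_irrefl _ this

/-- The gluing map respects the removed part of the tube. -/
theorem apply_mem_openCylinder_iff {x : S3} (hx : x ∈ frontier P) :
    f x ∈ F '' openCylinder ↔ x ∈ F '' openCylinder := by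
  have hsub : openCylinder ⊆ tubeDomain := openCylinder_subset.trans solidCylinder_subset
  constructor
  · rintro ⟨⟨w, s⟩, hq, he⟩
    obtain rfl : s = 0 := by
      have := (T.tube.mem_left _ (hsub hq)).1 (by
        rw [he, IsTrapping.apply_mem_frontier_image]; exact hx)
      exact this
    have hw := (T.closedBall_returnInv (ball_subset_closedBall hq.1)).1
    have h2 := (T.returnInv_spec hw).2
    rw [he, f.symm_apply_apply] at h2
    exact ⟨(returnInv f F G w, 1), ⟨T.ball_returnInv hq.1, zero_le_one, le_rfl⟩, h2⟩
  · rintro ⟨⟨z, s⟩, hq, rfl⟩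
    obtain rfl : s = 1 := (T.tube.mem_right _ (hsub hq)).1 hx
    have hz := (T.closedBall_returnMap (ball_subset_closedBall hq.1)).1
    exact ⟨(returnMap f F G z, 0), ⟨T.ball_returnMap hq.1, le_rfl, zero_le_one⟩,
      (T.returnMap_spec hz).2⟩

end IsMatchedTube

/-- The domain of the prolonged tube. -/
def longDomain (f : S3 ≃ₜ S3) (F : ℂ × ℝ → S3) : Set (ℂ × ℝ) := returnDomain f F ×ˢ Ioo 0 2

namespace IsMatchedTube

variable {P : Set S3} {f : S3 ≃ₜ S3} {F : ℂ × ℝ → S3} {G : S3 → ℂ × ℝ}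
  (T : IsMatchedTube P f F G)
include T

omit T in
theorem mem_tubeDomain {q : ℂ × ℝ} (hq : q ∈ longDomain f F) (h : q.2 ≤ 1) : q ∈ tubeDomain :=
  ⟨hq.1.1, hq.2.1.le, h⟩

omit T in
theorem longTube_of_le {q : ℂ × ℝ} (h : q.2 ≤ 1) : longTube f F G q = F q := if_pos h

theorem return_mem_tubeDomain {q : ℂ × ℝ} (hq : q ∈ longDomain f F) (h : 1 ≤ q.2) :
    (returnMap f F G q.1, q.2 - 1) ∈ tubeDomain :=
  ⟨(T.returnMap_spec hq.1).1, by linarith, by linarith [hq.2.2]⟩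

theorem apply_longTube_of_ge {q : ℂ × ℝ} (hq : q ∈ longDomain f F) (h : 1 ≤ q.2) :
    f (longTube f F G q) = F (returnMap f F G q.1, q.2 - 1) := by
  rcases h.eq_or_lt with h | h
  · rw [longTube_of_le h.ge, ← h, sub_self, (T.returnMap_spec hq.1).2]
    congr 2
    exact Prod.ext rfl h.symm
  · rw [longTube, if_neg (not_le.2 h), f.apply_symm_apply]

/-- Beyond its end the tube leaves the cut region. -/
theorem longTube_notMem {q : ℂ × ℝ} (hq : q ∈ longDomain f F) (h : 1 < q.2) :
    longTube f F G q ∉ cutRegion P f := by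
  intro hmem
  have hD := T.return_mem_tubeDomain hq h.le
  have he := T.apply_longTube_of_ge hq h.le
  have h1 := T.trapping.mem_frontier_of_apply_mem hmem (by rw [he]; exact T.tube.mapsTo hD)
  have h2 := (T.tube.mem_left _ hD).1 (by
    rw [← he, IsTrapping.apply_mem_frontier_image]; exact h1)
  simp only at h2
  linarith

theorem longTubeInv_longTube {q : ℂ × ℝ} (hq : q ∈ longDomain f F) :
    longTubeInv P f F G (longTube f F G q) = q := by
  rcases le_or_gt q.2 1 with h | h
  · have hD := mem_tubeDomain hq h
    rw [longTube_of_le h, longTubeInv, if_pos (T.tube.mapsTo hD), T.tube.left_inv q hD]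
  · rw [longTubeInv, if_neg (T.longTube_notMem hq h), T.apply_longTube_of_ge hq h.le,
      T.tube.left_inv _ (T.return_mem_tubeDomain hq h.le), (T.returnMap_mem hq.1).2]
    simp

theorem continuousOn_longTube : ContinuousOn (longTube f F G) (longDomain f F) := by
  have hcl : closure {q : ℂ × ℝ | ¬ q.2 ≤ 1} ⊆ {q | 1 ≤ q.2} :=
    closure_minimal (fun q hq => (not_le.1 hq).le) (isClosed_le continuous_const continuous_snd)
  have hcl' : closure {q : ℂ × ℝ | q.2 ≤ 1} = {q | q.2 ≤ 1} :=
    (isClosed_le continuous_snd continuous_const).closure_eq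
  refine ContinuousOn.if ?_ ?_ ?_
  · rintro q ⟨hq, hfr⟩
    have h1 : q.2 = 1 := frontier_le_subset_eq continuous_snd continuous_const hfr
    have := T.apply_longTube_of_ge hq h1.ge
    rw [longTube_of_le h1.le] at this
    rw [← this, f.symm_apply_apply]
  · rw [hcl']
    exact T.tube.continuousOn.mono fun q hq => mem_tubeDomain hq.1 hq.2
  · refine f.symm.continuous.comp_continuousOn (T.tube.continuousOn.comp
      (ContinuousOn.prodMk (T.continuousOn_returnMap.comp continuousOn_fst fun q hq => hq.1.1)
        (Continuous.continuousOn (by fun_prop))) fun q hq => ?_)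
    exact T.return_mem_tubeDomain hq.1 (hcl hq.2)

/-- The points of the prolonged tube are interior to the union of two successive cut regions. -/
theorem longTube_mem_open {q : ℂ × ℝ} (hq : q ∈ longDomain f F) :
    ∀ᶠ y in 𝓝 (longTube f F G q), y ∈ cutRegion P f ∨ f y ∈ cutRegion P f := by
  have hopen : IsOpen (f ⁻¹' interior P \ f '' P) :=
    (isOpen_interior.preimage f.continuous).sdiff (f.isClosedMap _ T.trapping.isClosed)
  have hmem : longTube f F G q ∈ f ⁻¹' interior P \ f '' P := by
    rcases le_or_gt q.2 1 with h | h
    · have hD := mem_tubeDomain hq h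
      have hX := T.tube.mapsTo hD
      rw [longTube_of_le h]
      refine ⟨T.trapping.apply_mem hX.1, fun hmem => ?_⟩
      have hfr : F q ∈ frontier (f '' P) := by
        rw [(f.isClosedMap _ T.trapping.isClosed).frontier_eq]
        exact ⟨hmem, hX.2⟩
      have := (T.tube.mem_left q hD).1 hfr
      linarith [hq.2.1]
    · have hD := T.return_mem_tubeDomain hq h.le
      have hX := T.tube.mapsTo hD
      have he := T.apply_longTube_of_ge hq h.le
      rw [← he] at hX
      refine ⟨?_, ?_⟩
      · rw [mem_preimage]
        by_contra hnot
        have := (T.tube.mem_right _ hD).1 (by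
          rw [← he]; exact T.trapping.mem_frontier.2 ⟨hX.1, hnot⟩)
        simp only at this
        linarith [hq.2.2]
      · rintro ⟨x, hx, hxe⟩
        refine hX.2 ?_
        rw [← f.image_interior, ← hxe]
        exact ⟨_, T.trapping.apply_mem hx, rfl⟩
  filter_upwards [hopen.mem_nhds hmem] with y hy
  by_cases hyP : y ∈ P
  · exact .inl ⟨hyP, fun h => hy.2 (interior_subset h)⟩
  · exact .inr (IsTrapping.apply_mem_cutRegion.2 ⟨interior_subset hy.1,
      fun h => hyP (interior_subset h)⟩)

theorem longTubeInv_spec {q : ℂ × ℝ} (hq : q ∈ longDomain f F) :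
    ContinuousAt (longTubeInv P f F G) (longTube f F G q) ∧
      ∀ᶠ y in 𝓝 (longTube f F G q), longTube f F G (longTubeInv P f F G y) = y := by
  set y₀ := longTube f F G q with hy₀
  set X := cutRegion P f with hX
  have hXc : IsClosed X := T.trapping.isClosed_cutRegion
  have hle : 𝓝 y₀ ≤ 𝓝[X] y₀ ⊔ 𝓝[{y | y ∉ X ∧ f y ∈ X}] y₀ := by
    rw [← nhdsWithin_union]
    refine le_inf le_rfl (Filter.le_principal_iff.2 ?_)
    filter_upwards [T.longTube_mem_open hq] with y hy
    by_cases h : y ∈ X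
    · exact .inl h
    · exact .inr ⟨h, hy.resolve_left h⟩
  have hpos := hq.2.1
  -- In the cut region the tube is the given one.
  have key₁ : Filter.Tendsto (longTubeInv P f F G) (𝓝[X] y₀) (𝓝 q) ∧
      ∀ᶠ y in 𝓝[X] y₀, longTube f F G (longTubeInv P f F G y) = y := by
    rcases le_or_gt q.2 1 with h | h
    · have hD := mem_tubeDomain hq h
      have hy : y₀ = F q := longTube_of_le h
      have hinv : ∀ᶠ y in 𝓝[X] y₀, longTubeInv P f F G y = G y := by
        filter_upwards [self_mem_nhdsWithin] with y hy using if_pos hy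
      rw [hy] at hinv ⊢
      refine ⟨(T.tube.tendsto_inv hD).congr' (hinv.mono fun _ h => h.symm), ?_⟩
      filter_upwards [hinv, T.tube.eventually_right_inv hD] with y h1 h2
      rw [h1, longTube_of_le h2.1.2.2, h2.2]
    · have hbot : 𝓝[X] y₀ = ⊥ := by
        rw [← notMem_closure_iff_nhdsWithin_eq_bot, hXc.closure_eq]
        exact T.longTube_notMem hq h
      rw [hbot]
      simp
  -- Outside the cut region the tube is the preimage of the given one.
  have key₂ : Filter.Tendsto (longTubeInv P f F G) (𝓝[{y | y ∉ X ∧ f y ∈ X}] y₀) (𝓝 q) ∧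
      ∀ᶠ y in 𝓝[{y | y ∉ X ∧ f y ∈ X}] y₀, longTube f F G (longTubeInv P f F G y) = y := by
    by_cases hfy : f y₀ ∈ X
    · have hge : 1 ≤ q.2 := by
        by_contra! hlt
        have hD := mem_tubeDomain hq hlt.le
        have hy : y₀ = F q := longTube_of_le hlt.le
        rw [hy] at hfy
        have := (T.tube.mem_right q hD).1
          (T.trapping.mem_frontier_of_apply_mem (T.tube.mapsTo hD) hfy)
        linarith
      have hD := T.return_mem_tubeDomain hq hge
      have he := T.apply_longTube_of_ge hq hge
      have htend : Filter.Tendsto f (𝓝[{y | y ∉ X ∧ f y ∈ X}] y₀)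
          (𝓝[X] (F (returnMap f F G q.1, q.2 - 1))) := by
        refine tendsto_nhdsWithin_iff.2 ⟨?_, ?_⟩
        · rw [← he]
          exact (f.continuous.tendsto y₀).mono_left nhdsWithin_le_nhds
        · filter_upwards [self_mem_nhdsWithin] with y hy using hy.2
      have hG := (T.tube.tendsto_inv hD).comp htend
      have hw := T.returnMap_mem hq.1
      have hR := T.eventually_returnRange hw.1
      have hG1 : Filter.Tendsto (fun y => (G (f y)).1) (𝓝[{y | y ∉ X ∧ f y ∈ X}] y₀)
          (𝓝 (returnMap f F G q.1)) :=
        (continuous_fst.tendsto (returnMap f F G q.1, q.2 - 1)).comp hG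
      have hG2 : Filter.Tendsto (fun y => (G (f y)).2) (𝓝[{y | y ∉ X ∧ f y ∈ X}] y₀)
          (𝓝 (q.2 - 1)) := (continuous_snd.tendsto _).comp hG
      have hinv : ∀ᶠ y in 𝓝[{y | y ∉ X ∧ f y ∈ X}] y₀,
          longTubeInv P f F G y = (returnInv f F G (G (f y)).1, (G (f y)).2 + 1) := by
        filter_upwards [self_mem_nhdsWithin] with y hy using if_neg hy.1
      refine ⟨?_, ?_⟩
      · refine Filter.Tendsto.congr' (hinv.mono fun _ h => h.symm) ?_
        have h1 := hR.2.tendsto.comp hG1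
        rw [hw.2] at h1
        have h2 := hG2.add_const 1
        rw [sub_add_cancel] at h2
        exact h1.prodMk_nhds h2
      · filter_upwards [hinv, htend.eventually (T.tube.eventually_right_inv hD),
          hG1.eventually hR.1, self_mem_nhdsWithin] with y h1 h2 h3 h4
        have hne : (G (f y)).2 ≠ 0 := by
          intro h0
          have := (T.tube.mem_left _ h2.1).2 h0
          rw [h2.2, IsTrapping.apply_mem_frontier_image] at this
          exact h4.1 (T.trapping.frontier_subset_cutRegion this)
        have hlt : 0 < (G (f y)).2 := lt_of_le_of_ne h2.1.2.1 hne.symm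
        rw [h1, longTube, if_neg (by simp only [not_le]; linarith)]
        simp only [(T.returnInv_mem h3).2, add_sub_cancel_right]
        rw [Prod.mk.eta, h2.2, f.symm_apply_apply]
    · have hbot : 𝓝[{y | y ∉ X ∧ f y ∈ X}] y₀ = ⊥ := by
        rw [← notMem_closure_iff_nhdsWithin_eq_bot]
        intro hmem
        have : closure {y | y ∉ X ∧ f y ∈ X} ⊆ f ⁻¹' X :=
          closure_minimal (fun y hy => hy.2) (hXc.preimage f.continuous)
        exact hfy (this hmem)
      rw [hbot]
      simp
  refine ⟨?_, ?_⟩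
  · rw [ContinuousAt, hy₀, T.longTubeInv_longTube hq]
    exact (key₁.1.sup key₂.1).mono_left hle
  · exact hle (Filter.eventually_sup.2 ⟨key₁.2, key₂.2⟩)

theorem isOpen_longDomain : IsOpen (longDomain f F) := T.isOpen_returnDomain.prod isOpen_Ioo

/-- The prolonged tube as an open partial homeomorphism. -/
noncomputable def tubeHomeo : OpenPartialHomeomorph (ℂ × ℝ) S3 where
  toFun := longTube f F G
  invFun := longTubeInv P f F G
  source := longDomain f F
  target := longTube f F G '' longDomain f F
  map_source' q hq := ⟨q, hq, rfl⟩
  map_target' := by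
    rintro _ ⟨q, hq, rfl⟩
    rwa [T.longTubeInv_longTube hq]
  left_inv' q hq := T.longTubeInv_longTube hq
  right_inv' := by
    rintro _ ⟨q, hq, rfl⟩
    rw [T.longTubeInv_longTube hq]
  open_source := T.isOpen_longDomain
  open_target := by
    rw [isOpen_iff_mem_nhds]
    rintro _ ⟨q, hq, rfl⟩
    have h := T.longTubeInv_spec hq
    have h1 := h.1.eventually (T.isOpen_longDomain.mem_nhds
      ((T.longTubeInv_longTube hq).symm ▸ hq))
    filter_upwards [h1, h.2] with y h1 h2
    exact ⟨_, h1, h2⟩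
  continuousOn_toFun := T.continuousOn_longTube
  continuousOn_invFun := by
    rintro _ ⟨q, hq, rfl⟩
    exact (T.longTubeInv_spec hq).1.continuousWithinAt

end IsMatchedTube

/-! ### Orientations on the 3-sphere -/

/-- The homeomorphism `g` of the 3-sphere preserves the orientation with respect to the charts of
`A`. -/
def PreservesAtlas (A : Set (OpenPartialHomeomorph S3 E3)) (g : S3 ≃ₜ S3) : Prop :=
  ∀ φ ∈ A, ∀ ψ ∈ A, ∀ x ∈ φ.source, g x ∈ ψ.source →
    HasLinkClass (ψ ∘ g ∘ φ.symm) (φ x) (ContinuousMap.id S2)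

theorem IsOrientedAtlas.hasLinkClass {A : Set (OpenPartialHomeomorph S3 E3)}
    (hA : IsOrientedAtlas A) {φ ψ : OpenPartialHomeomorph S3 E3} (hφ : φ ∈ A) (hψ : ψ ∈ A) {x : S3}
    (hxφ : x ∈ φ.source) (hxψ : x ∈ ψ.source) :
    HasLinkClass (ψ ∘ φ.symm) (φ x) (ContinuousMap.id S2) := by
  have hs : φ x ∈ (φ.symm.trans ψ).source := by
    rw [OpenPartialHomeomorph.trans_source]
    exact ⟨φ.map_source hxφ, by simpa [φ.left_inv hxφ] using hxψ⟩
  exact (preservesOrientationAt_iff hs).1 (hA.2 φ hφ ψ hψ _ hs)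

theorem OpenPartialHomeomorph.eventually_comp_symm_left {T Y : Type*} [TopologicalSpace T]
    [TopologicalSpace Y] (φ : OpenPartialHomeomorph T Y) {x : T} (hx : x ∈ φ.source) :
    ∀ᶠ y in 𝓝 (φ x), y ∈ φ.target ∧ φ.symm y ∈ φ.source ∧ φ (φ.symm y) = y := by
  filter_upwards [φ.open_target.mem_nhds (φ.map_source hx)] with y hy
  exact ⟨hy, φ.map_target hy, φ.right_inv hy⟩

theorem OpenPartialHomeomorph.tendsto_symm_apply {T Y : Type*} [TopologicalSpace T]
    [TopologicalSpace Y] (φ : OpenPartialHomeomorph T Y) {x : T} (hx : x ∈ φ.source) :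
    Filter.Tendsto φ.symm (𝓝 (φ x)) (𝓝 x) := by
  have := φ.continuousAt_symm (φ.map_source hx)
  rwa [ContinuousAt, φ.left_inv hx] at this

namespace PreservesAtlas

variable {A : Set (OpenPartialHomeomorph S3 E3)} {g g' : S3 ≃ₜ S3}

theorem one (hA : IsOrientedAtlas A) : PreservesAtlas A 1 := fun _ hφ _ hψ _ hx hx' =>
  hA.hasLinkClass hφ hψ hx hx'

theorem mul (hA : IsOrientedAtlas A) (h : PreservesAtlas A g) (h' : PreservesAtlas A g') :
    PreservesAtlas A (g * g') := by
  intro φ hφ ψ hψ x hx hgx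
  obtain ⟨χ, hχ, hxχ⟩ := hA.1 (g' x)
  have h1 := h' φ hφ χ hχ x hx hxχ
  have h2 := h χ hχ ψ hψ (g' x) hxχ hgx
  have e : (χ ∘ g' ∘ φ.symm) (φ x) = χ (g' x) := by simp [φ.left_inv hx]
  rw [← e] at h2
  refine (h1.id_comp h2).congr_germ ?_
  have hev := ((g'.continuous.tendsto x).comp (φ.tendsto_symm_apply hx)).eventually
    (χ.eventually_left_inverse hxχ)
  filter_upwards [hev] with y hy
  simp only [Function.comp_apply] at hy ⊢
  rw [hy]
  rfl

theorem inv (h : PreservesAtlas A g) : PreservesAtlas A g⁻¹ := by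
  intro φ hφ ψ hψ x hx hgx
  let G : OpenPartialHomeomorph E3 E3 := (ψ.symm.trans g.toOpenPartialHomeomorph).trans φ
  have hgg : g (g⁻¹ x) = x := g.apply_symm_apply x
  have h1 := h ψ hψ φ hφ (g⁻¹ x) hgx (by rwa [hgg])
  have hs : ψ (g⁻¹ x) ∈ G.source := by
    simp only [G, OpenPartialHomeomorph.trans_source, mem_inter_iff, mem_preimage]
    refine ⟨⟨ψ.map_source hgx, mem_univ _⟩, ?_⟩
    change g (ψ.symm (ψ (g⁻¹ x))) ∈ φ.source
    rwa [ψ.left_inv hgx, hgg]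
  have h2 := hasLinkClass_symm (g := G) hs h1
  have e : G (ψ (g⁻¹ x)) = φ x := by
    change φ (g (ψ.symm (ψ (g⁻¹ x)))) = φ x
    rw [ψ.left_inv hgx, hgg]
  rw [e] at h2
  exact h2

theorem zpow (hA : IsOrientedAtlas A) (h : PreservesAtlas A g) (n : ℤ) :
    PreservesAtlas A (g ^ n) := by
  induction n using Int.induction_on with
  | zero => rw [zpow_zero]; exact one hA
  | succ n ih => rw [zpow_add, zpow_one]; exact mul hA ih h
  | pred n ih => rw [zpow_sub, zpow_one]; exact mul hA ih h.inv

end PreservesAtlas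

theorem OrientationPreserving.exists_atlas {f : S3 ≃ₜ S3} (hf : OrientationPreserving f) :
    ∃ A, IsOrientedAtlas A ∧ PreservesAtlas A f := by
  obtain ⟨A, hA, h⟩ := hf
  refine ⟨A, hA, fun φ hφ ψ hψ x hx hfx => ?_⟩
  have hs : φ x ∈ ((φ.symm.trans f.toOpenPartialHomeomorph).trans ψ).source := by
    simp only [OpenPartialHomeomorph.trans_source, mem_inter_iff, mem_preimage]
    refine ⟨⟨φ.map_source hx, mem_univ _⟩, ?_⟩
    change f (φ.symm (φ x)) ∈ ψ.source
    rwa [φ.left_inv hx]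
  exact (preservesOrientationAt_iff hs).1 (h φ hφ ψ hψ _ hs)

/-- On a connected set the local degree of a parametrization, with respect to an oriented atlas,
is constant. -/
theorem IsOrientedAtlas.exists_constant_class {A : Set (OpenPartialHomeomorph S3 E3)}
    (hA : IsOrientedAtlas A) (κ : OpenPartialHomeomorph E3 S3) {C : Set E3} (hC : IsPreconnected C)
    (hsub : C ⊆ κ.source) :
    ∃ c, ∀ y ∈ C, ∀ φ ∈ A, κ y ∈ φ.source → HasLinkClass (φ ∘ κ) y c := by
  have hex : ∀ y ∈ κ.source, ∀ φ : OpenPartialHomeomorph S3 E3, κ y ∈ φ.source →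
      ∃ c, HasLinkClass (φ ∘ κ) y c := fun y hy φ hφ =>
    (κ.trans φ).exists_hasLinkClass (by
      rw [OpenPartialHomeomorph.trans_source]; exact ⟨hy, hφ⟩)
  have hchange : ∀ y ∈ κ.source, ∀ φ ∈ A, ∀ ψ ∈ A, κ y ∈ φ.source → κ y ∈ ψ.source →
      ∀ c, HasLinkClass (φ ∘ κ) y c → HasLinkClass (ψ ∘ κ) y c := by
    intro y hy φ hφ ψ hψ h1 h2 c hc
    refine (hc.id_comp (hA.hasLinkClass hφ hψ h1 h2)).congr_germ ?_
    filter_upwards [(κ.continuousAt hy).eventually (φ.eventually_left_inverse h1)] with z hz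
    simp only [Function.comp_apply]
    rw [hz]
  rcases C.eq_empty_or_nonempty with rfl | ⟨y₀, hy₀⟩
  · exact ⟨ContinuousMap.id S2, fun y hy => hy.elim⟩
  obtain ⟨φ₀, hφ₀, hy₀φ⟩ := hA.1 (κ y₀)
  obtain ⟨c₀, hc₀⟩ := hex y₀ (hsub hy₀) φ₀ hy₀φ
  -- The points with a class homotopic to `c₀` and those with another class form disjoint open sets.
  let u : Set (C(S2, S2)) → Set E3 := fun s => {y | y ∈ κ.source ∧ ∃ φ ∈ A, κ y ∈ φ.source ∧
    ∃ c ∈ s, HasLinkClass (φ ∘ κ) y c}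
  have hu : ∀ s, IsOpen (u s) := by
    intro s
    rw [isOpen_iff_mem_nhds]
    rintro y ⟨hy, φ, hφ, hyφ, c, hcs, hc⟩
    filter_upwards [κ.open_source.mem_nhds hy,
      (κ.continuousAt hy).eventually (φ.open_source.mem_nhds hyφ), hc.eventually] with z h1 h2 h3
    exact ⟨h1, φ, hφ, h2, c, hcs, h3⟩
  have hdisj : Disjoint (u {c | c.Homotopic c₀}) (u {c | ¬ c.Homotopic c₀}) := by
    rw [disjoint_left]
    rintro y ⟨hy, φ, hφ, hyφ, c, hcs, hc⟩ ⟨-, ψ, hψ, hyψ, c', hcs', hc'⟩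
    exact hcs' (((hchange y hy φ hφ ψ hψ hyφ hyψ c hc).homotopic hc').symm.trans hcs)
  have hcov : C ⊆ u {c | c.Homotopic c₀} ∪ u {c | ¬ c.Homotopic c₀} := by
    intro y hy
    obtain ⟨φ, hφ, hyφ⟩ := hA.1 (κ y)
    obtain ⟨c, hc⟩ := hex y (hsub hy) φ hyφ
    by_cases h : c.Homotopic c₀
    · exact .inl ⟨hsub hy, φ, hφ, hyφ, c, h, hc⟩
    · exact .inr ⟨hsub hy, φ, hφ, hyφ, c, h, hc⟩
  have hall := hC.subset_left_of_subset_union (hu _) (hu _) hdisj hcov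
    ⟨y₀, hy₀, hsub hy₀, φ₀, hφ₀, hy₀φ, c₀, .refl c₀, hc₀⟩
  refine ⟨c₀, fun y hy ψ hψ hyψ => ?_⟩
  obtain ⟨-, φ, hφ, hyφ, c, hcs, hc⟩ := hall hy
  exact (hchange y (hsub hy) φ hφ ψ hψ hyφ hyψ c hc).congr_class hcs

/-- If `f` transports a parametrization `κ` of a connected region to `κ ∘ Γ`, up to a translation,
then `Γ` has local degree one. -/
theorem PreservesAtlas.hasLinkClass_of_conj {A : Set (OpenPartialHomeomorph S3 E3)}
    (hA : IsOrientedAtlas A) {f : S3 ≃ₜ S3} (hf : PreservesAtlas A f)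
    (κ : OpenPartialHomeomorph E3 S3) {C : Set E3} (hC : IsPreconnected C) (hsub : C ⊆ κ.source)
    {Γ : E3 → E3} {x a : E3} (hΓx : Γ x ∈ C) (hxa : x + a ∈ C)
    (hconj : ∀ᶠ y in 𝓝 x, f (κ (y + a)) = κ (Γ y)) {cΓ : C(S2, S2)} (hΓ : HasLinkClass Γ x cΓ) :
    HasLinkClass Γ x (ContinuousMap.id S2) := by
  obtain ⟨c, hc⟩ := hA.exists_constant_class κ hC hsub
  obtain ⟨φ, hφ, h1⟩ := hA.1 (κ (Γ x))
  obtain ⟨φ', hφ', h1'⟩ := hA.1 (κ (x + a))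
  have hfx : f (κ (x + a)) = κ (Γ x) := hconj.self_of_nhds
  have hL := hΓ.comp (hc _ hΓx φ hφ h1)
  have hR := (HasLinkClass.add_const a x).comp_id (hc _ hxa φ' hφ' h1')
  have hR' := hR.id_comp (hf φ' hφ' φ hφ _ h1' (by rwa [hfx]))
  have hgerm : (φ ∘ f ∘ φ'.symm) ∘ (φ' ∘ κ) ∘ (fun v => v + a) =ᶠ[𝓝 x] (φ ∘ κ) ∘ Γ := by
    have hcont : ContinuousAt (fun y => κ (y + a)) x :=
      ContinuousAt.comp (f := fun y => y + a) (κ.continuousAt (hsub hxa))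
        (by fun_prop)
    filter_upwards [hconj, hcont.eventually (φ'.eventually_left_inverse h1')] with y hy hy'
    simp only [Function.comp_apply]
    rw [hy', hy]
  have hcc := (hR'.congr_germ hgerm).homotopic hL
  let G := κ.trans φ
  have hGs : Γ x ∈ G.source := by
    rw [OpenPartialHomeomorph.trans_source]; exact ⟨hsub hΓx, h1⟩
  obtain ⟨d, hd⟩ := G.symm.exists_hasLinkClass (G.map_source hGs)
  have hdc : (d.comp c).Homotopic (ContinuousMap.id S2) :=
    HasLinkClass.comp_homotopic_id (g₁ := G) (hc _ hΓx φ hφ h1) hd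
      ((G.eventually_left_inverse hGs).mono fun _ h => h)
  refine hΓ.congr_class ?_
  -- `c ∘ cΓ` is homotopic to `c`, and `c` has the left inverse `d`, so it can be cancelled.
  have e1 : ((d.comp c).comp cΓ).Homotopic ((ContinuousMap.id S2).comp cΓ) := hdc.comp (.refl cΓ)
  have e2 : (d.comp c).Homotopic (d.comp (c.comp cΓ)) := (ContinuousMap.Homotopic.refl d).comp hcc
  rw [ContinuousMap.id_comp] at e1
  rw [ContinuousMap.comp_assoc] at e1
  exact e1.symm.trans (e2.symm.trans hdc)

namespace IsMatchedTube

variable {P : Set S3} {f : S3 ≃ₜ S3} {F : ℂ × ℝ → S3} {G : S3 → ℂ × ℝ}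
  (T : IsMatchedTube P f F G)
include T

/-- The boundary circles of the end discs of the tube are glued by an orientation preserving map. -/
theorem exists_angle (hf : OrientationPreserving f) :
    ∃ ψ : C(Circle, ℝ), (∀ z : Circle, returnMap f F G z = ((z * Circle.exp (ψ z) : Circle) : ℂ)) ∧
      StrictMono fun θ : ℝ => θ + ψ (Circle.exp θ) := by
  have hsub : closedBall (0 : ℂ) 1 ⊆ returnDomain f F := fun z hz => (T.closedBall_returnMap hz).1
  have hz : ∀ z : Circle, (z : ℂ) ∈ closedBall (0 : ℂ) 1 := fun z =>
    mem_closedBall_zero_iff.2 z.norm_coe.le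
  let g : Circle → Circle := fun z =>
    ⟨returnMap f F G z, mem_sphere_zero_iff_norm.2 (T.norm_returnMap z.norm_coe).2⟩
  have hg : Continuous g := Continuous.subtype_mk
    (T.continuousOn_returnMap.comp_continuous continuous_subtype_val fun z => hsub (hz z)) _
  have hgi : Function.Injective g := fun z z' h =>
    Circle.coe_injective (T.injOn_returnMap (hsub (hz z)) (hsub (hz z')) (congrArg Subtype.val h))
  obtain ⟨ψ, ⟨h1, h2⟩ | h1⟩ := exists_angle_of_injective hg hgi
  · exact ⟨ψ, fun z => congrArg Subtype.val (h1 z), h2⟩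
  exfalso
  have h0 : (0 : ℂ) ∈ ball (0 : ℂ) 1 := mem_ball_self one_pos
  refine not_hasLinkClass_cylinderMap (T.continuousOn_returnMap.mono hsub)
    (T.injOn_returnMap.mono hsub) (mem_ball_zero_iff.1 (T.ball_returnMap h0)) ψ
    (fun z => congrArg Subtype.val (h1 z)) (1 / 2) ?_
  -- In the coordinates `κ` of the prolonged tube, the unit translation along the tube followed by
  -- `f` is the product of the return map and the identity.
  obtain ⟨A, hA, hfA⟩ := hf.exists_atlas
  let κ : OpenPartialHomeomorph E3 S3 :=
    coordsE3.toHomeomorph.toOpenPartialHomeomorph.trans T.tubeHomeo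
  have hκ : ∀ x, κ x = longTube f F G (coordsE3 x) := fun x => rfl
  let D : Set (ℂ × ℝ) := ball 0 1 ×ˢ Ioo 0 2
  have hD : D ⊆ longDomain f F :=
    prod_mono (ball_subset_closedBall.trans hsub) le_rfl
  have hDc : IsPreconnected D := ((convex_ball _ _).prod (convex_Ioo _ _)).isPreconnected
  have hDo : IsOpen D := isOpen_ball.prod isOpen_Ioo
  let x : E3 := coordsE3.symm (0, 1 / 2)
  have hx : coordsE3 x = (0, 1 / 2) := coordsE3.apply_symm_apply _
  have hΓ : ∀ y, coordsE3 (cylinderMap (returnMap f F G) y) =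
      (returnMap f F G (coordsE3 y).1, (coordsE3 y).2) := fun y => coordsE3.apply_symm_apply _
  let s : Set E3 := coordsE3 ⁻¹' (ball 0 1 ×ˢ Ioo 0 1)
  have hs : s ∈ 𝓝 x := by
    refine ((isOpen_ball.prod isOpen_Ioo).preimage coordsE3.continuous).mem_nhds ?_
    rw [mem_preimage, hx]
    exact ⟨h0, by norm_num, by norm_num⟩
  have hΓex : ∃ c, HasLinkClass (cylinderMap (returnMap f F G)) x c := by
    refine exists_hasLinkClass hs ?_ ?_
    · refine coordsE3.symm.continuous.comp_continuousOn (ContinuousOn.prodMk ?_ ?_)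
      · exact T.continuousOn_returnMap.comp (Continuous.continuousOn (by fun_prop))
          fun y hy => hsub (ball_subset_closedBall hy.1)
      · exact Continuous.continuousOn (by fun_prop)
    · intro y hy y' hy' he
      have he' := congrArg coordsE3 he
      rw [hΓ, hΓ, Prod.mk.injEq] at he'
      refine coordsE3.injective (Prod.ext ?_ he'.2)
      exact T.injOn_returnMap (hsub (ball_subset_closedBall hy.1))
        (hsub (ball_subset_closedBall hy'.1)) he'.1
  obtain ⟨c, hc⟩ := hΓex
  refine PreservesAtlas.hasLinkClass_of_conj hA hfA κ (C := coordsE3 ⁻¹' D) (x := x)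
    (a := coordsE3.symm (0, 1)) ?_ ?_ ?_ ?_ ?_ hc
  · have : coordsE3 ⁻¹' D = coordsE3.symm '' D := (coordsE3.toEquiv.image_symm_eq_preimage D).symm
    rw [this]
    exact hDc.image _ coordsE3.symm.continuous.continuousOn
  · intro y hy
    simp only [κ, OpenPartialHomeomorph.trans_source, mem_inter_iff, mem_preimage]
    exact ⟨mem_univ _, hD hy⟩
  · rw [mem_preimage, hΓ, hx]
    exact ⟨T.ball_returnMap h0, by norm_num, by norm_num⟩
  · rw [mem_preimage, map_add, hx, coordsE3.apply_symm_apply]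
    refine ⟨by simp, ?_, ?_⟩ <;> norm_num
  · filter_upwards [hs] with y hy
    have hyV := hsub (ball_subset_closedBall hy.1)
    have h3 : coordsE3 (y + coordsE3.symm (0, 1)) = ((coordsE3 y).1, (coordsE3 y).2 + 1) := by
      rw [map_add, coordsE3.apply_symm_apply]
      ext <;> simp
    rw [hκ, hκ, hΓ, h3]
    have h4 : ((coordsE3 y).1, (coordsE3 y).2 + 1) ∈ longDomain f F :=
      ⟨hyV, by linarith [hy.2.1], by linarith [hy.2.2]⟩
    rw [T.apply_longTube_of_ge h4 (by simp only; linarith [hy.2.1]),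
      longTube_of_le (by simp only; exact hy.2.2.le)]
    simp

end IsMatchedTube

/-! ### The orbit space -/

/-- An injective, continuous and open map on an open set, as an open partial homeomorphism. -/
theorem exists_openPartialHomeomorph_of_injOn {T M : Type*} [TopologicalSpace T]
    [TopologicalSpace M] [Nonempty T] {g : T → M} {S : Set T} (hS : IsOpen S)
    (hc : ContinuousOn g S) (hi : InjOn g S) (ho : ∀ V, IsOpen V → IsOpen (g '' (V ∩ S))) :
    ∃ e : OpenPartialHomeomorph T M, e.source = S ∧ ∀ x, e x = g x := by
  refine ⟨OpenPartialHomeomorph.ofContinuousOpenRestrict (hi.toPartialEquiv g S) hc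
    (fun V hV => ?_) hS, rfl, fun x => rfl⟩
  obtain ⟨O, hO, rfl⟩ := isOpen_induced_iff.1 hV
  convert ho O hO using 1
  ext m
  constructor
  · rintro ⟨⟨x, hx⟩, hxO, rfl⟩
    exact ⟨x, ⟨hxO, hx⟩, rfl⟩
  · rintro ⟨x, ⟨hxO, hx⟩, rfl⟩
    exact ⟨⟨x, hx⟩, hxO, rfl⟩

/-- `p` restricts to a covering projection of the invariant set `Y` onto its orbit space under the
iterates of `f`; outside `Y` its values are irrelevant. -/
structure IsOrbitMap {M : Type*} [TopologicalSpace M] (f : S3 ≃ₜ S3) (Y : Set S3) (p : S3 → M) :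
    Prop where
  zpow_mem : ∀ y ∈ Y, ∀ n : ℤ, (f ^ n) y ∈ Y
  continuousOn : ContinuousOn p Y
  isOpen_image : ∀ V, IsOpen V → IsOpen (p '' (V ∩ Y))
  exists_injOn : ∀ y ∈ Y, ∃ V, IsOpen V ∧ y ∈ V ∧ InjOn p (V ∩ Y)
  surjOn : ∀ m, ∃ y ∈ Y, p y = m
  eq_iff : ∀ y ∈ Y, ∀ y' ∈ Y, p y = p y' ↔ ∃ n : ℤ, (f ^ n) y = y'

namespace GluedCover

variable {P Z : Set S3} {f : S3 ≃ₜ S3}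

/-- The image of the developing map. -/
def developed (Z A : Set S3) (f : S3 ≃ₜ S3) : Set S3 := range (dev Z A f)

theorem mem_developed {A : Set S3} {y : S3} : y ∈ developed Z A f ↔
    ∃ k : ℤ, ∃ x ∈ Z, (f ^ k) x = y := by
  constructor
  · rintro ⟨c, rfl⟩
    obtain ⟨k, x, rfl⟩ := exists_mk c
    exact ⟨k, x, x.2, rfl⟩
  · rintro ⟨k, x, hx, rfl⟩
    exact ⟨mk A f k ⟨x, hx⟩, rfl⟩

theorem zpow_mem_developed {A : Set S3} {y : S3} (n : ℤ) :
    (f ^ n) y ∈ developed Z A f ↔ y ∈ developed Z A f := by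
  have key : ∀ (n : ℤ) (y : S3), y ∈ developed Z A f → (f ^ n) y ∈ developed Z A f := by
    intro n y hy
    obtain ⟨k, x, hx, rfl⟩ := mem_developed.1 hy
    exact mem_developed.2 ⟨n + k, x, hx, f.zpow_add_apply n k x⟩
  refine ⟨fun h => ?_, key n y⟩
  have := key (-n) _ h
  rwa [f.zpow_neg_apply_zpow_apply] at this

theorem apply_mem_developed {A : Set S3} {y : S3} :
    f y ∈ developed Z A f ↔ y ∈ developed Z A f := by
  have := zpow_mem_developed (Z := Z) (A := A) (f := f) (y := y) 1
  rwa [zpow_one] at this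

theorem mem_developed_of_mem {A : Set S3} {y : S3} (hy : y ∈ Z) : y ∈ developed Z A f :=
  mem_developed.2 ⟨0, y, hy, by rw [zpow_zero]; rfl⟩

/-- In the cut region the developed set is `Z`, provided the gluing map respects `Z`. -/
theorem mem_developed_iff (h : IsTrapping P f) (hZ : Z ⊆ cutRegion P f)
    (hg : ∀ x ∈ frontier P, f x ∈ Z ↔ x ∈ Z) {y : S3} (hy : y ∈ cutRegion P f) :
    y ∈ developed Z (frontier P) f ↔ y ∈ Z := by
  refine ⟨fun hmem => ?_, mem_developed_of_mem⟩
  obtain ⟨k, x, hx, hxy⟩ := mem_developed.1 hmem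
  rcases h.eq_of_zpow_eq (hZ hx) hy hxy with ⟨-, h2⟩ | ⟨-, h2, h3⟩ | ⟨-, h2, h3⟩
  · exact h2 ▸ hx
  · rw [← h3, hg x h2]
    exact hx
  · rw [← hg y h2, h3]
    exact hx

/-- The projection to the glued space, transported to the 3-sphere by the developing map. -/
noncomputable def orbitMap (Z A : Set S3) (f : S3 ≃ₜ S3) [Nonempty (Glued Z A f)] :
    S3 → Glued Z A f :=
  Function.extend (dev Z A f) (proj Z A f) fun _ => Classical.arbitrary _

theorem isOrbitMap [Nonempty (Glued Z (frontier P) f)] (h : IsTrapping P f)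
    (hZ : Z ⊆ cutRegion P f) (hc : IsClosed Z) :
    IsOrbitMap f (developed Z (frontier P) f) (orbitMap Z (frontier P) f) := by
  have hinj := dev_injective h hZ
  have hemb := isEmbedding_dev h hZ hc
  have hp := isAddQuotientCoveringMap_proj h hZ
  have hd : ∀ c, orbitMap Z (frontier P) f (dev Z (frontier P) f c) = proj Z (frontier P) f c :=
    fun c => hinj.extend_apply _ _ c
  have heq : ∀ y ∈ developed Z (frontier P) f, ∀ y' ∈ developed Z (frontier P) f,
      orbitMap Z (frontier P) f y = orbitMap Z (frontier P) f y' ↔ ∃ n : ℤ, (f ^ n) y = y' := by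
    rintro _ ⟨c, rfl⟩ _ ⟨c', rfl⟩
    rw [hd, hd, eq_comm, proj_eq_iff]
    constructor
    · rintro ⟨n, hn⟩
      have hn : n +ᵥ c = c' := hn
      exact ⟨n, by rw [← dev_vadd, hn]⟩
    · rintro ⟨n, hn⟩
      rw [← dev_vadd] at hn
      exact ⟨n, hinj hn⟩
  refine ⟨fun y hy n => (zpow_mem_developed n).2 hy, ?_, fun V hV => ?_, ?_, fun m => ?_, heq⟩
  · rintro _ ⟨c, rfl⟩
    rw [ContinuousWithinAt, developed, ← hemb.map_nhds_eq, Filter.tendsto_map'_iff, hd]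
    exact (continuous_proj.tendsto c).congr fun x => (hd x).symm
  · have : orbitMap Z (frontier P) f '' (V ∩ developed Z (frontier P) f) =
        proj Z (frontier P) f '' (dev Z (frontier P) f ⁻¹' V) := by
      ext m
      constructor
      · rintro ⟨_, ⟨hV, c, rfl⟩, rfl⟩
        exact ⟨c, hV, (hd c).symm⟩
      · rintro ⟨c, hV, rfl⟩
        exact ⟨_, ⟨hV, c, rfl⟩, hd c⟩
    rw [this]
    exact hp.isCoveringMap.isOpenMap _ (hV.preimage continuous_dev)
  · intro y hy
    obtain ⟨k, x, hx, rfl⟩ := mem_developed.1 hy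
    obtain ⟨U, hU, hxU, hn⟩ := h.exists_wandering k (hZ hx)
    refine ⟨U, hU, hxU, fun y hy y' hy' he => ?_⟩
    obtain ⟨n, hn'⟩ := (heq y hy.2 y' hy'.2).1 he
    have h0 := hn n y hy.1 (hn' ▸ hy'.1)
    rw [h0, zpow_zero] at hn'
    exact hn'
  · obtain ⟨c, rfl⟩ := hp.surjective m
    exact ⟨_, ⟨c, rfl⟩, hd c⟩

end GluedCover

namespace IsOrbitMap

variable {M : Type*} [TopologicalSpace M] {f : S3 ≃ₜ S3} {Y : Set S3} {p : S3 → M}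
  (hp : IsOrbitMap f Y p)
include hp

theorem apply_zpow {y : S3} (hy : y ∈ Y) (n : ℤ) : p ((f ^ n) y) = p y :=
  ((hp.eq_iff y hy _ (hp.zpow_mem y hy n)).2 ⟨n, rfl⟩).symm

/-- A parametrization of an open subset of the 3-sphere in which `Y` corresponds to the half-space
induces a chart of the orbit space. -/
theorem exists_chart (Θ : OpenPartialHomeomorph E3 S3)
    (hΘ : ∀ x ∈ Θ.source, Θ x ∈ Y ↔ 0 ≤ x 0) {x₀ : E3} (hx₀ : x₀ ∈ Θ.source) (h0 : 0 ≤ x₀ 0) :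
    ∃ c : OpenPartialHomeomorph M (EuclideanHalfSpace 3), p (Θ x₀) ∈ c.source ∧
      (c (p (Θ x₀))).1 = x₀ := by
  obtain ⟨V, hV, hxV, hinj⟩ := hp.exists_injOn (Θ x₀) ((hΘ x₀ hx₀).2 h0)
  let O : Set E3 := Θ.source ∩ Θ ⁻¹' V
  have hO : IsOpen O := Θ.isOpen_inter_preimage hV
  let S : Set (EuclideanHalfSpace 3) := Subtype.val ⁻¹' O
  have hmem : ∀ x ∈ S, Θ x.1 ∈ V ∩ Y := fun x hx => ⟨hx.2, (hΘ x.1 hx.1).2 x.2⟩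
  obtain ⟨e, hes, he⟩ := exists_openPartialHomeomorph_of_injOn
    (g := fun x : EuclideanHalfSpace 3 => p (Θ x.1)) (S := S) (hO.preimage continuous_subtype_val)
    (hp.continuousOn.comp (Θ.continuousOn.comp continuous_subtype_val.continuousOn
      fun x hx => hx.1) fun x hx => (hmem x hx).2)
    (fun x hx x' hx' h => Subtype.ext (Θ.injOn hx.1 hx'.1 (hinj (hmem x hx) (hmem x' hx') h)))
    (fun W hW => by
      obtain ⟨W', hW', rfl⟩ := isOpen_induced_iff.1 hW
      have hopen : IsOpen (Θ '' (O ∩ W')) :=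
        Θ.isOpen_image_of_subset_source (hO.inter hW') fun x hx => hx.1.1
      convert hp.isOpen_image _ hopen using 1
      ext m
      constructor
      · rintro ⟨x, ⟨hxW, hxS⟩, rfl⟩
        exact ⟨Θ x.1, ⟨⟨x.1, ⟨hxS, hxW⟩, rfl⟩, (hmem x hxS).2⟩, rfl⟩
      · rintro ⟨_, ⟨⟨x, ⟨hxO, hxW⟩, rfl⟩, hxY⟩, rfl⟩
        exact ⟨⟨x, (hΘ x hxO.1).1 hxY⟩, ⟨hxW, hxO⟩, rfl⟩)
  have hxs : (⟨x₀, h0⟩ : EuclideanHalfSpace 3) ∈ e.source := by rw [hes]; exact ⟨hx₀, hxV⟩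
  refine ⟨e.symm, ?_, ?_⟩
  · exact he ⟨x₀, h0⟩ ▸ e.map_source hxs
  · have := e.left_inv hxs
    rw [he] at this
    rw [this]

/-- The open subset of the orbit space that corresponds to interior points of `Y` carries an
oriented atlas if the 3-sphere has one that is preserved by `f`. -/
theorem exists_orientedAtlas {A : Set (OpenPartialHomeomorph S3 E3)} (hA : IsOrientedAtlas A)
    (hf : PreservesAtlas A f) {W : Set M} (hW : IsOpen W)
    (hYW : ∀ y ∈ Y, p y ∈ W → Y ∈ 𝓝 y) :
    ∃ A' : Set (OpenPartialHomeomorph W E3), IsOrientedAtlas A' := by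
  rcases isEmpty_or_nonempty W with hWe | hWn
  · exact ⟨∅, fun w => (hWe.false w).elim, fun _ h => h.elim⟩
  refine ⟨{χ | ∃ φ ∈ A, ∃ σ : OpenPartialHomeomorph W S3, χ = σ.trans φ ∧
    ∀ w ∈ σ.source, σ w ∈ Y ∧ p (σ w) = w}, fun w => ?_, ?_⟩
  · obtain ⟨y, hy, hyw⟩ := hp.surjOn w
    obtain ⟨V, hV, hyV, hinj⟩ := hp.exists_injOn y hy
    obtain ⟨φ, hφ, hyφ⟩ := hA.1 y
    let S := V ∩ interior Y
    have hS : IsOpen S := hV.inter isOpen_interior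
    have hSY : S ⊆ V ∩ Y := inter_subset_inter_right _ interior_subset
    have : Nonempty S3 := ⟨y⟩
    obtain ⟨s, hss, hs⟩ := exists_openPartialHomeomorph_of_injOn hS
      (hp.continuousOn.mono (hSY.trans inter_subset_right)) (hinj.mono hSY) fun O hO => by
        have : O ∩ S = (O ∩ S) ∩ Y := (inter_eq_left.2 fun x hx => (hSY hx.2).2).symm
        rw [this]
        exact hp.isOpen_image _ (hO.inter hS)
    have hyS : y ∈ s.source := by
      rw [hss]
      exact ⟨hyV, mem_interior_iff_mem_nhds.2 (hYW y hy (hyw ▸ w.2))⟩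
    let i : OpenPartialHomeomorph W M := hW.isOpenEmbedding_subtypeVal.toOpenPartialHomeomorph _
    have hi : ∀ w, i w = (w : M) := fun w => rfl
    refine ⟨(i.trans s.symm).trans φ, ⟨φ, hφ, i.trans s.symm, rfl, fun w' hw' => ?_⟩, ?_⟩
    · have hw't : (w' : M) ∈ s.target := hw'.2
      have h1 := s.map_target hw't
      rw [hss] at h1
      refine ⟨(hSY h1).2, ?_⟩
      change p (s.symm w') = w'
      rw [← hs, s.right_inv hw't]
    · have hwt : (w : M) ∈ s.target := by
        rw [← hyw, ← hs]
        exact s.map_source hyS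
      have hsy : s.symm w = y := by
        rw [← hyw, ← hs, s.left_inv hyS]
      rw [OpenPartialHomeomorph.trans_source, OpenPartialHomeomorph.trans_source]
      refine ⟨⟨mem_univ _, hwt⟩, ?_⟩
      change s.symm w ∈ φ.source
      rwa [hsy]
  · rintro _ ⟨φ, hφ, σ, rfl, hσ⟩ _ ⟨φ', hφ', σ', rfl, hσ'⟩ y hy
    refine (preservesOrientationAt_iff hy).2 ?_
    have hy1 : y ∈ (σ.trans φ).target := hy.1
    set w := (σ.trans φ).symm y with hw
    have hws : w ∈ (σ.trans φ).source := (σ.trans φ).map_target hy1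
    have hws' : w ∈ (σ'.trans φ').source := hy.2
    have hyw : φ (σ w) = y := (σ.trans φ).right_inv hy1
    have hwσ : w ∈ σ.source := hws.1
    have hwφ : σ w ∈ φ.source := hws.2
    have hwσ' : w ∈ σ'.source := hws'.1
    have hwφ' : σ' w ∈ φ'.source := hws'.2
    obtain ⟨n, hn⟩ := (hp.eq_iff _ (hσ w hwσ).1 _ (hσ' w hwσ').1).1
      ((hσ w hwσ).2.trans (hσ' w hwσ').2.symm)
    have h1 := hf.zpow hA n φ hφ φ' hφ' (σ w) hwφ (by rwa [hn])
    rw [hyw] at h1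
    refine h1.congr_germ ?_
    obtain ⟨V, hV, hyV, hinj⟩ := hp.exists_injOn (σ' w) (hσ' w hwσ').1
    -- The two local sections differ by the fixed iterate near `y`.
    have ht1 : Filter.Tendsto φ.symm (𝓝 y) (𝓝 (σ w)) := hyw ▸ φ.tendsto_symm_apply hwφ
    have ht2 : Filter.Tendsto (fun y => σ.symm (φ.symm y)) (𝓝 y) (𝓝 w) :=
      (σ.tendsto_symm_apply hwσ).comp ht1
    have ht3 : Filter.Tendsto (fun y => σ' (σ.symm (φ.symm y))) (𝓝 y) (𝓝 (σ' w)) :=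
      (σ'.continuousAt hwσ').tendsto.comp ht2
    have ht4 : Filter.Tendsto (fun y => (f ^ n) (φ.symm y)) (𝓝 y) (𝓝 (σ' w)) :=
      hn ▸ ((f ^ n).continuous.tendsto _).comp ht1
    filter_upwards [ht1.eventually (σ.eventually_comp_symm_left hwσ),
      ht2.eventually (σ'.open_source.mem_nhds hwσ'), ht3.eventually (hV.mem_nhds hyV),
      ht4.eventually (hV.mem_nhds hyV)] with y' a1 a2 a3 a4
    change φ' ((f ^ n) (φ.symm y')) = φ' (σ' (σ.symm (φ.symm y')))
    have b1 := hσ _ a1.2.1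
    rw [a1.2.2] at b1
    have b2 := hσ' _ a2
    congr 1
    refine hinj ⟨a4, hp.zpow_mem _ b1.1 n⟩ ⟨a3, b2.1⟩ ?_
    rw [hp.apply_zpow b1.1, b1.2, b2.2]

end IsOrbitMap

/-! ### The boundary of the drilled region in the orbit space -/

/-- The cut region without the open tube. -/
def drilledCut (P : Set S3) (f : S3 ≃ₜ S3) (F : ℂ × ℝ → S3) : Set S3 :=
  cutRegion P f \ F '' openCylinder

theorem drilledCut_subset {P : Set S3} {f : S3 ≃ₜ S3} {F : ℂ × ℝ → S3} :
    drilledCut P f F ⊆ cutRegion P f := sdiff_subset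

namespace IsMatchedTube

variable {P : Set S3} {f : S3 ≃ₜ S3} {F : ℂ × ℝ → S3} {G : S3 → ℂ × ℝ}
  (T : IsMatchedTube P f F G)
include T

theorem isClosed_drilledCut : IsClosed (drilledCut P f F) :=
  T.tube.isClosed_drilled T.trapping.isClosed_cutRegion

theorem apply_mem_drilledCut {x : S3} (hx : x ∈ frontier P) :
    f x ∈ drilledCut P f F ↔ x ∈ drilledCut P f F := by
  simp only [drilledCut, mem_sdiff, T.apply_mem_openCylinder_iff hx,
    T.trapping.apply_mem_cutRegion_of_mem_frontier hx, T.trapping.frontier_subset_cutRegion hx]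

theorem tube_mem_drilledCut {q : ℂ × ℝ} (hq : q ∈ tubeDomain) :
    F q ∈ drilledCut P f F ↔ 1 ≤ ‖q.1‖ := by
  rw [drilledCut, mem_sdiff,
    T.tube.mem_image_iff (openCylinder_subset.trans solidCylinder_subset) hq]
  refine ⟨fun h => not_lt.1 fun hlt => h.2 ⟨mem_ball_zero_iff.2 hlt, hq.2⟩,
    fun h => ⟨T.tube.mapsTo hq, fun h' => ?_⟩⟩
  exact not_lt.2 h (mem_ball_zero_iff.1 h'.1)

theorem tube_mem_developed {q : ℂ × ℝ} (hq : q ∈ tubeDomain) :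
    F q ∈ GluedCover.developed (drilledCut P f F) (frontier P) f ↔ 1 ≤ ‖q.1‖ := by
  rw [GluedCover.mem_developed_iff T.trapping drilledCut_subset (fun x => T.apply_mem_drilledCut)
    (T.tube.mapsTo hq), T.tube_mem_drilledCut hq]

theorem longTube_mem_developed {q : ℂ × ℝ} (hq : q ∈ longDomain f F) :
    longTube f F G q ∈ GluedCover.developed (drilledCut P f F) (frontier P) f ↔ 1 ≤ ‖q.1‖ := by
  rcases le_total q.2 1 with h | h
  · rw [longTube_of_le h, T.tube_mem_developed (mem_tubeDomain hq h)]
  · rw [← GluedCover.apply_mem_developed, T.apply_longTube_of_ge hq h,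
      T.tube_mem_developed (T.return_mem_tubeDomain hq h), ← not_lt, ← not_lt]
    have := T.returnMap_mem_ball_iff hq.1
    rw [mem_ball_zero_iff, mem_ball_zero_iff] at this
    exact not_congr this

/-- A point of the developed set is an interior point unless its orbit meets the lateral boundary
of the tube. -/
theorem developed_mem_nhds {y : S3}
    (hy : y ∈ GluedCover.developed (drilledCut P f F) (frontier P) f)
    (hlat : ∀ n : ℤ, (f ^ n) y ∉ F '' lateralCylinder) :
    GluedCover.developed (drilledCut P f F) (frontier P) f ∈ 𝓝 y := by
  have hPc := T.trapping.isClosed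
  have hsolid : IsClosed (F '' solidCylinder) :=
    T.tube.isClosed_image solidCylinder_subset isCompact_solidCylinder
  have hnot : ∀ {x : S3}, x ∈ drilledCut P f F → x ∉ F '' lateralCylinder →
      x ∉ F '' solidCylinder := by
    rintro _ hx hx' ⟨q, hq, rfl⟩
    rw [T.tube_mem_drilledCut (solidCylinder_subset hq)] at hx
    exact hx' ⟨q, ⟨mem_sphere_zero_iff_norm.2 (le_antisymm (mem_closedBall_zero_iff.1 hq.1) hx),
      hq.2⟩, rfl⟩
  have hdev : ∀ {x : S3}, x ∈ cutRegion P f → x ∉ F '' solidCylinder →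
      x ∈ GluedCover.developed (drilledCut P f F) (frontier P) f := fun hx hx' =>
    GluedCover.mem_developed_of_mem ⟨hx, fun h => hx' (image_mono openCylinder_subset h)⟩
  have key : ∀ {x : S3}, x ∈ drilledCut P f F → x ∉ f '' P → x ∉ F '' lateralCylinder →
      f x ∉ F '' lateralCylinder →
      GluedCover.developed (drilledCut P f F) (frontier P) f ∈ 𝓝 x := by
    intro x hx hxP hxl hfxl
    have hfx : f x ∉ F '' solidCylinder := by
      intro h
      have hX : f x ∈ cutRegion P f := by
        obtain ⟨q, hq, he⟩ := h
        exact he ▸ T.tube.mapsTo (solidCylinder_subset hq)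
      have hfr := T.trapping.mem_frontier_of_apply_mem hx.1 hX
      exact hnot ((T.apply_mem_drilledCut hfr).2 hx) hfxl h
    have h1 : ∀ᶠ y in 𝓝 x, y ∉ f '' P := (f.isClosedMap _ hPc).isOpen_compl.mem_nhds hxP
    have h2 : ∀ᶠ y in 𝓝 x, f y ∈ interior P :=
      (isOpen_interior.preimage f.continuous).mem_nhds (T.trapping.apply_mem hx.1.1)
    have h3 : ∀ᶠ y in 𝓝 x, y ∉ F '' solidCylinder :=
      hsolid.isOpen_compl.mem_nhds (hnot hx hxl)
    have h4 : ∀ᶠ y in 𝓝 x, f y ∉ F '' solidCylinder :=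
      (hsolid.isOpen_compl.preimage f.continuous).mem_nhds hfx
    -- A point near `x` lies in the cut region, or its image under `f` does.
    filter_upwards [h1, h2, h3, h4] with y h1 h2 h3 h4
    by_cases hyP : y ∈ P
    · exact hdev ⟨hyP, fun h => h1 (interior_subset h)⟩ h3
    · exact GluedCover.apply_mem_developed.1 (hdev (IsTrapping.apply_mem_cutRegion.2
        ⟨interior_subset h2, fun h => hyP (interior_subset h)⟩) h4)
  have hpush : ∀ (n : ℤ) (x : S3),
      GluedCover.developed (drilledCut P f F) (frontier P) f ∈ 𝓝 x →
      GluedCover.developed (drilledCut P f F) (frontier P) f ∈ 𝓝 ((f ^ n) x) := by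
    intro n x hx
    have : Filter.Tendsto (f ^ (-n)) (𝓝 ((f ^ n) x)) (𝓝 x) := by
      have := (f ^ (-n)).continuous.tendsto ((f ^ n) x)
      rwa [f.zpow_neg_apply_zpow_apply] at this
    filter_upwards [this.eventually hx] with y hy using (GluedCover.zpow_mem_developed _).1 hy
  obtain ⟨k, x, hx, rfl⟩ := GluedCover.mem_developed.1 hy
  refine hpush k x ?_
  have hlat' : ∀ n : ℤ, (f ^ n) x ∉ F '' lateralCylinder := fun n => by
    have := hlat (n - k)
    rwa [← f.zpow_add_apply, sub_add_cancel] at this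
  by_cases hxP : x ∈ f '' P
  · obtain ⟨x', hx', rfl⟩ := hxP
    have hfr : x' ∈ frontier P :=
      T.trapping.mem_frontier.2 ⟨hx', (IsTrapping.apply_mem_cutRegion.1 hx.1).2⟩
    have := hpush 1 x' (key ((T.apply_mem_drilledCut hfr).1 hx)
      (fun h => (T.trapping.mem_frontier.1 hfr).2 (T.trapping.image_subset h)) ?_ ?_)
    · rwa [zpow_one] at this
    · have := hlat' (-1)
      rwa [zpow_neg_one, show f⁻¹ (f x') = x' from f.symm_apply_apply x'] at this
    · have := hlat' 0
      rwa [zpow_zero] at this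
  · refine key hx hxP ?_ ?_
    · have := hlat' 0
      rwa [zpow_zero] at this
    · have := hlat' 1
      rwa [zpow_one] at this

end IsMatchedTube

/-! ### The manifold structure of the orbit space -/

/-- Charts at all points whose first coordinate vanishes exactly at the points of `B` define a
manifold with boundary `B`. -/
theorem exists_chartedSpace_boundary_eq {M : Type*} [TopologicalSpace M] {B : Set M}
    (h : ∀ m, ∃ c : OpenPartialHomeomorph M (EuclideanHalfSpace 3), m ∈ c.source ∧
      ((c m).1 0 = 0 ↔ m ∈ B)) :
    ∃ _ : ChartedSpace (EuclideanHalfSpace 3) M, (𝓡∂ 3).boundary M = B := by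
  choose c hc hcB using h
  let C : ChartedSpace (EuclideanHalfSpace 3) M :=
    { atlas := range c
      chartAt := c
      mem_chart_source := hc
      chart_mem_atlas := fun m => ⟨m, rfl⟩ }
  refine ⟨C, ?_⟩
  ext m
  rw [← hcB m]
  change (𝓡∂ 3).IsBoundaryPoint m ↔ _
  rw [ModelWithCorners.isBoundaryPoint_iff, frontier_range_modelWithCornersEuclideanHalfSpace,
    mem_ofPred_eq, eq_comm]
  rfl

theorem IsOrbitMap.exists_chart_of_mem_nhds {M : Type*} [TopologicalSpace M] {f : S3 ≃ₜ S3}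
    {Y : Set S3} {p : S3 → M} (hp : IsOrbitMap f Y p) {y : S3} (hY : Y ∈ 𝓝 y)
    (φ : OpenPartialHomeomorph S3 E3) (hφ : y ∈ φ.source) :
    ∃ c : OpenPartialHomeomorph M (EuclideanHalfSpace 3), p y ∈ c.source ∧
      0 < (c (p y)).1 0 := by
  let a : E3 := EuclideanSpace.single 0 1
  have ha : a 0 = 1 := by simp [a]
  let Θ : OpenPartialHomeomorph E3 S3 :=
    (Homeomorph.addRight (φ y - a)).toOpenPartialHomeomorph.trans φ.symm
  have hΘ : ∀ x, Θ x = φ.symm (x + (φ y - a)) := fun x => rfl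
  have hΘa : Θ a = y := by rw [hΘ, add_sub_cancel, φ.left_inv hφ]
  have has : a ∈ Θ.source := by
    rw [OpenPartialHomeomorph.trans_source]
    refine ⟨mem_univ _, ?_⟩
    change a + (φ y - a) ∈ φ.target
    rw [add_sub_cancel]
    exact φ.map_source hφ
  let s : Set E3 := {x | 0 < x 0 ∧ Θ x ∈ Y}
  have hs : s ∈ 𝓝 a := by
    have h1 : ∀ᶠ x : E3 in 𝓝 a, 0 < x 0 := by
      have : Continuous fun x : E3 => x 0 := by fun_prop
      exact (isOpen_lt continuous_const this).mem_nhds (by rw [mem_ofPred_eq, ha]; exact one_pos)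
    have h2 : ∀ᶠ x in 𝓝 a, Θ x ∈ Y :=
      (Θ.continuousAt has).eventually (by rw [hΘa]; exact hY)
    filter_upwards [h1, h2] with x h1 h2 using ⟨h1, h2⟩
  obtain ⟨c, hc1, hc2⟩ := hp.exists_chart (Θ.restr s) (fun x hx => by
      rw [OpenPartialHomeomorph.restr_source] at hx
      have := interior_subset hx.2
      exact ⟨fun _ => this.1.le, fun _ => this.2⟩) (x₀ := a)
    (by rw [OpenPartialHomeomorph.restr_source]; exact ⟨has, mem_interior_iff_mem_nhds.2 hs⟩)
    (by rw [ha]; exact zero_le_one)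
  have he : (Θ.restr s) a = y := hΘa
  rw [he] at hc1 hc2
  exact ⟨c, hc1, by rw [hc2, ha]; exact one_pos⟩

namespace IsMatchedTube

variable {P : Set S3} {f : S3 ≃ₜ S3} {F : ℂ × ℝ → S3} {G : S3 → ℂ × ℝ}
  (T : IsMatchedTube P f F G)
include T

/-- Polar coordinates around the prolonged tube give a chart at its lateral boundary. -/
theorem exists_chart_longTube {M : Type*} [TopologicalSpace M] {p : S3 → M}
    (hp : IsOrbitMap f (GluedCover.developed (drilledCut P f F) (frontier P) f) p)
    {q : ℂ × ℝ} (hq : q ∈ longDomain f F) (hq1 : ‖q.1‖ = 1) :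
    ∃ c : OpenPartialHomeomorph M (EuclideanHalfSpace 3), p (longTube f F G q) ∈ c.source ∧
      (c (p (longTube f F G q))).1 0 = 0 := by
  obtain ⟨z, t⟩ := q
  -- In the coordinates `(log ‖z‖, arg z, t)` the developed set is a half-space.
  let ζ : ℂ := Complex.log z
  have hz0 : z ≠ 0 := norm_ne_zero_iff.1 (by rw [hq1]; exact one_ne_zero)
  have hζ : Complex.exp ζ = z := Complex.exp_log hz0
  have hζre : ζ.re = 0 := by rw [Complex.log_re, hq1, Real.log_one]
  obtain ⟨e, hζe, he⟩ := Complex.isCoveringMapOn_exp.isLocalHomeomorphOn ζ (Complex.exp_ne_zero ζ)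
  let Θ : OpenPartialHomeomorph E3 S3 := coordsE3.toHomeomorph.toOpenPartialHomeomorph.trans
    ((e.prod (OpenPartialHomeomorph.refl ℝ)).trans T.tubeHomeo)
  have hΘ : ∀ x, Θ x = longTube f F G (Complex.exp (coordsE3 x).1, (coordsE3 x).2) := fun x => by
    rw [he]; rfl
  have hΘs : ∀ x, x ∈ Θ.source ↔ (coordsE3 x).1 ∈ e.source ∧
      (Complex.exp (coordsE3 x).1, (coordsE3 x).2) ∈ longDomain f F := fun x => by
    rw [he]
    simp only [Θ, OpenPartialHomeomorph.trans_source, OpenPartialHomeomorph.prod_source,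
      mem_inter_iff, mem_preimage]
    exact ⟨fun h => ⟨h.2.1.1, h.2.2⟩, fun h => ⟨mem_univ _, ⟨h.1, mem_univ _⟩, h.2⟩⟩
  obtain ⟨x₀, hx₀⟩ := coordsE3.surjective (ζ, t)
  have hx0 : x₀ 0 = 0 := by
    rw [coordsE3_apply, Prod.mk.injEq] at hx₀
    rw [← hζre, ← hx₀.1]
  have hmem : x₀ ∈ Θ.source := by
    rw [hΘs, hx₀, hζ]
    exact ⟨hζe, hq⟩
  have hval : Θ x₀ = longTube f F G (z, t) := by rw [hΘ, hx₀, hζ]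
  obtain ⟨c, h1, h2⟩ := hp.exists_chart Θ (fun x hx => by
    rw [hΘ, T.longTube_mem_developed ((hΘs x).1 hx).2, Complex.norm_exp, Real.one_le_exp_iff,
      coordsE3_apply]) hmem hx0.ge
  rw [hval] at h1 h2
  exact ⟨c, h1, by rw [h2, hx0]⟩

/-- Every point of the lateral boundary is equivalent to an interior point of the prolonged tube. -/
theorem exists_chart_lateral {M : Type*} [TopologicalSpace M] {p : S3 → M}
    (hp : IsOrbitMap f (GluedCover.developed (drilledCut P f F) (frontier P) f) p)
    {q : ℂ × ℝ} (hq : q ∈ lateralCylinder) :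
    ∃ c : OpenPartialHomeomorph M (EuclideanHalfSpace 3), p (F q) ∈ c.source ∧
      (c (p (F q))).1 0 = 0 := by
  obtain ⟨z, t⟩ := q
  have hz : ‖z‖ = 1 := mem_sphere_zero_iff_norm.1 hq.1
  -- The prolonged tube is open at `t = 0`, where points are moved to `t = 1` by `f⁻¹`.
  rcases hq.2.1.eq_or_lt with h0 | h0
  · simp only at h0
    subst h0
    have hzr := (T.closedBall_returnInv (sphere_subset_closedBall hq.1)).1
    obtain ⟨h1, h2⟩ := T.returnInv_mem hzr
    set w := returnInv f F G z with hw
    have hw1 : ‖w‖ = 1 := by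
      have hwb := (T.closedBall_returnInv (sphere_subset_closedBall hq.1)).2
      refine le_antisymm (mem_closedBall_zero_iff.1 hwb) (not_lt.1 fun hlt => ?_)
      have := (T.returnMap_mem_ball_iff h1).2 (mem_ball_zero_iff.2 hlt)
      rw [h2, mem_ball_zero_iff, hz] at this
      exact lt_irrefl _ this
    have hwl : (w, (1 : ℝ)) ∈ longDomain f F := ⟨h1, by norm_num, by norm_num⟩
    have := T.exists_chart_longTube hp hwl hw1
    rw [longTube_of_le le_rfl] at this
    have heq : p (F (z, 0)) = p (F (w, 1)) := by
      have hD : (w, (1 : ℝ)) ∈ tubeDomain := mk_one_mem_tubeDomain h1.1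
      rw [← hp.apply_zpow ((T.tube_mem_developed hD).2 hw1.ge) 1, zpow_one,
        ← (T.returnMap_spec h1).2, h2]
    rwa [heq]
  · have := T.exists_chart_longTube hp (q := (z, t))
      ⟨(T.norm_returnMap hz).1, h0, hq.2.2.trans_lt one_lt_two⟩ hz
    rwa [longTube_of_le hq.2.2] at this

end IsMatchedTube

/-! ### The boundary torus -/

/-- Continuous surjections from a compact space onto Hausdorff spaces that identify the same points
have homeomorphic images. -/
theorem nonempty_homeomorph_of_eq_iff {Q S T : Type*} [TopologicalSpace Q] [TopologicalSpace S]
    [TopologicalSpace T] [CompactSpace Q] [T2Space S] [T2Space T] {a : Q → S} {b : Q → T}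
    (ha : Continuous a) (hb : Continuous b) (hsa : Function.Surjective a)
    (hsb : Function.Surjective b) (h : ∀ x y, a x = a y ↔ b x = b y) : Nonempty (S ≃ₜ T) := by
  have qa : IsQuotientMap (⟨a, ha⟩ : C(Q, S)) := .of_surjective_continuous hsa ha
  have qb : IsQuotientMap (⟨b, hb⟩ : C(Q, T)) := .of_surjective_continuous hsb hb
  exact ⟨qa.homeomorph.symm.trans ((Homeomorph.Quotient.congrRight h).trans qb.homeomorph)⟩

section Twist

variable {ψ : C(Circle, ℝ)} (hψ : StrictMono fun θ : ℝ => θ + ψ (Circle.exp θ))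
include hψ

theorem strictMono_twist {s : ℝ} (hs : s ∈ Icc (0 : ℝ) 1) :
    StrictMono fun θ : ℝ => θ + s * ψ (Circle.exp θ) := by
  intro θ θ' h
  have h1 : θ + ψ (Circle.exp θ) < θ' + ψ (Circle.exp θ') := hψ h
  rcases hs.1.eq_or_lt with rfl | h0
  · simpa using h
  · simp only
    nlinarith [mul_pos h0 (sub_pos.2 h1), mul_nonneg (sub_nonneg.2 hs.2) (sub_nonneg.2 h.le)]

/-- The twist maps that interpolate between the identity and the return map on the circle are
injective. -/
theorem injective_twist {s : ℝ} (hs : s ∈ Icc (0 : ℝ) 1) :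
    Function.Injective fun z : Circle => z * Circle.exp (s * ψ z) := by
  intro z z' h
  obtain ⟨θ, rfl⟩ := exists_circleExp_eq z
  obtain ⟨θ', rfl⟩ := exists_circleExp_eq z'
  simp only [← Circle.exp_add] at h
  obtain ⟨n, hn⟩ := Circle.exp_eq_exp.1 h
  have := (strictMono_twist hψ hs).injective (a₁ := θ) (a₂ := θ' + n * (2 * Real.pi)) (by
    simp only [circleExp_add_two_pi_int]
    rw [hn]
    ring)
  rw [this, circleExp_add_two_pi_int]

omit hψ in
theorem surjective_twist (ψ : C(Circle, ℝ)) (s : ℝ) :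
    Function.Surjective fun z : Circle => z * Circle.exp (s * ψ z) := by
  intro w
  obtain ⟨α, rfl⟩ := exists_circleExp_eq w
  have hb : ∀ θ, |s * ψ (Circle.exp θ)| ≤ |s| * ‖ψ‖ := fun θ => by
    rw [abs_mul]
    exact mul_le_mul_of_nonneg_left (ψ.norm_coe_le_norm _) (abs_nonneg s)
  have hsurj : Function.Surjective fun θ : ℝ => θ + s * ψ (Circle.exp θ) :=
    Continuous.surjective (by fun_prop)
      (Filter.tendsto_atTop_add_right_of_le _ (-(|s| * ‖ψ‖)) Filter.tendsto_id
        fun θ => (abs_le.1 (hb θ)).1)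
      (Filter.tendsto_atBot_add_right_of_ge _ (|s| * ‖ψ‖) Filter.tendsto_id
        fun θ => (abs_le.1 (hb θ)).2)
  obtain ⟨θ, hθ⟩ := hsurj α
  refine ⟨Circle.exp θ, ?_⟩
  simp only at hθ ⊢
  rw [← Circle.exp_add, hθ]

/-- The twist map of the circle times the unit interval onto the torus. -/
noncomputable def twistTorus (ψ : C(Circle, ℝ)) (q : Circle × unitInterval) : Circle × Circle :=
  (q.1 * Circle.exp (q.2 * ψ q.1), Circle.exp (2 * Real.pi * q.2))

omit hψ in
theorem continuous_twistTorus (ψ : C(Circle, ℝ)) : Continuous (twistTorus ψ) := by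
  unfold twistTorus
  fun_prop

omit hψ in
theorem surjective_twistTorus (ψ : C(Circle, ℝ)) : Function.Surjective (twistTorus ψ) := by
  rintro ⟨w, u⟩
  obtain ⟨α, rfl⟩ := exists_circleExp_eq u
  let t : unitInterval := ⟨Int.fract (α / (2 * Real.pi)), Int.fract_nonneg _,
    (Int.fract_lt_one _).le⟩
  obtain ⟨z, hz⟩ := surjective_twist ψ t w
  refine ⟨(z, t), Prod.ext hz ?_⟩
  change Circle.exp (2 * Real.pi * Int.fract (α / (2 * Real.pi))) = _
  rw [← circleExp_add_two_pi_int _ ⌊α / (2 * Real.pi)⌋]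
  congr 1
  have h1 := Int.fract_add_floor (α / (2 * Real.pi))
  have h2 : 2 * Real.pi * (α / (2 * Real.pi)) = α := mul_div_cancel₀ α Real.two_pi_pos.ne'
  rw [← h1] at h2
  linarith

/-- The twist map exhibits the torus as the mapping torus of the return map. -/
theorem twistTorus_eq_iff {z z' : Circle} {t t' : unitInterval} :
    twistTorus ψ (z, t) = twistTorus ψ (z', t') ↔ (z = z' ∧ t = t') ∨
      (t = 1 ∧ t' = 0 ∧ z * Circle.exp (ψ z) = z') ∨
      (t' = 1 ∧ t = 0 ∧ z' * Circle.exp (ψ z') = z) := by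
  have h0 : Circle.exp 0 = 1 := Circle.exp_zero
  have h1 : Circle.exp (2 * Real.pi) = 1 := Circle.exp_two_pi
  constructor
  · intro h
    obtain ⟨h2, h3⟩ := Prod.ext_iff.1 h
    simp only [twistTorus] at h2 h3
    obtain ⟨n, hn⟩ := Circle.exp_eq_exp.1 h3
    have hn' : (t : ℝ) = t' + n := by
      have := Real.two_pi_pos
      apply mul_left_cancel₀ this.ne'
      linarith
    have b1 := t.2.1
    have b2 := t.2.2
    have b3 := t'.2.1
    have b4 := t'.2.2
    have hn1 : n ≤ 1 := by
      have : (n : ℝ) ≤ 1 := by linarith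
      exact_mod_cast this
    have hn2 : -1 ≤ n := by
      have : (-1 : ℝ) ≤ n := by linarith
      exact_mod_cast this
    obtain rfl | rfl | rfl : n = 0 ∨ n = 1 ∨ n = -1 := by omega
    · have ht : t = t' := Subtype.ext (by simpa using hn')
      subst ht
      exact .inl ⟨injective_twist hψ t.2 h2, rfl⟩
    · push_cast at hn'
      have ht : t = 1 := Subtype.ext (by change (t : ℝ) = 1; linarith)
      have ht' : t' = 0 := Subtype.ext (by change (t' : ℝ) = 0; linarith)
      subst ht ht'
      exact .inr (.inl ⟨rfl, rfl, by simpa [h0] using h2⟩)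
    · push_cast at hn'
      have ht : t = 0 := Subtype.ext (by change (t : ℝ) = 0; linarith)
      have ht' : t' = 1 := Subtype.ext (by change (t' : ℝ) = 1; linarith)
      subst ht ht'
      exact .inr (.inr ⟨rfl, rfl, by simpa [h0] using h2.symm⟩)
  · rintro (⟨rfl, rfl⟩ | ⟨rfl, rfl, rfl⟩ | ⟨rfl, rfl, rfl⟩)
    · rfl
    · simp [twistTorus, h0, h1]
    · simp [twistTorus, h0, h1]

end Twist

namespace IsMatchedTube

variable {P : Set S3} {f : S3 ≃ₜ S3} {F : ℂ × ℝ → S3} {G : S3 → ℂ × ℝ}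
  (T : IsMatchedTube P f F G)
include T

/-- On the lateral boundary of the tube the projection to the orbit space identifies the two end
circles by the return map, and nothing else. -/
theorem orbitMap_lateral_eq_iff {M : Type*} [TopologicalSpace M] {p : S3 → M}
    (hp : IsOrbitMap f (GluedCover.developed (drilledCut P f F) (frontier P) f) p)
    {z z' : ℂ} {t t' : ℝ} (hq : (z, t) ∈ lateralCylinder) (hq' : (z', t') ∈ lateralCylinder) :
    p (F (z, t)) = p (F (z', t')) ↔ (z = z' ∧ t = t') ∨
      (t = 1 ∧ t' = 0 ∧ returnMap f F G z = z') ∨ (t' = 1 ∧ t = 0 ∧ returnMap f F G z' = z) := by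
  have hmem : ∀ {q}, q ∈ lateralCylinder →
      F q ∈ GluedCover.developed (drilledCut P f F) (frontier P) f := fun hq =>
    (T.tube_mem_developed (lateralCylinder_subset hq)).2 (mem_sphere_zero_iff_norm.1 hq.1).ge
  have hone : ∀ {z z' : ℂ} {t t' : ℝ}, (z, t) ∈ lateralCylinder → (z', t') ∈ lateralCylinder →
      F (z, t) ∈ frontier P → f (F (z, t)) = F (z', t') →
      t = 1 ∧ t' = 0 ∧ returnMap f F G z = z' := by
    intro z z' t t' hq hq' hfr he
    obtain rfl : t = 1 := (T.tube.mem_right _ (lateralCylinder_subset hq)).1 hfr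
    obtain ⟨h1, h2⟩ :=
      T.returnMap_spec (T.norm_returnMap (mem_sphere_zero_iff_norm.1 hq.1)).1
    rw [← h2] at he
    have := T.tube.injOn (mk_zero_mem_tubeDomain h1) (lateralCylinder_subset hq') he
    rw [Prod.mk.injEq] at this
    exact ⟨rfl, this.2.symm, this.1⟩
  have hback : ∀ {z : ℂ}, (z, (1 : ℝ)) ∈ lateralCylinder →
      p (F (z, 1)) = p (F (returnMap f F G z, 0)) := by
    intro z hq
    rw [(T.returnMap_spec (T.norm_returnMap (mem_sphere_zero_iff_norm.1 hq.1)).1).2,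
      ← hp.apply_zpow (hmem hq) 1, zpow_one]
  constructor
  · intro h
    obtain ⟨n, hn⟩ := (hp.eq_iff _ (hmem hq) _ (hmem hq')).1 h
    rcases T.trapping.eq_of_zpow_eq (T.tube.mapsTo (lateralCylinder_subset hq))
      (T.tube.mapsTo (lateralCylinder_subset hq')) hn with ⟨-, h2⟩ | ⟨-, h2, h3⟩ | ⟨-, h2, h3⟩
    · have := T.tube.injOn (lateralCylinder_subset hq) (lateralCylinder_subset hq') h2
      rw [Prod.mk.injEq] at this
      exact .inl this
    · exact .inr (.inl (hone hq hq' h2 h3))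
    · exact .inr (.inr (hone hq' hq h2 h3))
  · rintro (⟨rfl, rfl⟩ | ⟨rfl, rfl, rfl⟩ | ⟨rfl, rfl, rfl⟩)
    · rfl
    · exact hback hq
    · exact (hback hq').symm

/-- The image of the lateral boundary of the tube is a torus, since the return map preserves the
orientation of the circle. -/
theorem nonempty_homeomorph_torus {M : Type*} [TopologicalSpace M] [T2Space M] {p : S3 → M}
    (hp : IsOrbitMap f (GluedCover.developed (drilledCut P f F) (frontier P) f) p)
    (hf : OrientationPreserving f) :
    Nonempty (p '' (F '' lateralCylinder) ≃ₜ Circle × Circle) := by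
  obtain ⟨ψ, hψ, hmono⟩ := T.exists_angle hf
  have hlat : ∀ q : Circle × unitInterval, ((q.1 : ℂ), (q.2 : ℝ)) ∈ lateralCylinder := fun q =>
    ⟨mem_sphere_zero_iff_norm.2 q.1.norm_coe, q.2.2⟩
  let a : Circle × unitInterval → p '' (F '' lateralCylinder) := fun q =>
    ⟨p (F (q.1, q.2)), _, ⟨_, hlat q, rfl⟩, rfl⟩
  have hmaps : MapsTo F lateralCylinder
      (GluedCover.developed (drilledCut P f F) (frontier P) f) := fun q hq =>
    (T.tube_mem_developed (lateralCylinder_subset hq)).2 (mem_sphere_zero_iff_norm.1 hq.1).ge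
  have hcoe : Continuous fun z : Circle => (z : ℂ) := continuous_subtype_val
  have ha : Continuous a := by
    refine Continuous.subtype_mk ?_ _
    exact (hp.continuousOn.comp (T.tube.continuousOn.mono lateralCylinder_subset)
      hmaps).comp_continuous (by fun_prop) hlat
  have hsa : Function.Surjective a := by
    rintro ⟨_, _, ⟨⟨z, t⟩, hq, rfl⟩, rfl⟩
    exact ⟨(⟨z, hq.1⟩, ⟨t, hq.2⟩), rfl⟩
  refine nonempty_homeomorph_of_eq_iff ha (continuous_twistTorus ψ) hsa
    (surjective_twistTorus ψ) ?_
  rintro ⟨z, t⟩ ⟨z', t'⟩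
  rw [Subtype.ext_iff, twistTorus_eq_iff hmono,
    T.orbitMap_lateral_eq_iff hp (hlat (z, t)) (hlat (z', t')), hψ, hψ]
  simp only [Circle.coe_inj, Subtype.ext_iff, Icc.coe_one, Icc.coe_zero]

theorem isCompactThreeManifold (hf : OrientationPreserving f) [Nonempty (drilledCut P f F)] :
    IsCompactThreeManifoldWithTorusBoundary (Glued (drilledCut P f F) (frontier P) f) := by
  have : Nonempty (Glued (drilledCut P f F) (frontier P) f) :=
    ‹Nonempty (drilledCut P f F)›.map (Quot.mk _)
  have hp := GluedCover.isOrbitMap T.trapping drilledCut_subset T.isClosed_drilledCut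
  set p := GluedCover.orbitMap (drilledCut P f F) (frontier P) f
  have hT2 := GluedCover.t2Space_glued T.trapping (drilledCut_subset (F := F))
  obtain ⟨A, hA, hAf⟩ := hf.exists_atlas
  set B := p '' (F '' lateralCylinder)
  have hmaps : MapsTo F lateralCylinder
      (GluedCover.developed (drilledCut P f F) (frontier P) f) := fun q hq =>
    (T.tube_mem_developed (lateralCylinder_subset hq)).2 (mem_sphere_zero_iff_norm.1 hq.1).ge
  have hB : IsClosed B := by
    rw [show B = (p ∘ F) '' lateralCylinder from (image_comp _ _ _).symm]
    exact (isCompact_lateralCylinder.image_of_continuousOn (hp.continuousOn.comp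
      (T.tube.continuousOn.mono lateralCylinder_subset) hmaps)).isClosed
  have hint : ∀ y ∈ GluedCover.developed (drilledCut P f F) (frontier P) f, p y ∈ Bᶜ →
      GluedCover.developed (drilledCut P f F) (frontier P) f ∈ 𝓝 y := fun y hy hyB =>
    T.developed_mem_nhds hy fun n hn => hyB ⟨_, hn, hp.apply_zpow hy n⟩
  obtain ⟨C, hC⟩ := exists_chartedSpace_boundary_eq (B := B) fun m => by
    by_cases hm : m ∈ B
    · obtain ⟨_, ⟨q, hq, rfl⟩, rfl⟩ := hm
      obtain ⟨c, h1, h2⟩ := T.exists_chart_lateral hp hq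
      exact ⟨c, h1, fun _ => ⟨_, ⟨q, hq, rfl⟩, rfl⟩, fun _ => h2⟩
    · obtain ⟨y, hy, rfl⟩ := hp.surjOn m
      obtain ⟨φ, -, hφ⟩ := hA.1 y
      obtain ⟨c, h1, h2⟩ := hp.exists_chart_of_mem_nhds (hint y hy hm) φ hφ
      exact ⟨c, h1, fun h => absurd h h2.ne', fun h => absurd h hm⟩
  have hC' : (𝓡∂ 3).interior (Glued (drilledCut P f F) (frontier P) f) = Bᶜ := by
    rw [← ModelWithCorners.compl_boundary, hC]
  refine ⟨GluedCover.compactSpace_glued T.isClosed_drilledCut, hT2,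
    GluedCover.secondCountableTopology_glued T.trapping drilledCut_subset T.isClosed_drilledCut,
    C, ?_, ?_⟩
  · rw [hC']
    exact hp.exists_orientedAtlas hA hAf hB.isOpen_compl hint
  · rw [hC]
    exact T.nonempty_homeomorph_torus hp hf

end IsMatchedTube

/-! ### The conclusion -/

theorem IsInfiniteCyclicCover.homeomorph_comp {C B E : Type} [TopologicalSpace C]
    [TopologicalSpace B] [TopologicalSpace E] {p : C → B} {τ : C ≃ₜ C}
    (h : IsInfiniteCyclicCover p τ) (φ : B ≃ₜ E) : IsInfiniteCyclicCover (φ ∘ p) τ := by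
  obtain ⟨h1, h2, h3, h4, h5, h6⟩ := h
  exact ⟨h1, h2.homeomorph_comp φ, φ.surjective.comp h3, fun x => congrArg φ (h4 x),
    fun x y hxy => h5 x y (φ.injective hxy), h6⟩

theorem proposition2p1 (P : Set S3) (hP : IsUnknottedSolidTorus P)
    (f : S3 ≃ₜ S3) (hf : OrientationPreserving f) (hfP : f '' P ⊆ interior P)
    (Γ N : Set S3)
    (hN : IsArcWithRegularNeighborhood (cutRegion P f) (frontier (f '' P)) (frontier P) Γ N)
    (hfN : f '' (frontier P ∩ N) = frontier (f '' P) ∩ N)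
    (Xstar : Set S3) (hX : Xstar = drilledRegion (cutRegion P f) N) :
    IsCompactThreeManifoldWithTorusBoundary (Glued Xstar (frontier P) f) ∧
    (IsInfiniteCyclicCover (GluedCover.proj Xstar (frontier P) f)
        (GluedCover.deck Xstar (frontier P) f) ∧
      DynEmbeds (GluedCover.deck Xstar (frontier P) f) f) ∧
    ∀ K E : Set S3, IsKnotWithExterior K E →
      Nonempty (Glued Xstar (frontier P) f ≃ₜ E) → HasPropertyDIE K := by
  obtain ⟨F, G, hT, rfl⟩ := hN.exists_isTube
  have T : IsMatchedTube P f F G := ⟨⟨hP.isClosed, hfP⟩, hT, hfN⟩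
  obtain rfl : Xstar = drilledCut P f F := hX.trans hT.drilledRegion_eq
  have hsub : drilledCut P f F ⊆ cutRegion P f := drilledCut_subset
  have hconn : IsConnected (drilledCut P f F) := hT.isConnected_drilled
    T.trapping.isClosed_cutRegion
    (T.trapping.isConnected_cutRegion hP.isConnected hP.isConnected_frontier)
  have : Nonempty (drilledCut P f F) := hconn.nonempty.to_subtype
  have h1 : (1 : ℂ) ∈ ball (0 : ℂ) 2 := by
    rw [mem_ball_zero_iff, norm_one]
    exact one_lt_two
  have hx : F (1, 1) ∈ drilledCut P f F :=
    (T.tube_mem_drilledCut (mk_one_mem_tubeDomain h1)).2 norm_one.ge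
  have := GluedCover.connectedSpace hconn hx (T.end_mem h1)
    ((T.apply_mem_drilledCut (T.end_mem h1)).2 hx)
  have hcover := GluedCover.isInfiniteCyclicCover T.trapping hsub
  have hdyn : DynEmbeds (GluedCover.deck (drilledCut P f F) (frontier P) f) f :=
    ⟨_, GluedCover.isEmbedding_dev T.trapping hsub T.isClosed_drilledCut, fun c =>
      (GluedCover.dev_vadd 1 c).trans (by rw [zpow_one])⟩
  refine ⟨T.isCompactThreeManifold hf, ⟨hcover, hdyn⟩, fun K E hK => ?_⟩
  rintro ⟨φ⟩
  exact ⟨E, hK, _, _, _, _, hcover.homeomorph_comp φ, f, hdyn⟩
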